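/- Let $\ell>0$, $\nu\neq 0$, $\mu=3\nu/\ell$, let $s\in\{1,-1\}$, and let $\alpha,c,\tilde k,\delta\in\mathbb R$ with $\alpha\neq\frac32$. Consider a chart $U\subseteq\mathbb R^2$ (an open set) with a smooth metric $\bar g$, Lorentzian if $s=1$ and positive definite if $s=-1$, with Levi-Civita connection $D$ and scalar curvature $\bar R$, and a smooth function $\phi$ on $U$ such that $d\phi$ is a nowhere null conformal Killing one-form of $\bar g$. Let $$f=2s\mu\,\tfrac{1-2\alpha}{2\alpha-3}\,e^{(2\alpha-1)\phi}+\tilde k e^{(4\alpha-4)\phi}+\delta e^{(2\alpha-2)\phi}\ \ (\alpha\neq1),\qquad f=2s\mu e^{\phi}+\tilde k\phi+\delta\ \ (\alpha=1).$$ Call $(U,\bar g,\phi)$ Ansatz data, and say that it solves the reduced equations of topologically massive gravity with constant $c$ if, on $U$, $$\mathbf{F}:\quad c=2s\mu e^{(3-2\alpha)\phi}f+e^{2(1-\alpha)\phi}\bar R-2(\alpha-1)e^{2(1-\alpha)\phi}D^2\phi+3e^{4(1-\alpha)\phi}f^2,$$ $$\mathbf{Dil}:\quad -\tfrac{6}{\ell^2}=e^{-2\alpha\phi}\bar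 R-2(\alpha+1)e^{-2\alpha\phi}D^2\phi-2e^{-2\alpha\phi}|d\phi|^2+\tfrac12e^{(2-4\alpha)\phi}f^2,$$ $$\mathbf{Kink}:\quad 0=D^2e^\phi+\tfrac12e^{(3-2\alpha)\phi}f^2-\tfrac2{\ell^2}e^{(2\alpha+1)\phi}+\tfrac{s}{2\mu}\Big(D^2(e^{(2-2\alpha)\phi}f)+e^{(2-2\alpha)\phi}f\bar R-2(\alpha-1)e^{(2-2\alpha)\phi}fD^2\phi+2e^{(4-4\alpha)\phi}f^3\Big),$$ and (**CKV**) the symmetric traceless part of $$e^{2\alpha\phi}D_a\big(e^{-2\alpha\phi}D_be^\phi\big)+\tfrac{s}{2\mu}e^{2(\alpha-1)\phi}D_a\big(e^{-2(\alpha-1)\phi}D_b(e^{-2(\alpha-1)\phi}f)\big)$$ vanishes. For a smooth one-form $A$ on $U$ with $dA=f\,\mathrm{dvol}_{\bar g}$ let $g=e^{2\alpha\phi}\bar g+s\,e^{2\phi}(dz+A)^2$ on $U\times\mathbb R$, and let $S_a{}^b=R_a{}^b-\frac13R\,\delta_a^b$ be its traceless Ricci tensor. **(I)** Ansatz data with $U\neq\emptyset$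 that solve the reduced equations exist if and only if the parameters are in one of the following three cases: 1. $\delta=0$, $\alpha=\frac12$ ($\tilde k$, $c$ arbitrary); 2. $c=\delta^2$, $\tilde k=\alpha=0$; 3. $\delta=c=\tilde k=0$ and $\mu^2\ell^2(2\alpha+1)^2=(2\alpha-3)^2$. **(II)** In the respective case, Ansatz data solve the reduced equations if and only if, on $U$, 1. $|d\phi|^2=-\frac12(c-2s\mu\tilde k)e^{-\phi}+\frac1{\ell^2}e^{\phi}+\frac14\tilde k^2e^{-3\phi}$; 2. $|d\phi|^2=-\frac23s\mu\delta e^{-\phi}+\frac14\delta^2e^{-2\phi}+\frac3{\ell^2}+\frac{\mu^2}9$; 3. $|d\phi|^2=\frac{4\mu^2}{(2\alpha-3)^2}e^{2\alpha\phi}$. **(III)** For every solution and every such $A$: 1. In case 1, $g$ is locally isometric to AdS$_3$ of radius $\ell$, and $S=0$ (Petrov class O). 2. In case 2 with $\nu^2\neq1$, let $\varepsilon$ be the sign of $s(\nu^2-1)$. Then $g$ is locally isometric to spacelike ($\varepsilon=1$) or timelike ($\varepsilon=-1$) warped AdS$_3$, $$\frac{\ell^2}{\nu^2+3}\Big(\frac{dy^2}{y^2}-\varepsilon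 y^2du^2+\varepsilon\frac{4\nu^2}{\nu^2+3}(dt+y\,du)^2\Big),\qquad y>0,$$ and at every point $S$ has the canonical form $\mathrm{diag}(-2\kappa,\kappa,\kappa)$ with $\kappa=(\nu^2-1)/\ell^2\neq0$ (Petrov class D). 3. In case 3 there is a sign $s_2\in\{1,-1\}$ with $3\nu s_2(2\alpha+1)=2\alpha-3$ such that $g$ is locally isometric to the AdS pp-wave (TMG wave) $$\frac{\ell^2}4\frac{d\rho^2}{\rho^2}+s\,\rho^{\frac12(1-3\nu s_2)}dz^2+\rho\,dz\,dt,\qquad\rho>0,$$ and $g$ has, near every point, two commuting, pointwise linearly independent Killing vector fields. If $\nu\neq\pm\frac13$, then at every point the canonical form of $S$ is the nilpotent matrix with exactly one nonzero entry, in position $(1,2)$ (Petrov class N). If $\nu=\pm\frac13$, then $g$ is locally isometric to AdS$_3$ of radius $\ell$. -/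

import Mathlib

open Real Set Topology
open scoped ContDiff Matrix

noncomputable section

namespace TMG

/-! Tensor calculus in a coordinate chart: the points are coordinate tuples and a metric is
the matrix of its components. -/

/-- The `i`-th partial derivative. -/
def pd {n : ℕ} (i : Fin n) (F : (Fin n → ℝ) → ℝ) (x : Fin n → ℝ) : ℝ :=
  fderiv ℝ F x (Pi.single i 1)

/-- The components `g i j` of a metric, as functions of the coordinates. -/
abbrev MetricField (n : ℕ) := (Fin n → ℝ) → Matrix (Fin n) (Fin n) ℝ

/-- `g` is a smooth pseudo-Riemannian metric on `U`. -/
structure IsMetricOn {n : ℕ} (g : MetricField n) (U : Set (Fin n → ℝ)) : Prop where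
  smooth : ∀ i j, ContDiffOn ℝ ∞ (fun x => g x i j) U
  symm : ∀ x ∈ U, (g x).IsSymm
  nondegenerate : ∀ x ∈ U, (g x).det ≠ 0

/-- The Christoffel symbol `Γ^k_{ij}` of the Levi-Civita connection. -/
def christoffel {n : ℕ} (g : MetricField n) (k i j : Fin n) (x : Fin n → ℝ) : ℝ :=
  (1 / 2) * ∑ l, (g x)⁻¹ k l *
    (pd i (fun y => g y l j) x + pd j (fun y => g y l i) x - pd l (fun y => g y i j) x)

/-- The Ricci tensor
`R_{ij} = ∂_k Γ^k_{ij} - ∂_j Γ^k_{ik} + Γ^k_{kl} Γ^l_{ij} - Γ^k_{jl} Γ^l_{ik}`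
(positive on round spheres). -/
def ricci {n : ℕ} (g : MetricField n) (x : Fin n → ℝ) : Matrix (Fin n) (Fin n) ℝ :=
  Matrix.of fun i j =>
    (∑ k, (pd k (christoffel g k i j) x - pd j (christoffel g k i k) x)) +
      ∑ k, ∑ l, (christoffel g k k l x * christoffel g l i j x -
        christoffel g k j l x * christoffel g l i k x)

/-- The trace `g^{ab} T_{ab}`. -/
def tr {n : ℕ} (g : MetricField n) (x : Fin n → ℝ) (T : Fin n → Fin n → ℝ) : ℝ :=
  ∑ a, ∑ b, (g x)⁻¹ a b * T a b

/-- The scalar curvature. -/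
def scalarCurv {n : ℕ} (g : MetricField n) (x : Fin n → ℝ) : ℝ :=
  tr g x (fun a b => ricci g x a b)

/-- The traceless Ricci tensor with one index raised, `S = g⁻¹ Ric - (R / n) 1`. -/
def tracelessRicci {n : ℕ} (g : MetricField n) (x : Fin n → ℝ) : Matrix (Fin n) (Fin n) ℝ :=
  (g x)⁻¹ * ricci g x - (scalarCurv g x / n) • (1 : Matrix (Fin n) (Fin n) ℝ)

/-- A one-form, given by its components. -/
abbrev OneForm (n : ℕ) := Fin n → (Fin n → ℝ) → ℝ

/-- The differential of a function. -/
def diff {n : ℕ} (F : (Fin n → ℝ) → ℝ) : OneForm n := fun a => pd a F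

/-- The covariant derivative `D_a θ_b` of a one-form. -/
def covD {n : ℕ} (g : MetricField n) (θ : OneForm n) (x : Fin n → ℝ) (a b : Fin n) : ℝ :=
  pd a (θ b) x - ∑ k, christoffel g k a b x * θ k x

/-- The symmetrization `T_{(ab)}`, of strength one. -/
def symPart {n : ℕ} (T : Fin n → Fin n → ℝ) (a b : Fin n) : ℝ := (T a b + T b a) / 2

/-- The symmetric traceless part `T_{(ab)} - (1 / n) g_{ab} T_c^c`. -/
def tracelessPart {n : ℕ} (g : MetricField n) (x : Fin n → ℝ) (T : Fin n → Fin n → ℝ)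
    (a b : Fin n) : ℝ :=
  symPart T a b - (tr g x T / n) * g x a b

/-- The Laplacian (d'Alembertian) `D² F = D_a D^a F`. -/
def laplacian {n : ℕ} (g : MetricField n) (F : (Fin n → ℝ) → ℝ) (x : Fin n → ℝ) : ℝ :=
  tr g x (covD g (diff F) x)

/-- `|dF|² = g^{ab} ∂_a F ∂_b F`. -/
def normSqDiff {n : ℕ} (g : MetricField n) (F : (Fin n → ℝ) → ℝ) (x : Fin n → ℝ) : ℝ :=
  tr g x (fun a b => pd a F x * pd b F x)

/-- `θ` is a conformal Killing one-form of `g` on `U`: `D_{(a} θ_{b)}` is pure trace. -/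
def IsConformalKilling {n : ℕ} (g : MetricField n) (θ : OneForm n) (U : Set (Fin n → ℝ)) : Prop :=
  ∀ x ∈ U, ∀ a b, tracelessPart g x (covD g θ x) a b = 0

/-! The reduced theory. The sign `s = 1` is the reduction on a spacelike direction, where the
two-dimensional metric is Lorentzian, and `s = -1` the reduction on a timelike direction, where it
is positive definite. -/

/-- The geometric Ansatz: a two-dimensional metric `gb` on the chart `U` and a dilaton `φ` such
that `dφ` is a nowhere null conformal Killing one-form. -/
structure IsAnsatz (s : ℝ) (U : Set (Fin 2 → ℝ)) (gb : MetricField 2)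
    (φ : (Fin 2 → ℝ) → ℝ) : Prop where
  isOpen : IsOpen U
  metric : IsMetricOn gb U
  lorentzian : s = 1 → ∀ x ∈ U, (gb x).det < 0
  riemannian : s = -1 → ∀ x ∈ U, (gb x).PosDef
  smooth : ContDiffOn ℝ ∞ φ U
  conformalKilling : IsConformalKilling gb (diff φ) U
  nonnull : ∀ x ∈ U, normSqDiff gb φ x ≠ 0

/-- The function of the dilaton that the Ansatz prescribes for the field strength `f`
(for `α ≠ 3 / 2`). -/
def ansatzF (s μ α kt δ : ℝ) (t : ℝ) : ℝ :=
  if α = 1 then s * 2 * μ * exp t + kt * t + δ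
  else s * 2 * μ * ((1 - 2 * α) / (2 * α - 3)) * exp ((2 * α - 1) * t)
    + kt * exp ((4 * α - 4) * t) + δ * exp ((2 * α - 2) * t)

/-- The tensor whose symmetric traceless part is the CKV equation. -/
def ckvTensor (s μ α : ℝ) (gb : MetricField 2) (φ f : (Fin 2 → ℝ) → ℝ) (x : Fin 2 → ℝ)
    (a b : Fin 2) : ℝ :=
  exp (2 * α * φ x) *
      covD gb (fun b y => exp (-(2 * α) * φ y) * pd b (fun w => exp (φ w)) y) x a b
    + s / (2 * μ) * (exp (2 * (α - 1) * φ x) *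
      covD gb (fun b y => exp (-(2 * (α - 1)) * φ y) *
        pd b (fun w => exp (-(2 * (α - 1)) * φ w) * f w) y) x a b)

/-- The Kaluza-Klein reduced equations of topologically massive gravity on `U`, with the constant
of integration `c`. -/
structure ReducedTMG (s ℓ μ α c : ℝ) (U : Set (Fin 2 → ℝ)) (gb : MetricField 2)
    (φ f : (Fin 2 → ℝ) → ℝ) : Prop where
  eqF : ∀ x ∈ U,
    c = s * 2 * μ * exp ((-2 * α + 3) * φ x) * f x
      + exp (2 * (1 - α) * φ x) * scalarCurv gb x
      - 2 * (α - 1) * exp (2 * (1 - α) * φ x) * laplacian gb φ x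
      + 3 * exp (4 * (1 - α) * φ x) * f x ^ 2
  eqDil : ∀ x ∈ U,
    -6 / ℓ ^ 2 = exp (-2 * α * φ x) * scalarCurv gb x
      - 2 * (α + 1) * exp (-2 * α * φ x) * laplacian gb φ x
      - 2 * exp (-2 * α * φ x) * normSqDiff gb φ x
      + 1 / 2 * exp ((-4 * α + 2) * φ x) * f x ^ 2
  eqKink : ∀ x ∈ U,
    0 = laplacian gb (fun y => exp (φ y)) x
      + 1 / 2 * exp ((-2 * α + 3) * φ x) * f x ^ 2
      - 2 / ℓ ^ 2 * exp ((2 * α + 1) * φ x)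
      + s / (2 * μ) * (laplacian gb (fun y => exp ((-2 * α + 2) * φ y) * f y) x
        + exp ((-2 * α + 2) * φ x) * f x * scalarCurv gb x
        - 2 * (α - 1) * exp ((-2 * α + 2) * φ x) * f x * laplacian gb φ x
        + 2 * exp ((-4 * α + 4) * φ x) * f x ^ 3)
  eqCKV : ∀ x ∈ U, ∀ a b, tracelessPart gb x (ckvTensor s μ α gb φ f x) a b = 0

/-- The parameters of the first case. -/
def Case1 (α δ : ℝ) : Prop := δ = 0 ∧ α = 1 / 2

/-- The parameters of the second case. -/
def Case2 (α c kt δ : ℝ) : Prop := c = δ ^ 2 ∧ kt = 0 ∧ α = 0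

/-- The parameters of the third case. -/
def Case3 (ℓ μ α c kt δ : ℝ) : Prop :=
  δ = 0 ∧ c = 0 ∧ kt = 0 ∧ μ ^ 2 * ℓ ^ 2 * (2 * α + 1) ^ 2 = (2 * α - 3) ^ 2

/-- `|dφ|²` as a function of the dilaton in the first case. -/
def profile1 (s ℓ μ c kt : ℝ) (t : ℝ) : ℝ :=
  -(1 / 2) * (c - s * 2 * μ * kt) * exp (-t) + 1 / ℓ ^ 2 * exp t + 1 / 4 * kt ^ 2 * exp (-3 * t)

/-- `|dφ|²` as a function of the dilaton in the second case. -/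
def profile2 (s ℓ μ δ : ℝ) (t : ℝ) : ℝ :=
  -(s * (2 / 3) * μ * δ * exp (-t)) + 1 / 4 * δ ^ 2 * exp (-2 * t) + (3 / ℓ ^ 2 + μ ^ 2 / 9)

/-- `|dφ|²` as a function of the dilaton in the third case. -/
def profile3 (μ α : ℝ) (t : ℝ) : ℝ :=
  4 * μ ^ 2 / (2 * α - 3) ^ 2 * exp (2 * α * t)

/-- `A` is a smooth one-form on `U` with `dA = f dvol`. -/
structure IsPotential (U : Set (Fin 2 → ℝ)) (gb : MetricField 2) (f : (Fin 2 → ℝ) → ℝ)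
    (A : OneForm 2) : Prop where
  smooth : ∀ a, ContDiffOn ℝ ∞ (A a) U
  curl : ∀ x ∈ U, pd 0 (A 1) x - pd 1 (A 0) x = f x * √|(gb x).det|

/-- The part of the coordinates `(x⁰, x¹, z)` that the fields depend on. -/
def base (p : Fin 3 → ℝ) : Fin 2 → ℝ := ![p 0, p 1]

/-- The coordinate domain of the three-dimensional metric. -/
def cylinder (U : Set (Fin 2 → ℝ)) : Set (Fin 3 → ℝ) := {p | base p ∈ U}

/-- The three-dimensional metric `e^{2αφ} gb + s e^{2φ} (dz + A)²`. -/
def kkMetric (s α : ℝ) (gb : MetricField 2) (φ : (Fin 2 → ℝ) → ℝ) (A : OneForm 2) :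
    MetricField 3 := fun p =>
  let x := base p
  let E := exp (2 * α * φ x)
  let W := s * exp (2 * φ x)
  !![E * gb x 0 0 + W * (A 0 x * A 0 x), E * gb x 0 1 + W * (A 0 x * A 1 x), W * A 0 x;
     E * gb x 1 0 + W * (A 1 x * A 0 x), E * gb x 1 1 + W * (A 1 x * A 1 x), W * A 1 x;
     W * A 0 x, W * A 1 x, W]

/-! Comparison of three-dimensional metrics. -/

/-- The Jacobian matrix. -/
def jac {m n : ℕ} (Φ : (Fin n → ℝ) → Fin m → ℝ) (x : Fin n → ℝ) : Matrix (Fin m) (Fin n) ℝ :=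
  Matrix.of fun a i => pd i (fun y => Φ y a) x

/-- The diffeomorphism `Φ` between open sets is an isometry from `g` to `h`. -/
structure IsLocalIsometry {n : ℕ} (Φ : OpenPartialHomeomorph (Fin n → ℝ) (Fin n → ℝ))
    (g h : MetricField n) : Prop where
  smooth : ContDiffOn ℝ ∞ Φ Φ.source
  smooth_symm : ContDiffOn ℝ ∞ Φ.symm Φ.target
  pullback : ∀ x ∈ Φ.source, g x = (jac Φ x)ᵀ * h (Φ x) * jac Φ x

/-- Every point of `W` has a neighbourhood on which `g` is isometric to `h` on an open part
of `V`. -/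
def LocallyIsometric {n : ℕ} (g : MetricField n) (W : Set (Fin n → ℝ))
    (h : MetricField n) (V : Set (Fin n → ℝ)) : Prop :=
  ∀ p ∈ W, ∃ Φ : OpenPartialHomeomorph (Fin n → ℝ) (Fin n → ℝ),
    p ∈ Φ.source ∧ Φ.source ⊆ W ∧ Φ.target ⊆ V ∧ IsLocalIsometry Φ g h

/-- The flat metric of signature `(-, -, +, +)`. -/
def flat22 : Matrix (Fin 4) (Fin 4) ℝ := Matrix.diagonal ![-1, -1, 1, 1]

/-- `g` is locally AdS₃ of radius `ℓ`: near every point there is an isometric map into the quadric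
`-X₀² - X₁² + X₂² + X₃² = -ℓ²` of `ℝ^{2,2}`. As the quadric is three-dimensional and `g` is
nondegenerate, such a map is a local diffeomorphism onto an open part of AdS₃. -/
def LocallyAdS3 (ℓ : ℝ) (g : MetricField 3) (W : Set (Fin 3 → ℝ)) : Prop :=
  ∀ p ∈ W, ∃ N : Set (Fin 3 → ℝ), IsOpen N ∧ p ∈ N ∧ N ⊆ W ∧
    ∃ X : (Fin 3 → ℝ) → Fin 4 → ℝ, ContDiffOn ℝ ∞ X N ∧
      (∀ x ∈ N, X x ⬝ᵥ (flat22 *ᵥ X x) = -ℓ ^ 2) ∧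
      ∀ x ∈ N, g x = (jac X x)ᵀ * flat22 * jac X x

/-- Spacelike (`ε = 1`) or timelike (`ε = -1`) warped AdS₃ in the coordinates `(y, u, t)`,
`ℓ² / (ν² + 3) (dy² / y² - ε y² du² + ε (4 ν² / (ν² + 3)) (dt + y du)²)`, for `y > 0`. -/
def warpedAdS3 (ℓ ν ε : ℝ) : MetricField 3 := fun p =>
  let y := p 0
  let w := 4 * ν ^ 2 / (ν ^ 2 + 3)
  (ℓ ^ 2 / (ν ^ 2 + 3)) •
    !![1 / y ^ 2, 0, 0;
       0, -(ε * y ^ 2) + ε * w * y ^ 2, ε * w * y;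
       0, ε * w * y, ε * w]

/-- The AdS pp-wave in the coordinates `(ρ, z, t)`,
`(ℓ² / 4) dρ² / ρ² + s₁ ρ^{(1 - 3 ν s₂) / 2} dz² + ρ dz dt`, for `ρ > 0`. -/
def ppWave (ℓ ν s₁ s₂ : ℝ) : MetricField 3 := fun p =>
  let ρ := p 0
  !![ℓ ^ 2 / 4 / ρ ^ 2, 0, 0;
     0, s₁ * ρ ^ ((1 - 3 * ν * s₂) / 2), ρ / 2;
     0, ρ / 2, 0]

/-- The coordinate domain of the two previous metrics. -/
def halfSpace : Set (Fin 3 → ℝ) := {p | 0 < p 0}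

/-- At every point of `W` the canonical form of the traceless Ricci tensor `S_a^b` is `J`. The
canonical form does not depend on the coordinates in which the components of the tensor are
computed; here they may be computed in any local coordinate system `Φ` about the point, in which
the metric has the components `h`. -/
def HasCanonicalForm (g : MetricField 3) (W : Set (Fin 3 → ℝ)) (J : Matrix (Fin 3) (Fin 3) ℝ) :
    Prop :=
  ∀ p ∈ W, ∃ (Φ : OpenPartialHomeomorph (Fin 3 → ℝ) (Fin 3 → ℝ)) (h : MetricField 3),
    p ∈ Φ.source ∧ IsLocalIsometry Φ g h ∧
      ∃ Q : Matrix (Fin 3) (Fin 3) ℝ, IsUnit Q.det ∧ tracelessRicci h (Φ p) * Q = Q * J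

/-- Petrov class O. -/
def PetrovO (g : MetricField 3) (W : Set (Fin 3 → ℝ)) : Prop := HasCanonicalForm g W 0

/-- Petrov class D, with the eigenvalues `-2κ, κ, κ`. -/
def PetrovD (κ : ℝ) (g : MetricField 3) (W : Set (Fin 3 → ℝ)) : Prop :=
  κ ≠ 0 ∧ HasCanonicalForm g W (Matrix.diagonal ![-2 * κ, κ, κ])

/-- Petrov class N. -/
def PetrovN (g : MetricField 3) (W : Set (Fin 3 → ℝ)) : Prop :=
  HasCanonicalForm g W !![0, 1, 0; 0, 0, 0; 0, 0, 0]

/-- `K` is a Killing vector field of `g` on `N`: the Lie derivative of `g` along `K` vanishes. -/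
def IsKilling {n : ℕ} (g : MetricField n) (K : (Fin n → ℝ) → Fin n → ℝ)
    (N : Set (Fin n → ℝ)) : Prop :=
  ∀ x ∈ N, ∀ i j, ∑ k, (K x k * pd k (fun y => g y i j) x
    + g x k j * pd i (fun y => K y k) x + g x i k * pd j (fun y => K y k) x) = 0

/-- Near every point of `W` there are two commuting, pointwise linearly independent Killing
vector fields. -/
def HasTwoCommutingIsometries (g : MetricField 3) (W : Set (Fin 3 → ℝ)) : Prop :=
  ∀ p ∈ W, ∃ N : Set (Fin 3 → ℝ), IsOpen N ∧ p ∈ N ∧ N ⊆ W ∧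
    ∃ K L : (Fin 3 → ℝ) → Fin 3 → ℝ,
      ContDiffOn ℝ ∞ K N ∧ ContDiffOn ℝ ∞ L N ∧ IsKilling g K N ∧ IsKilling g L N ∧
      (∀ x ∈ N, VectorField.lieBracket ℝ K L x = 0) ∧
      ∀ x ∈ N, LinearIndependent ℝ ![K x, L x]

end TMG

end

/-! # Kaluza-Klein reduction of topologically massive gravity

As `dφ` is a conformal Killing one-form, the Hessian of the dilaton is pure trace. Two consequences
govern everything: `d|dφ|² = (D²φ) dφ` (`IsAnsatz.pd_normSqDiff`), and the Ricci identity
`R dφ = -d(D²φ)` (`IsAnsatz.scalarCurv_mul_diff`). The CKV equation holds identically, because for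
the prescribed `f` the coefficients of `dφ ⊗ dφ` in its two terms cancel, and the three other
equations become linear in `|dφ|²`, `D²φ` and `R` with coefficients that are functions of the
dilaton (`IsAnsatz.reducedTMG_iff`).

*Consistency.* Two of these equations give `R - a D²φ` and `4 D²φ + 2 |dφ|²` as functions of the
dilaton. Differentiating them determines `D²φ`, and leaves a relation between the dilaton and the
parameters (`IsAnsatz.compatibility`). The dilaton takes all values in an open interval, so that the
relation is a linear dependence between exponentials, and all coefficients vanish
(`IsAnsatz.consistency_ne_one`, `IsAnsatz.consistency_one`). In the three cases that remain the
equations determine `|dφ|²`. Conversely, if `|dφ|²` is a function `n` of the dilaton, then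
`D²φ = n'` and `R = -n''` (`IsAnsatz.of_profile`), and the equations can be verified; the static
metrics `dt² / n - s n dx²` with `φ = t` are examples.

*Geometry.* The one-form `*dφ / |dφ|²` is closed. Its potential `ψ` and the dilaton are coordinates
in which the two-dimensional metric is static, and a gauge transformation makes `A` a multiple of
`dψ`, so that the three-dimensional metric takes a normal form that depends on the dilaton only
(`IsAnsatz.exists_pullsBack_kkModel`). It has the shape `d dτ² + a du² + 2 b du dv + c dv²`, with
`a`, `b`, `c` functions of `τ`. In the first two cases `u` and `v` are the parameters of
one-parameter subgroups of `SL(2, ℝ)` acting from the left and from the right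
(`exists_isSL2Chart`): the metric `-det dM` of AdS₃ and, for warped AdS₃, the square of a left
invariant one-form have constant components along these directions, and the remaining function of
`τ` is matched to the dilaton. In the third case `τ` is a multiple of the dilaton and the metric is
the pp-wave at once. The Petrov classes follow from the Ricci tensor of metrics of this shape
(`ricci_blockMetric`), and the Killing vector fields are `∂_u` and `∂_v`. -/

namespace TMG

/-! ### Partial derivatives -/

lemma pd_congr {n : ℕ} {i : Fin n} {F G : (Fin n → ℝ) → ℝ} {x : Fin n → ℝ}
    (h : F =ᶠ[𝓝 x] G) : pd i F x = pd i G x := by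
  simp only [pd, h.fderiv_eq]

lemma pd_congr_on {n : ℕ} {i : Fin n} {F G : (Fin n → ℝ) → ℝ} {x : Fin n → ℝ}
    {U : Set (Fin n → ℝ)} (hU : IsOpen U) (h : ∀ y ∈ U, F y = G y) (hx : x ∈ U) :
    pd i F x = pd i G x :=
  pd_congr (Filter.eventuallyEq_of_mem (hU.mem_nhds hx) h)

@[simp] lemma pd_const {n : ℕ} (i : Fin n) (c : ℝ) (x : Fin n → ℝ) :
    pd i (fun _ => c) x = 0 := by
  simp [pd]

lemma pd_add {n : ℕ} {i : Fin n} {F G : (Fin n → ℝ) → ℝ} {x : Fin n → ℝ}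
    (hF : DifferentiableAt ℝ F x) (hG : DifferentiableAt ℝ G x) :
    pd i (fun y => F y + G y) x = pd i F x + pd i G x := by
  simp [pd, fderiv_fun_add hF hG]

lemma pd_sub {n : ℕ} {i : Fin n} {F G : (Fin n → ℝ) → ℝ} {x : Fin n → ℝ}
    (hF : DifferentiableAt ℝ F x) (hG : DifferentiableAt ℝ G x) :
    pd i (fun y => F y - G y) x = pd i F x - pd i G x := by
  simp [pd, fderiv_fun_sub hF hG]

lemma pd_mul {n : ℕ} {i : Fin n} {F G : (Fin n → ℝ) → ℝ} {x : Fin n → ℝ}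
    (hF : DifferentiableAt ℝ F x) (hG : DifferentiableAt ℝ G x) :
    pd i (fun y => F y * G y) x = pd i F x * G x + F x * pd i G x := by
  simp only [pd, fderiv_fun_mul hF hG]
  simp
  ring

lemma pd_sum {n : ℕ} {ι : Type*} {i : Fin n} (u : Finset ι) {F : ι → (Fin n → ℝ) → ℝ}
    {x : Fin n → ℝ} (hF : ∀ j ∈ u, DifferentiableAt ℝ (F j) x) :
    pd i (fun y => ∑ j ∈ u, F j y) x = ∑ j ∈ u, pd i (F j) x := by
  simp [pd, fderiv_fun_sum hF]

lemma pd_comp {n : ℕ} {i : Fin n} {F : (Fin n → ℝ) → ℝ} {h : ℝ → ℝ} {h' : ℝ}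
    {x : Fin n → ℝ} (hh : HasDerivAt h h' (F x)) (hF : DifferentiableAt ℝ F x) :
    pd i (fun y => h (F y)) x = h' * pd i F x := by
  have := (hh.comp_hasFDerivAt x hF.hasFDerivAt).fderiv
  simp only [pd]
  rw [show (fun y => h (F y)) = h ∘ F from rfl, this]
  simp

/-- The chain rule for partial derivatives. -/
lemma pd_comp_map {n m : ℕ} {i : Fin n} {F : (Fin m → ℝ) → ℝ} {Ψ : (Fin n → ℝ) → Fin m → ℝ}
    {x : Fin n → ℝ} (hF : DifferentiableAt ℝ F (Ψ x)) (hΨ : DifferentiableAt ℝ Ψ x) :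
    pd i (fun y => F (Ψ y)) x = ∑ k, pd k F (Ψ x) * pd i (fun y => Ψ y k) x := by
  have h1 : fderiv ℝ (fun y => F (Ψ y)) x = (fderiv ℝ F (Ψ x)).comp (fderiv ℝ Ψ x) :=
    fderiv_comp x hF hΨ
  have h2 : ∀ k, pd i (fun y => Ψ y k) x = fderiv ℝ Ψ x (Pi.single i 1) k := fun k => by
    simp only [pd]
    have h := (hasFDerivAt_pi'.1 hΨ.hasFDerivAt k).fderiv
    rw [h]
    rfl
  simp only [h2]
  simp only [pd, h1, ContinuousLinearMap.comp_apply]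
  conv_lhs => rw [← Finset.univ_sum_single (fderiv ℝ Ψ x (Pi.single i 1)), map_sum]
  refine Finset.sum_congr rfl fun k _ => ?_
  have : (Pi.single k (fderiv ℝ Ψ x (Pi.single i 1) k) : Fin m → ℝ)
      = (fderiv ℝ Ψ x (Pi.single i 1) k) • Pi.single k 1 := by
    rw [← Pi.single_smul]; simp
  rw [this, map_smul, smul_eq_mul, mul_comm]

/-- The differential in terms of the partial derivatives. -/
lemma fderiv_eq_sum_pd {n : ℕ} (F : (Fin n → ℝ) → ℝ) (x v : Fin n → ℝ) :
    fderiv ℝ F x v = ∑ k, pd k F x * v k := by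
  conv_lhs => rw [← Finset.univ_sum_single v, map_sum]
  refine Finset.sum_congr rfl fun k _ => ?_
  have : (Pi.single k (v k) : Fin n → ℝ) = v k • Pi.single k 1 := by
    rw [← Pi.single_smul]; simp
  rw [this, map_smul, smul_eq_mul, mul_comm, pd]

lemma contDiffOn_pd {n : ℕ} {i : Fin n} {F : (Fin n → ℝ) → ℝ} {U : Set (Fin n → ℝ)}
    (hU : IsOpen U) (hF : ContDiffOn ℝ ∞ F U) : ContDiffOn ℝ ∞ (pd i F) U :=
  ((contDiffOn_infty_iff_fderiv_of_isOpen hU).1 hF).2.clm_apply contDiffOn_const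

lemma diffAt_of_smooth {n : ℕ} {E : Type*} [NormedAddCommGroup E] [NormedSpace ℝ E]
    {F : (Fin n → ℝ) → E} {U : Set (Fin n → ℝ)}
    {x : Fin n → ℝ} (hU : IsOpen U) (hF : ContDiffOn ℝ ∞ F U) (hx : x ∈ U) :
    DifferentiableAt ℝ F x :=
  (hF.contDiffAt (hU.mem_nhds hx)).differentiableAt (by simp)

lemma pd_pd_comm {n : ℕ} {i j : Fin n} {F : (Fin n → ℝ) → ℝ} {U : Set (Fin n → ℝ)}
    {x : Fin n → ℝ} (hU : IsOpen U) (hF : ContDiffOn ℝ ∞ F U) (hx : x ∈ U) :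
    pd i (pd j F) x = pd j (pd i F) x := by
  have hs : IsSymmSndFDerivAt ℝ F x :=
    (hF.contDiffAt (hU.mem_nhds hx)).isSymmSndFDerivAt (by
      rw [minSmoothness_of_isRCLikeNormedField]; exact WithTop.coe_le_coe.2 le_top)
  have hd : DifferentiableAt ℝ (fderiv ℝ F) x :=
    diffAt_of_smooth hU ((contDiffOn_infty_iff_fderiv_of_isOpen hU).1 hF).2 hx
  have key : ∀ v w : Fin n → ℝ,
      fderiv ℝ (fun y => fderiv ℝ F y v) x w = fderiv ℝ (fderiv ℝ F) x w v := fun v w => by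
    rw [fderiv_clm_apply hd (differentiableAt_const v)]
    simp
  simp only [pd]
  exact (key _ _).trans ((hs _ _).trans (key _ _).symm)

lemma pd_coord {n : ℕ} (i j : Fin n) (x : Fin n → ℝ) :
    pd i (fun y => y j) x = if i = j then 1 else 0 := by
  have : fderiv ℝ (fun y : Fin n → ℝ => y j) x = ContinuousLinearMap.proj j :=
    (ContinuousLinearMap.proj (R := ℝ) (φ := fun _ : Fin n => ℝ) j).hasFDerivAt.fderiv
  rw [pd, this]
  simp [Pi.single_apply, eq_comm]

lemma pd_comp_coord {n : ℕ} (i j : Fin n) {x : Fin n → ℝ} {F : ℝ → ℝ} {F' : ℝ}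
    (hF : HasDerivAt F F' (x j)) :
    pd i (fun y => F (y j)) x = if i = j then F' else 0 := by
  rw [pd_comp (F := fun y : Fin n → ℝ => y j) hF (by fun_prop), pd_coord]
  split_ifs <;> simp

/-- `F` is differentiable at `x`, with `i`-th partial derivative `F'`. -/
def HasPd {n : ℕ} (i : Fin n) (F : (Fin n → ℝ) → ℝ) (F' : ℝ) (x : Fin n → ℝ) : Prop :=
  DifferentiableAt ℝ F x ∧ pd i F x = F'

namespace HasPd

variable {n : ℕ} {i : Fin n} {F G : (Fin n → ℝ) → ℝ} {F' G' : ℝ} {x : Fin n → ℝ}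

lemma of_diff (h : DifferentiableAt ℝ F x) : HasPd i F (pd i F x) x := ⟨h, rfl⟩

lemma const (c : ℝ) : HasPd i (fun _ => c) 0 x := ⟨by fun_prop, pd_const _ _ _⟩

lemma add (hF : HasPd i F F' x) (hG : HasPd i G G' x) :
    HasPd i (fun y => F y + G y) (F' + G') x :=
  ⟨hF.1.add hG.1, by rw [pd_add hF.1 hG.1, hF.2, hG.2]⟩

lemma sub (hF : HasPd i F F' x) (hG : HasPd i G G' x) :
    HasPd i (fun y => F y - G y) (F' - G') x :=
  ⟨hF.1.sub hG.1, by rw [pd_sub hF.1 hG.1, hF.2, hG.2]⟩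

lemma mul (hF : HasPd i F F' x) (hG : HasPd i G G' x) :
    HasPd i (fun y => F y * G y) (F' * G x + F x * G') x :=
  ⟨hF.1.mul hG.1, by rw [pd_mul hF.1 hG.1, hF.2, hG.2]⟩

lemma const_mul (c : ℝ) (hF : HasPd i F F' x) : HasPd i (fun y => c * F y) (c * F') x := by
  simpa using (HasPd.const c).mul hF

lemma comp {h : ℝ → ℝ} {h' : ℝ} (hh : HasDerivAt h h' (F x)) (hF : HasPd i F F' x) :
    HasPd i (fun y => h (F y)) (h' * F') x :=
  ⟨hh.differentiableAt.comp x hF.1, by rw [pd_comp hh hF.1, hF.2]⟩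

lemma inv (hF : HasPd i F F' x) (h0 : F x ≠ 0) :
    HasPd i (fun y => (F y)⁻¹) (-(F x ^ 2)⁻¹ * F') x :=
  HasPd.comp (hasDerivAt_inv h0) hF

end HasPd

/-! ### Two-dimensional metrics -/

lemma inv_two_apply (A : Matrix (Fin 2) (Fin 2) ℝ) :
    A⁻¹ 0 0 = A 1 1 / A.det ∧ A⁻¹ 0 1 = -A 0 1 / A.det ∧ A⁻¹ 1 0 = -A 1 0 / A.det ∧
      A⁻¹ 1 1 = A 0 0 / A.det := by
  rw [Matrix.inv_def, Matrix.adjugate_fin_two, Ring.inverse_eq_inv']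
  refine ⟨?_, ?_, ?_, ?_⟩ <;> simp [div_eq_inv_mul]

section Surface

variable {U : Set (Fin 2 → ℝ)} {g : MetricField 2} {x : Fin 2 → ℝ}

lemma IsMetricOn.det_eq (hg : IsMetricOn g U) (hx : x ∈ U) :
    (g x).det = g x 0 0 * g x 1 1 - g x 0 1 * g x 0 1 := by
  rw [Matrix.det_fin_two, (hg.symm x hx).apply 0 1]

lemma IsMetricOn.contDiffOn_det (hg : IsMetricOn g U) :
    ContDiffOn ℝ ∞ (fun y => (g y).det) U := by
  simp only [Matrix.det_fin_two]
  exact ((hg.smooth 0 0).mul (hg.smooth 1 1)).sub ((hg.smooth 0 1).mul (hg.smooth 1 0))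

lemma IsMetricOn.contDiffOn_inv (hg : IsMetricOn g U) (a b : Fin 2) :
    ContDiffOn ℝ ∞ (fun y => (g y)⁻¹ a b) U := by
  have hd := hg.contDiffOn_det
  have h := fun y => inv_two_apply (g y)
  match a, b with
  | 0, 0 => simp only [(h _).1]; exact (hg.smooth 1 1).div hd hg.nondegenerate
  | 0, 1 => simp only [(h _).2.1]; exact (hg.smooth 0 1).neg.div hd hg.nondegenerate
  | 1, 0 => simp only [(h _).2.2.1]; exact (hg.smooth 1 0).neg.div hd hg.nondegenerate
  | 1, 1 => simp only [(h _).2.2.2]; exact (hg.smooth 0 0).div hd hg.nondegenerate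

lemma IsMetricOn.contDiffOn_christoffel (hU : IsOpen U) (hg : IsMetricOn g U) (k i j : Fin 2) :
    ContDiffOn ℝ ∞ (christoffel g k i j) U := by
  unfold christoffel
  refine contDiffOn_const.mul (ContDiffOn.sum fun l _ => (hg.contDiffOn_inv k l).mul ?_)
  exact ((contDiffOn_pd hU (hg.smooth l j)).add (contDiffOn_pd hU (hg.smooth l i))).sub
    (contDiffOn_pd hU (hg.smooth i j))

lemma IsMetricOn.pd_symm (hU : IsOpen U) (hg : IsMetricOn g U) (hx : x ∈ U) (c i j : Fin 2) :
    pd c (fun y => g y i j) x = pd c (fun y => g y j i) x :=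
  pd_congr_on hU (fun y hy => (hg.symm y hy).apply j i) hx

lemma IsMetricOn.christoffel_symm (hU : IsOpen U) (hg : IsMetricOn g U) (hx : x ∈ U)
    (k i j : Fin 2) : christoffel g k i j x = christoffel g k j i x := by
  unfold christoffel
  congr 1
  refine Finset.sum_congr rfl fun l _ => ?_
  rw [hg.pd_symm hU hx l i j]
  ring

/-- The Christoffel symbols with all indices lowered. -/
lemma IsMetricOn.christoffel_lower (hg : IsMetricOn g U) (hx : x ∈ U) (m i j : Fin 2) :
    g x m 0 * christoffel g 0 i j x + g x m 1 * christoffel g 1 i j x =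
      (1 / 2) * (pd i (fun y => g y m j) x + pd j (fun y => g y m i) x
        - pd m (fun y => g y i j) x) := by
  have h := inv_two_apply (g x)
  have hd := hg.nondegenerate x hx
  have hdet := hg.det_eq hx
  have hs : g x 1 0 = g x 0 1 := (hg.symm x hx).apply 0 1
  simp only [christoffel, Fin.sum_univ_two, h, hs]
  match m with
  | 0 => field_simp; rw [hdet]; ring
  | 1 => simp only [hs]; field_simp; rw [hdet]; ring

/-- The linear algebra behind `scalarCurv_mul_diff`: `M k i` stands for the curvature operator
`R^k_{i10}`, and `X` for the gradient, with the lowered components `φ`. -/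
lemma scalarCurv_algebra {E F G d R R00 R01 R10 R11 M00 M01 M10 M11 X0 X1 φ0 φ1 l0 l1 : ℝ}
    (hd : d = E * G - F * F) (hd0 : d ≠ 0)
    (hR : R = (G * R00 - F * R01 - F * R10 + E * R11) / d)
    (h00 : R00 = M10) (h01 : R01 = -M00) (h10 : R10 = M11) (h11 : R11 = -M01)
    (hφ0 : φ0 = E * X0 + F * X1) (hφ1 : φ1 = F * X0 + G * X1)
    (a0 : E * M00 + F * M10 = 0) (a1 : F * M01 + G * M11 = 0)
    (a2 : E * M01 + F * M11 + F * M00 + G * M10 = 0)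
    (e0 : M00 * φ0 + M10 * φ1 = (l0 * F - l1 * E) / 2)
    (e1 : M01 * φ0 + M11 * φ1 = (l0 * G - l1 * F) / 2) :
    R * φ0 = -l0 ∧ R * φ1 = -l1 := by
  -- the single independent component of the lowered curvature tensor
  obtain ⟨ρ, hρ⟩ : ∃ ρ, ρ = F * M00 + G * M10 := ⟨_, rfl⟩
  have hRρ : R * d = 2 * ρ := by
    rw [hR, h00, h01, h10, h11, hρ]; field_simp; linear_combination -a2
  have f0 : ρ * X1 = (l0 * F - l1 * E) / 2 := by
    rw [← e0, hφ0, hφ1, hρ]; linear_combination -X0 * a0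
  have f1 : -(ρ * X0) = (l0 * G - l1 * F) / 2 := by
    rw [← e1, hφ0, hφ1, hρ]; linear_combination -X1 * a1 - X0 * a2
  constructor
  · apply mul_right_cancel₀ hd0
    calc R * φ0 * d = 2 * ρ * φ0 := by rw [← hRρ]; ring
      _ = -l0 * d := by rw [hφ0, hd]; linear_combination 2 * F * f0 - 2 * E * f1
  · apply mul_right_cancel₀ hd0
    calc R * φ1 * d = 2 * ρ * φ1 := by rw [← hRρ]; ring
      _ = -l1 * d := by rw [hφ1, hd]; linear_combination 2 * G * f0 - 2 * F * f1

lemma IsMetricOn.tr_eq (hg : IsMetricOn g U) (hx : x ∈ U) (T : Fin 2 → Fin 2 → ℝ) :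
    tr g x T = (g x 1 1 * T 0 0 - g x 0 1 * T 0 1 - g x 0 1 * T 1 0 + g x 0 0 * T 1 1)
      / (g x).det := by
  have h := inv_two_apply (g x)
  have hs : g x 1 0 = g x 0 1 := (hg.symm x hx).apply 0 1
  simp only [tr, Fin.sum_univ_two, h, hs]
  ring

lemma IsMetricOn.pd_eq_christoffel (hU : IsOpen U) (hg : IsMetricOn g U) (hx : x ∈ U)
    (c : Fin 2) :
    pd c (fun y => g y 0 0) x = 2 * (g x 0 0 * christoffel g 0 c 0 x
      + g x 0 1 * christoffel g 1 c 0 x) ∧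
    pd c (fun y => g y 0 1) x = g x 0 0 * christoffel g 0 c 1 x + g x 0 1 * christoffel g 1 c 1 x
      + g x 0 1 * christoffel g 0 c 0 x + g x 1 1 * christoffel g 1 c 0 x ∧
    pd c (fun y => g y 1 1) x = 2 * (g x 0 1 * christoffel g 0 c 1 x
      + g x 1 1 * christoffel g 1 c 1 x) := by
  have hs : g x 1 0 = g x 0 1 := (hg.symm x hx).apply 0 1
  have l00 := hg.christoffel_lower hx 0 c 0
  have l01 := hg.christoffel_lower hx 0 c 1
  have l10 := hg.christoffel_lower hx 1 c 0
  have l11 := hg.christoffel_lower hx 1 c 1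
  rw [hg.pd_symm hU hx 0 c 0] at l00
  rw [hg.pd_symm hU hx 0 c 1, hg.pd_symm hU hx 1 0 c] at *
  rw [hg.pd_symm hU hx 1 c 1, hg.pd_symm hU hx c 1 0, hs] at *
  exact ⟨by linear_combination -2 * l00, by linear_combination -l01 - l10,
    by linear_combination -2 * l11⟩

/-- The derivative of the lowered Christoffel symbols. -/
lemma IsMetricOn.pd_christoffel_lower (hU : IsOpen U) (hg : IsMetricOn g U) (hx : x ∈ U)
    (m i j c : Fin 2) :
    g x m 0 * pd c (christoffel g 0 i j) x + g x m 1 * pd c (christoffel g 1 i j) x =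
      (1 / 2) * (pd c (pd i (fun y => g y m j)) x + pd c (pd j (fun y => g y m i)) x
        - pd c (pd m (fun y => g y i j)) x)
      - pd c (fun y => g y m 0) x * christoffel g 0 i j x
      - pd c (fun y => g y m 1) x * christoffel g 1 i j x := by
  have dg : ∀ a b, DifferentiableAt ℝ (fun y => g y a b) x :=
    fun a b => diffAt_of_smooth hU (hg.smooth a b) hx
  have dp : ∀ e a b, DifferentiableAt ℝ (pd e (fun y => g y a b)) x :=
    fun e a b => diffAt_of_smooth hU (contDiffOn_pd hU (hg.smooth a b)) hx
  have dc : ∀ k, DifferentiableAt ℝ (christoffel g k i j) x :=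
    fun k => diffAt_of_smooth hU (hg.contDiffOn_christoffel hU k i j) hx
  have h := pd_congr_on (i := c) hU (fun y hy => hg.christoffel_lower hy m i j) hx
  rw [((HasPd.of_diff (dg _ _)).mul (HasPd.of_diff (dc _))).add
    ((HasPd.of_diff (dg _ _)).mul (HasPd.of_diff (dc _))) |>.2,
    (((HasPd.of_diff (dp _ _ _)).add (HasPd.of_diff (dp _ _ _))).sub
      (HasPd.of_diff (dp _ _ _))).const_mul (1 / 2) |>.2] at h
  linear_combination h

/-- The component `R^k_{i10}` of the curvature operator of a surface. -/
noncomputable def curvOp (g : MetricField 2) (k i : Fin 2) (x : Fin 2 → ℝ) : ℝ :=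
  pd 1 (christoffel g k 0 i) x - pd 0 (christoffel g k 1 i) x
    + christoffel g k 1 0 x * christoffel g 0 0 i x + christoffel g k 1 1 x * christoffel g 1 0 i x
    - christoffel g k 0 0 x * christoffel g 0 1 i x - christoffel g k 0 1 x * christoffel g 1 1 i x

lemma IsMetricOn.ricci_eq_curvOp (hU : IsOpen U) (hg : IsMetricOn g U) (hx : x ∈ U) :
    ricci g x 0 0 = curvOp g 1 0 x ∧ ricci g x 0 1 = -curvOp g 0 0 x ∧
      ricci g x 1 0 = curvOp g 1 1 x ∧ ricci g x 1 1 = -curvOp g 0 1 x := by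
  have hs : ∀ k, christoffel g k 1 0 x = christoffel g k 0 1 x :=
    fun k => hg.christoffel_symm hU hx k 1 0
  have hp : ∀ k c, pd c (christoffel g k 1 0) x = pd c (christoffel g k 0 1) x :=
    fun k c => pd_congr_on hU (fun y hy => hg.christoffel_symm hU hy k 1 0) hx
  simp only [ricci, curvOp, Matrix.of_apply, Fin.sum_univ_two, hs, hp]
  refine ⟨?_, ?_, ?_, ?_⟩ <;> ring

/-- The curvature operator is antisymmetric once its first index is lowered. -/
lemma IsMetricOn.curvOp_antisymm (hU : IsOpen U) (hg : IsMetricOn g U) (hx : x ∈ U) :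
    g x 0 0 * curvOp g 0 0 x + g x 0 1 * curvOp g 1 0 x = 0 ∧
    g x 0 1 * curvOp g 0 1 x + g x 1 1 * curvOp g 1 1 x = 0 ∧
    g x 0 0 * curvOp g 0 1 x + g x 0 1 * curvOp g 1 1 x + g x 0 1 * curvOp g 0 0 x
      + g x 1 1 * curvOp g 1 0 x = 0 := by
  have hs : g x 1 0 = g x 0 1 := (hg.symm x hx).apply 0 1
  have hc : ∀ k, christoffel g k 1 0 x = christoffel g k 0 1 x :=
    fun k => hg.christoffel_symm hU hx k 1 0
  have hp1 : ∀ c, pd c (fun y => g y 1 0) x = pd c (fun y => g y 0 1) x :=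
    fun c => hg.pd_symm hU hx c 1 0
  have hp2 : ∀ c e, pd c (pd e (fun y => g y 1 0)) x = pd c (pd e (fun y => g y 0 1)) x :=
    fun c e => pd_congr_on hU (fun y hy => hg.pd_symm hU hy e 1 0) hx
  have hcomm : ∀ a b, pd 1 (pd 0 (fun y => g y a b)) x = pd 0 (pd 1 (fun y => g y a b)) x :=
    fun a b => pd_pd_comm hU (hg.smooth a b) hx
  obtain ⟨e0, f0, k0⟩ := hg.pd_eq_christoffel hU hx 0
  obtain ⟨e1, f1, k1⟩ := hg.pd_eq_christoffel hU hx 1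
  have D := hg.pd_christoffel_lower hU hx
  have d1 := D 0 0 0 1
  have d2 := D 0 1 0 0
  have d3 := D 1 0 1 1
  have d4 := D 1 1 1 0
  have d5 := D 0 0 1 1
  have d6 := D 0 1 1 0
  have d7 := D 1 0 0 1
  have d8 := D 1 1 0 0
  simp only [hs, hp1, hp2, hcomm, e0, f0, k0, e1, f1, k1, hc] at d1 d2 d3 d4 d5 d6 d7 d8
  simp only [curvOp, hc]
  refine ⟨?_, ?_, ?_⟩
  · linear_combination d1 - d2
  · linear_combination d3 - d4
  · linear_combination d5 - d6 + d7 - d8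

end Surface

/-! ### The gradient of the dilaton -/

namespace IsAnsatz

variable {s : ℝ} {U : Set (Fin 2 → ℝ)} {g : MetricField 2} {φ : (Fin 2 → ℝ) → ℝ}
  {x : Fin 2 → ℝ}

lemma contDiffOn_laplacian (h : IsAnsatz s U g φ) : ContDiffOn ℝ ∞ (laplacian g φ) U := by
  unfold laplacian tr covD
  refine ContDiffOn.sum fun a _ => ContDiffOn.sum fun b _ => (h.metric.contDiffOn_inv a b).mul ?_
  exact (contDiffOn_pd h.isOpen (contDiffOn_pd h.isOpen h.smooth)).sub (ContDiffOn.sum fun k _ =>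
    (h.metric.contDiffOn_christoffel h.isOpen k a b).mul (contDiffOn_pd h.isOpen h.smooth))

lemma contDiffOn_normSqDiff (h : IsAnsatz s U g φ) : ContDiffOn ℝ ∞ (normSqDiff g φ) U := by
  unfold normSqDiff tr
  exact ContDiffOn.sum fun a _ => ContDiffOn.sum fun b _ => (h.metric.contDiffOn_inv a b).mul
    ((contDiffOn_pd h.isOpen h.smooth).mul (contDiffOn_pd h.isOpen h.smooth))

lemma differentiableAt (h : IsAnsatz s U g φ) (hx : x ∈ U) : DifferentiableAt ℝ φ x :=
  diffAt_of_smooth h.isOpen h.smooth hx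

/-- The Hessian of the dilaton is pure trace. -/
lemma hessian (h : IsAnsatz s U g φ) (hx : x ∈ U) (a b : Fin 2) :
    pd a (pd b φ) x = christoffel g 0 a b x * pd 0 φ x + christoffel g 1 a b x * pd 1 φ x
      + laplacian g φ x / 2 * g x a b := by
  have h1 := h.conformalKilling x hx a b
  have hc : ∀ k, christoffel g k b a x = christoffel g k a b x :=
    fun k => h.metric.christoffel_symm h.isOpen hx k b a
  have hp : pd b (pd a φ) x = pd a (pd b φ) x := pd_pd_comm h.isOpen h.smooth hx
  have h2 : tr g x (covD g (diff φ) x) = laplacian g φ x := rfl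
  simp only [tracelessPart, symPart, h2, covD, diff, Fin.sum_univ_two, hc, hp] at h1
  push_cast at h1
  linear_combination h1

lemma diff_ne_zero (h : IsAnsatz s U g φ) (hx : x ∈ U) : pd 0 φ x ≠ 0 ∨ pd 1 φ x ≠ 0 := by
  by_contra! hc
  apply h.nonnull x hx
  simp [normSqDiff, tr, Fin.sum_univ_two, hc.1, hc.2]

lemma normSqDiff_mul_det (h : IsAnsatz s U g φ) (hx : x ∈ U) :
    normSqDiff g φ x * (g x).det = g x 1 1 * (pd 0 φ x * pd 0 φ x)
      - 2 * g x 0 1 * (pd 0 φ x * pd 1 φ x) + g x 0 0 * (pd 1 φ x * pd 1 φ x) := by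
  rw [normSqDiff, h.metric.tr_eq hx, div_mul_cancel₀ _ (h.metric.nondegenerate x hx)]
  ring

/-- The components `X` of the gradient vector. -/
lemma exists_gradient (h : IsAnsatz s U g φ) (hx : x ∈ U) : ∃ X0 X1,
    pd 0 φ x = g x 0 0 * X0 + g x 0 1 * X1 ∧ pd 1 φ x = g x 0 1 * X0 + g x 1 1 * X1 := by
  have hd := h.metric.nondegenerate x hx
  have hdet := h.metric.det_eq hx
  refine ⟨(g x 1 1 * pd 0 φ x - g x 0 1 * pd 1 φ x) / (g x).det,
    (g x 0 0 * pd 1 φ x - g x 0 1 * pd 0 φ x) / (g x).det, ?_, ?_⟩ <;>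
  · field_simp
    rw [hdet]
    ring

/-- `d|dφ|² = (D²φ) dφ`, as the Hessian is pure trace. -/
lemma pd_normSqDiff (h : IsAnsatz s U g φ) (hx : x ∈ U) (c : Fin 2) :
    pd c (normSqDiff g φ) x = laplacian g φ x * pd c φ x := by
  have hU := h.isOpen
  have hd := h.metric.nondegenerate x hx
  have D : ∀ {F : (Fin 2 → ℝ) → ℝ}, ContDiffOn ℝ ∞ F U → HasPd c F (pd c F x) x :=
    fun hF => HasPd.of_diff (diffAt_of_smooth hU hF hx)
  have dg := fun a b => D (h.metric.smooth a b)
  have dp := fun a => D (contDiffOn_pd (i := a) hU h.smooth)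
  have e1 := pd_congr_on (i := c) hU (fun y hy => h.normSqDiff_mul_det hy) hx
  have e2 := pd_congr_on (i := c) hU (fun y hy => h.metric.det_eq hy) hx
  rw [(((dg 0 0).mul (dg 1 1)).sub ((dg 0 1).mul (dg 0 1))).2] at e2
  rw [((D h.contDiffOn_normSqDiff).mul (D h.metric.contDiffOn_det)).2,
    ((((dg 1 1).mul ((dp 0).mul (dp 0))).sub (((dg 0 1).const_mul 2).mul
      ((dp 0).mul (dp 1)))).add ((dg 0 0).mul ((dp 1).mul (dp 1)))).2, e2,
    h.hessian hx c 0, h.hessian hx c 1] at e1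
  obtain ⟨p0, p1, p2⟩ := h.metric.pd_eq_christoffel hU hx c
  rw [p0, p1, p2] at e1
  obtain ⟨X0, X1, x0, x1⟩ := h.exists_gradient hx
  have hN := h.normSqDiff_mul_det hx
  have hs : g x 1 0 = g x 0 1 := (h.metric.symm x hx).apply 0 1
  have hN' : normSqDiff g φ x = pd 0 φ x * X0 + pd 1 φ x * X1 := by
    apply mul_right_cancel₀ hd
    rw [hN, h.metric.det_eq hx, x0, x1]
    ring
  apply mul_right_cancel₀ hd
  rw [hN', h.metric.det_eq hx, x0, x1] at e1
  rw [h.metric.det_eq hx]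
  match c with
  | 0 => simp only [x0]; linear_combination e1
  | 1 => simp only [x1, hs] at *; linear_combination e1

/-- `R dφ = - d(D²φ)`: the Ricci identity for the gradient of the dilaton. -/
lemma scalarCurv_mul_diff (h : IsAnsatz s U g φ) (hx : x ∈ U) (c : Fin 2) :
    scalarCurv g x * pd c φ x = -pd c (laplacian g φ) x := by
  have hU := h.isOpen
  have hg := h.metric
  have D : ∀ e {F : (Fin 2 → ℝ) → ℝ}, ContDiffOn ℝ ∞ F U → HasPd e F (pd e F x) x :=
    fun e _ hF => HasPd.of_diff (diffAt_of_smooth hU hF hx)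
  have dg := fun e a b => D e (hg.smooth a b)
  have dc := fun e k i j => D e (hg.contDiffOn_christoffel hU k i j)
  have dp := fun e a => D e (contDiffOn_pd (i := a) hU h.smooth)
  have dl := fun e => D e h.contDiffOn_laplacian
  have hs : g x 1 0 = g x 0 1 := (hg.symm x hx).apply 0 1
  have hc : ∀ k, christoffel g k 1 0 x = christoffel g k 0 1 x :=
    fun k => hg.christoffel_symm hU hx k 1 0
  have hp1 : ∀ c, pd c (fun y => g y 1 0) x = pd c (fun y => g y 0 1) x :=
    fun c => hg.pd_symm hU hx c 1 0
  have H : ∀ e a b, pd e (pd a (pd b φ)) x = _ := fun e a b =>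
    (pd_congr_on (i := e) hU (fun y hy => h.hessian hy a b) hx).trans
      ((((dc e 0 a b).mul (dp e 0)).add ((dc e 1 a b).mul (dp e 1))).add
        (((dl e).mul (HasPd.const (2⁻¹ : ℝ))).mul (dg e a b))).2
  have c0 : pd 1 (pd 0 (pd 0 φ)) x = pd 0 (pd 1 (pd 0 φ)) x :=
    pd_pd_comm hU (contDiffOn_pd hU h.smooth) hx
  have c1 : pd 1 (pd 0 (pd 1 φ)) x = pd 0 (pd 1 (pd 1 φ)) x :=
    pd_pd_comm hU (contDiffOn_pd hU h.smooth) hx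
  obtain ⟨e0, f0, k0⟩ := hg.pd_eq_christoffel hU hx 0
  obtain ⟨e1, f1, k1⟩ := hg.pd_eq_christoffel hU hx 1
  rw [H, H] at c0 c1
  simp only [h.hessian hx, hs, hc, hp1, f0, k0, e1, f1] at c0 c1
  obtain ⟨a0, a1, a2⟩ := hg.curvOp_antisymm hU hx
  obtain ⟨r0, r1, r2, r3⟩ := hg.ricci_eq_curvOp hU hx
  obtain ⟨X0, X1, x0, x1⟩ := h.exists_gradient hx
  have := scalarCurv_algebra (l0 := pd 0 (laplacian g φ) x) (l1 := pd 1 (laplacian g φ) x)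
    (hg.det_eq hx) (hg.nondegenerate x hx) (hg.tr_eq hx _) r0 r1 r2 r3 x0 x1 a0 a1 a2
    (by simp only [curvOp, hc]; linear_combination c0)
    (by simp only [curvOp, hc]; linear_combination c1)
  match c with
  | 0 => exact this.1
  | 1 => exact this.2

lemma covD_mul_diff (h : IsAnsatz s U g φ) (hx : x ∈ U) {θ : OneForm 2} {k : ℝ → ℝ} {k' : ℝ}
    (hk : HasDerivAt k k' (φ x)) (hθ : ∀ b, ∀ y ∈ U, θ b y = k (φ y) * pd b φ y) (a b : Fin 2) :
    covD g θ x a b = k' * (pd a φ x * pd b φ x)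
      + k (φ x) * (laplacian g φ x / 2 * g x a b) := by
  have hp := (((HasPd.of_diff (i := a) (h.differentiableAt hx)).comp hk).mul (HasPd.of_diff (i := a)
    (diffAt_of_smooth h.isOpen (contDiffOn_pd (i := b) h.isOpen h.smooth) hx))).2
  rw [covD, pd_congr_on h.isOpen (hθ b) hx, hp, h.hessian hx, Fin.sum_univ_two, hθ 0 x hx,
    hθ 1 x hx]
  ring

lemma tr_mul_diff (h : IsAnsatz s U g φ) (hx : x ∈ U) (k k' : ℝ) :
    tr g x (fun a b => k' * (pd a φ x * pd b φ x) + k * (laplacian g φ x / 2 * g x a b))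
      = k' * normSqDiff g φ x + k * laplacian g φ x := by
  have hs : g x 1 0 = g x 0 1 := (h.metric.symm x hx).apply 0 1
  have hd := h.metric.nondegenerate x hx
  rw [normSqDiff, h.metric.tr_eq hx, h.metric.tr_eq hx, hs]
  field_simp
  rw [h.metric.det_eq hx]
  ring

lemma laplacian_comp (h : IsAnsatz s U g φ) (hx : x ∈ U) {F k : ℝ → ℝ} {k' : ℝ}
    (hF : ∀ t, HasDerivAt F (k t) t) (hk : HasDerivAt k k' (φ x)) :
    laplacian g (fun y => F (φ y)) x = k (φ x) * laplacian g φ x + k' * normSqDiff g φ x := by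
  have h1 : covD g (diff fun y => F (φ y)) x = fun a b => k' * (pd a φ x * pd b φ x)
      + k (φ x) * (laplacian g φ x / 2 * g x a b) := by
    ext a b
    exact h.covD_mul_diff hx hk (fun b y hy => pd_comp (hF _) (h.differentiableAt hy)) a b
  rw [laplacian, h1, h.tr_mul_diff hx]
  ring

/-- If the coefficients of `dφ ⊗ dφ` in the two terms of the CKV tensor cancel, the CKV equation
holds. -/
lemma ckv_of_cancel (h : IsAnsatz s U g φ) (hx : x ∈ U) {μ α : ℝ} {f q q' : ℝ → ℝ} {q'' : ℝ}
    (hf : ∀ t, f t = exp (2 * (α - 1) * t) * q t) (hq : ∀ t, HasDerivAt q (q' t) t)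
    (hq' : HasDerivAt q' q'' (φ x))
    (h0 : (1 - 2 * α) * exp (φ x) + s / (2 * μ) * (q'' - 2 * (α - 1) * q' (φ x)) = 0)
    (a b : Fin 2) :
    tracelessPart g x (ckvTensor s μ α g φ (fun y => f (φ y)) x) a b = 0 := by
  have hlin : ∀ c t : ℝ, HasDerivAt (fun t => exp (c * t)) (exp (c * t) * c) t := fun c t => by
    simpa using ((hasDerivAt_id t).const_mul c).exp
  have hq2 : ∀ y ∈ U, ∀ b, pd b (fun w => exp (-(2 * (α - 1)) * φ w) * f (φ w)) y
      = q' (φ y) * pd b φ y := fun y hy b => by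
    have : (fun w => exp (-(2 * (α - 1)) * φ w) * f (φ w)) = fun w => q (φ w) := by
      ext w
      rw [hf, ← mul_assoc, ← exp_add]
      ring_nf
      simp
    rw [this, pd_comp (hq _) (h.differentiableAt hy)]
  have h1 := fun a b =>
    h.covD_mul_diff hx (k := fun t => exp (-(2 * α) * t) * exp t)
      (θ := fun b y => exp (-(2 * α) * φ y) * pd b (fun w => exp (φ w)) y)
      ((hlin _ _).mul (Real.hasDerivAt_exp _))
      (fun b y hy => by rw [pd_comp (Real.hasDerivAt_exp _) (h.differentiableAt hy)]; ring) a b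
  have h2 := fun a b =>
    h.covD_mul_diff hx (k := fun t => exp (-(2 * (α - 1)) * t) * q' t)
      (θ := fun b y => exp (-(2 * (α - 1)) * φ y) *
        pd b (fun w => exp (-(2 * (α - 1)) * φ w) * f (φ w)) y)
      ((hlin _ _).mul hq') (fun b y hy => by rw [hq2 y hy]; ring) a b
  have e1 : exp (2 * α * φ x) * exp (-(2 * α) * φ x) = 1 := by rw [← exp_add]; simp
  have e2 : exp (2 * (α - 1) * φ x) * exp (-(2 * (α - 1)) * φ x) = 1 := by rw [← exp_add]; simp
  have hT : ckvTensor s μ α g φ (fun y => f (φ y)) x = fun a b => 0 * (pd a φ x * pd b φ x)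
      + (exp (φ x) + s / (2 * μ) * q' (φ x)) * (laplacian g φ x / 2 * g x a b) := by
    ext a b
    simp only [ckvTensor, h1, h2]
    linear_combination ((1 - 2 * α) * exp (φ x) * (pd a φ x * pd b φ x)
      + exp (φ x) * (laplacian g φ x / 2 * g x a b)) * e1
      + s / (2 * μ) * ((q'' - 2 * (α - 1) * q' (φ x)) * (pd a φ x * pd b φ x)
      + q' (φ x) * (laplacian g φ x / 2 * g x a b)) * e2 + (pd a φ x * pd b φ x) * h0
  rw [hT, tracelessPart, h.tr_mul_diff hx, symPart, (h.metric.symm x hx).apply a b]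
  push_cast
  ring

end IsAnsatz

/-- The reduced equations at a point where the dilaton is `t`, in terms of `N = |dφ|²`, `L = D²φ`,
the scalar curvature `R`, and the function `q` with `f = e^{2 (α - 1) φ} q` and its derivative
`q'`. The dilaton equation is combined with the first one, which eliminates `R`. -/
def ScalarEqs (s ℓ μ α c t q q' N L R : ℝ) : Prop :=
  R - 2 * (α - 1) * L = exp (2 * (α - 1) * t) * (c - 2 * s * μ * exp t * q - 3 * q ^ 2) ∧
  4 * L + 2 * N = exp (2 * (α - 1) * t) *
    (c - 2 * s * μ * exp t * q - 5 / 2 * q ^ 2 + 6 / ℓ ^ 2 * exp t ^ 2) ∧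
  (exp t + s / (2 * μ) * q') * L + (2 * α * exp t + s / μ * (α - 1) * q') * N
    + exp (2 * (α - 1) * t) * (-(1 / 2) * exp t * q ^ 2 - 2 / ℓ ^ 2 * exp t ^ 3
      + s / (2 * μ) * (c * q - q ^ 3)) = 0

lemma scalarEqs_iff {s ℓ μ α c t q q' N L R f e E : ℝ} (hs : s ^ 2 = 1) (hμ : μ ≠ 0)
    (he : e = exp t) (hE : E = exp (2 * (α - 1) * t)) (hf : f = E * q) :
    ScalarEqs s ℓ μ α c t q q' N L R ↔
      c = s * 2 * μ * (e / E) * f + 1 / E * R - 2 * (α - 1) * (1 / E) * L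
        + 3 * (1 / E ^ 2) * f ^ 2 ∧
      -6 / ℓ ^ 2 = 1 / (E * e ^ 2) * R - 2 * (α + 1) * (1 / (E * e ^ 2)) * L
        - 2 * (1 / (E * e ^ 2)) * N + 1 / 2 * (1 / (E ^ 2 * e ^ 2)) * f ^ 2 ∧
      0 = e * L + e * N + 1 / 2 * (e / E) * f ^ 2 - 2 / ℓ ^ 2 * (E * e ^ 3)
        + s / (2 * μ) * (q' * L + (2 * (α - 1) * q' - 2 * s * μ * (1 - 2 * α) * e) * N
          + 1 / E * f * R - 2 * (α - 1) * (1 / E) * f * L + 2 * (1 / E ^ 2) * f ^ 3) := by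
  have he0 : e ≠ 0 := he ▸ (exp_pos _).ne'
  have hE0 : E ≠ 0 := hE ▸ (exp_pos _).ne'
  rw [ScalarEqs, ← he, ← hE, hf]
  obtain ⟨r1, h1⟩ : ∃ r, r = R - 2 * (α - 1) * L
    - E * (c - 2 * s * μ * e * q - 3 * q ^ 2) := ⟨_, rfl⟩
  obtain ⟨r2, h2⟩ : ∃ r, r = 4 * L + 2 * N
    - E * (c - 2 * s * μ * e * q - 5 / 2 * q ^ 2 + 6 / ℓ ^ 2 * e ^ 2) := ⟨_, rfl⟩
  obtain ⟨r3, h3⟩ : ∃ r, r = (e + s / (2 * μ) * q') * L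
    + (2 * α * e + s / μ * (α - 1) * q') * N
    + E * (-(1 / 2) * e * q ^ 2 - 2 / ℓ ^ 2 * e ^ 3 + s / (2 * μ) * (c * q - q ^ 3)) := ⟨_, rfl⟩
  rw [← sub_eq_zero, ← h1, ← sub_eq_zero (a := 4 * L + 2 * N), ← h2, ← h3]
  have hsμ : s / (2 * μ) * (2 * s * μ) = 1 := by field_simp; linear_combination hs
  -- the residuals of the original equations are combinations of those of `ScalarEqs`
  have k1 : s * 2 * μ * (e / E) * (E * q) + 1 / E * R - 2 * (α - 1) * (1 / E) * L
      + 3 * (1 / E ^ 2) * (E * q) ^ 2 = c + r1 / E := by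
    rw [h1]; field_simp; ring
  have k2 : 1 / (E * e ^ 2) * R - 2 * (α + 1) * (1 / (E * e ^ 2)) * L
        - 2 * (1 / (E * e ^ 2)) * N + 1 / 2 * (1 / (E ^ 2 * e ^ 2)) * (E * q) ^ 2
      = -6 / ℓ ^ 2 + (r1 - r2) / (E * e ^ 2) := by
    have : -6 / ℓ ^ 2 = -(6 / ℓ ^ 2) := by ring
    rw [h1, h2, this]
    generalize 6 / ℓ ^ 2 = w
    field_simp; ring
  have k3 : e * L + e * N + 1 / 2 * (e / E) * (E * q) ^ 2 - 2 / ℓ ^ 2 * (E * e ^ 3)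
        + s / (2 * μ) * (q' * L + (2 * (α - 1) * q' - 2 * s * μ * (1 - 2 * α) * e) * N
          + 1 / E * (E * q) * R - 2 * (α - 1) * (1 / E) * (E * q) * L
          + 2 * (1 / E ^ 2) * (E * q) ^ 3) = r3 + s / (2 * μ) * q * r1 := by
    have z1 : e / E * (E * q) ^ 2 = e * E * q ^ 2 := by field_simp
    have z2 : 1 / E * (E * q) = q := by field_simp
    have z3 : 1 / E ^ 2 * (E * q) ^ 3 = E * q ^ 3 := by field_simp
    have z4 : s / μ = 2 * (s / (2 * μ)) := by field_simp
    rw [h1, h3, z4]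
    linear_combination 1 / 2 * z1 + s / (2 * μ) * (R - 2 * (α - 1) * L) * z2
      + 2 * (s / (2 * μ)) * z3 - ((1 - 2 * α) * e * N + E * e * q ^ 2) * hsμ
  rw [k1, k2, k3]
  constructor
  · rintro ⟨a1, a2, a3⟩
    simp [a1, a2, a3]
  · rintro ⟨a1, a2, a3⟩
    have b1 : r1 = 0 := by
      have : r1 / E = 0 := by linear_combination -a1
      simpa [hE0] using this
    have b2 : r2 = 0 := by
      have : (r1 - r2) / (E * e ^ 2) = 0 := by linear_combination -a2
      simpa [hE0, he0, b1] using this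
    exact ⟨b1, b2, by rw [b1] at a3; linear_combination -a3⟩

/-- The reduced equations amount to `ScalarEqs`; the CKV equation is solved by the field strength
prescribed in the Ansatz. -/
lemma IsAnsatz.reducedTMG_iff {s ℓ μ α c : ℝ} {U : Set (Fin 2 → ℝ)} {g : MetricField 2}
    {φ : (Fin 2 → ℝ) → ℝ} (h : IsAnsatz s U g φ) (hs : s ^ 2 = 1) (hμ : μ ≠ 0)
    {f q q' : ℝ → ℝ}
    (hf : ∀ t, f t = exp (2 * (α - 1) * t) * q t) (hq : ∀ t, HasDerivAt q (q' t) t)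
    (hq' : ∀ t, HasDerivAt q' (2 * (α - 1) * q' t - 2 * s * μ * (1 - 2 * α) * exp t) t) :
    ReducedTMG s ℓ μ α c U g φ (fun x => f (φ x)) ↔
      ∀ x ∈ U, ScalarEqs s ℓ μ α c (φ x) (q (φ x)) (q' (φ x)) (normSqDiff g φ x)
        (laplacian g φ x) (scalarCurv g x) := by
  have hEE : ∀ t : ℝ, exp (2 * (α - 1) * t) ≠ 0 := fun t => (exp_pos _).ne'
  have hee : ∀ t : ℝ, exp t ≠ 0 := fun t => (exp_pos _).ne'
  -- every exponential in the equations is a monomial in `e^φ` and `e^{2 (α - 1) φ}`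
  have x1 : ∀ t : ℝ, exp ((-2 * α + 3) * t) = exp t / exp (2 * (α - 1) * t) := fun t => by
    rw [← exp_sub]; ring_nf
  have x2 : ∀ t : ℝ, exp (2 * (1 - α) * t) = 1 / exp (2 * (α - 1) * t) := fun t => by
    rw [one_div, ← exp_neg]; ring_nf
  have x3 : ∀ t : ℝ, exp (4 * (1 - α) * t) = 1 / exp (2 * (α - 1) * t) ^ 2 := fun t => by
    rw [one_div, ← exp_nat_mul, ← exp_neg]; push_cast; ring_nf
  have x4 : ∀ t : ℝ, exp (-2 * α * t) = 1 / (exp (2 * (α - 1) * t) * exp t ^ 2) := fun t => by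
    rw [one_div, ← exp_nat_mul, ← exp_add, ← exp_neg]; push_cast; ring_nf
  have x5 : ∀ t : ℝ, exp ((-4 * α + 2) * t) = 1 / (exp (2 * (α - 1) * t) ^ 2 * exp t ^ 2) :=
    fun t => by
      rw [one_div, ← exp_nat_mul, ← exp_nat_mul, ← exp_add, ← exp_neg]; push_cast; ring_nf
  have x6 : ∀ t : ℝ, exp ((2 * α + 1) * t) = exp (2 * (α - 1) * t) * exp t ^ 3 := fun t => by
    rw [← exp_nat_mul, ← exp_add]; push_cast; ring_nf
  have x7 : ∀ t : ℝ, exp ((-2 * α + 2) * t) = 1 / exp (2 * (α - 1) * t) := fun t => by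
    rw [one_div, ← exp_neg]; ring_nf
  have x8 : ∀ t : ℝ, exp ((-4 * α + 4) * t) = 1 / exp (2 * (α - 1) * t) ^ 2 := fun t => by
    rw [one_div, ← exp_nat_mul, ← exp_neg]; push_cast; ring_nf
  have hlapq : ∀ x ∈ U, laplacian g (fun y => exp ((-2 * α + 2) * φ y) * f (φ y)) x
      = q' (φ x) * laplacian g φ x
        + (2 * (α - 1) * q' (φ x) - 2 * s * μ * (1 - 2 * α) * exp (φ x))
          * normSqDiff g φ x := fun x hx => by
    rw [← h.laplacian_comp hx hq (hq' _)]
    congr 1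
    ext y
    rw [hf, x7]
    field_simp [hEE (φ y)]
  have hlape : ∀ x ∈ U, laplacian g (fun y => exp (φ y)) x
      = exp (φ x) * laplacian g φ x + exp (φ x) * normSqDiff g φ x := fun x hx =>
    h.laplacian_comp hx Real.hasDerivAt_exp (Real.hasDerivAt_exp _)
  have key : ∀ x ∈ U, _ := fun x hx => scalarEqs_iff (ℓ := ℓ) (c := c) (q' := q' (φ x))
    (N := normSqDiff g φ x) (L := laplacian g φ x) (R := scalarCurv g x) hs hμ
    (Eq.refl (exp (φ x))) (Eq.refl (exp (2 * (α - 1) * φ x))) (hf (φ x))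
  constructor
  · intro H x hx
    have F := H.eqF x hx
    have D := H.eqDil x hx
    have K := H.eqKink x hx
    rw [hlapq x hx, hlape x hx] at K
    simp only [x1, x2, x3, x4, x5, x6, x7, x8] at F D K
    exact (key x hx).2 ⟨F, D, K⟩
  · intro H
    refine ⟨fun x hx => ?_, fun x hx => ?_, fun x hx => ?_, fun x hx => ?_⟩
    · simp only [x1, x2, x3]
      exact ((key x hx).1 (H x hx)).1
    · simp only [x4, x5]
      exact ((key x hx).1 (H x hx)).2.1
    · rw [hlapq x hx, hlape x hx]
      simp only [x1, x6, x7, x8]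
      exact ((key x hx).1 (H x hx)).2.2
    · refine h.ckv_of_cancel hx hf hq (hq' _) ?_
      have hsμ : s / (2 * μ) * (2 * s * μ) = 1 := by field_simp; linear_combination hs
      linear_combination -(1 - 2 * α) * exp (φ x) * hsμ

/-! ### Linear independence of exponentials -/

lemma hasDerivAt_exp_mul (m t : ℝ) : HasDerivAt (fun t => exp (m * t)) (m * exp (m * t)) t := by
  have := ((hasDerivAt_id t).const_mul m).exp
  simp only [mul_one, id] at this
  rwa [mul_comm] at this

lemma hasDerivAt_exp_sum (l : List (ℝ × ℝ)) (t : ℝ) :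
    HasDerivAt (fun t => (l.map fun p => p.2 * exp (p.1 * t)).sum)
      (l.map fun p => p.2 * (p.1 * exp (p.1 * t))).sum t := by
  induction l with
  | nil => simpa using hasDerivAt_const t (0 : ℝ)
  | cons p l ih =>
    simp only [List.map_cons, List.sum_cons]
    exact ((hasDerivAt_exp_mul p.1 t).const_mul p.2).add ih

/-- In a sum of exponentials `p.2 * exp (p.1 * t)` that vanishes on an open set, a term whose
exponent does not occur a second time has the coefficient zero. -/
lemma exp_sum_isolate {I : Set ℝ} (hI : IsOpen I) (hne : I.Nonempty) (n : ℕ) :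
    ∀ (l : List (ℝ × ℝ)) (c m : ℝ), l.length = n → (∀ p ∈ l, p.1 ≠ m) →
      (∀ t ∈ I, c * exp (m * t) + (l.map fun p => p.2 * exp (p.1 * t)).sum = 0) → c = 0 := by
  induction n with
  | zero =>
    intro l c m hl _ h
    obtain ⟨t, ht⟩ := hne
    rw [List.length_eq_zero_iff.1 hl] at h
    simpa [(exp_pos _).ne'] using h t ht
  | succ n ih =>
    intro l c m hl hm h
    obtain ⟨p, l, rfl⟩ := List.exists_cons_of_length_eq_add_one hl
    -- the operator `d/dt - p.1` removes the first term of the list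
    have key := ih (l.map fun r => (r.1, r.2 * (r.1 - p.1))) (c * (m - p.1)) m
      (by simpa using hl) ?_ ?_
    · rcases mul_eq_zero.1 key with h0 | h0
      · exact h0
      · exact absurd (sub_eq_zero.1 h0).symm (hm p (by simp))
    · intro r hr
      obtain ⟨r', hr', rfl⟩ := List.mem_map.1 hr
      exact hm r' (List.mem_cons_of_mem _ hr')
    · intro t ht
      have hd := ((hasDerivAt_exp_mul m t).const_mul c).add (hasDerivAt_exp_sum (p :: l) t)
      have h0 := hd.unique ((hasDerivAt_const t (0 : ℝ)).congr_of_eventuallyEq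
        (Filter.eventuallyEq_of_mem (hI.mem_nhds ht) h))
      have h1 := h t ht
      have h2 : ((l.map fun r => (r.1, r.2 * (r.1 - p.1))).map
          fun r => r.2 * exp (r.1 * t)).sum = (l.map fun r => r.2 * (r.1 * exp (r.1 * t))).sum
            - p.1 * (l.map fun r => r.2 * exp (r.1 * t)).sum := by
        clear h0 h1 hd h hm hl ih
        induction l with
        | nil => simp
        | cons r l ih =>
          simp only [List.map_cons, List.sum_cons] at ih ⊢
          rw [ih]
          ring
      rw [h2]
      simp only [List.map_cons, List.sum_cons] at h0 h1
      linear_combination h0 - p.1 * h1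

/-! ### Differentiating along the dilaton -/

namespace IsAnsatz

variable {s : ℝ} {U : Set (Fin 2 → ℝ)} {g : MetricField 2} {φ : (Fin 2 → ℝ) → ℝ}
  {x : Fin 2 → ℝ}

lemma eq_deriv (h : IsAnsatz s U g φ) (hx : x ∈ U) {F : (Fin 2 → ℝ) → ℝ} {H : ℝ → ℝ} {v H' : ℝ}
    (hF : ∀ y ∈ U, F y = H (φ y)) (hv : ∀ c, pd c F x = v * pd c φ x)
    (hH : HasDerivAt H H' (φ x)) : v = H' := by
  have h1 : ∀ c, v * pd c φ x = H' * pd c φ x := fun c => by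
    rw [← hv, pd_congr_on h.isOpen hF hx, pd_comp hH (h.differentiableAt hx)]
  rcases h.diff_ne_zero hx with h0 | h0
  · exact mul_right_cancel₀ h0 (h1 0)
  · exact mul_right_cancel₀ h0 (h1 1)

/-- If `|dφ|²` is a function `n` of the dilaton, then `D²φ = n'` and `R = - n''`. -/
lemma of_profile (h : IsAnsatz s U g φ) {n n' n'' : ℝ → ℝ}
    (hn : ∀ t, HasDerivAt n (n' t) t) (hn' : ∀ t, HasDerivAt n' (n'' t) t)
    (hN : ∀ y ∈ U, normSqDiff g φ y = n (φ y)) (hx : x ∈ U) :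
    laplacian g φ x = n' (φ x) ∧ scalarCurv g x = -n'' (φ x) := by
  have h1 : ∀ y ∈ U, laplacian g φ y = n' (φ y) := fun y hy =>
    h.eq_deriv hy hN (fun c => h.pd_normSqDiff hy c) (hn _)
  have h2 := h.eq_deriv (v := -scalarCurv g x) hx h1
    (fun c => by linear_combination h.scalarCurv_mul_diff hx c) (hn' _)
  exact ⟨h1 x hx, by linear_combination -h2⟩

/-- If `R - a D²φ` and `4 D²φ + 2 |dφ|²` are functions `P` and `Q` of the dilaton, differentiating
once determines `D²φ`, and twice gives a relation between `P` and `Q`. -/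
lemma compatibility (h : IsAnsatz s U g φ) {a : ℝ} {P P' Q Q' Q'' : ℝ → ℝ}
    (hP : ∀ t, HasDerivAt P (P' t) t) (hQ : ∀ t, HasDerivAt Q (Q' t) t)
    (hQ' : ∀ t, HasDerivAt Q' (Q'' t) t)
    (eP : ∀ y ∈ U, scalarCurv g y - a * laplacian g φ y = P (φ y))
    (eQ : ∀ y ∈ U, 4 * laplacian g φ y + 2 * normSqDiff g φ y = Q (φ y)) (hx : x ∈ U) :
    (2 - 4 * a) * laplacian g φ x = Q' (φ x) + 4 * P (φ x) ∧
      4 * P' (φ x) + 2 * P (φ x) + Q'' (φ x) + a * Q' (φ x) = 0 := by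
  have D : ∀ {F : (Fin 2 → ℝ) → ℝ} (y) (_ : y ∈ U) (c : Fin 2), ContDiffOn ℝ ∞ F U →
      HasPd c F (pd c F y) y := fun y hy c hF => HasPd.of_diff (diffAt_of_smooth h.isOpen hF hy)
  have h1 : ∀ y ∈ U, (2 - 4 * a) * laplacian g φ y = Q' (φ y) + 4 * P (φ y) := fun y hy => by
    have := h.eq_deriv (v := -4 * scalarCurv g y + 2 * laplacian g φ y) hy eQ (fun c => by
      rw [(((D y hy c h.contDiffOn_laplacian).const_mul 4).add
        ((D y hy c h.contDiffOn_normSqDiff).const_mul 2)).2, h.pd_normSqDiff hy]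
      linear_combination 4 * h.scalarCurv_mul_diff hy c) (hQ _)
    linear_combination this + 4 * eP y hy
  refine ⟨h1 x hx, ?_⟩
  have h2 := h.eq_deriv (v := -(2 - 4 * a) * scalarCurv g x) (H := fun t => Q' t + 4 * P t) hx h1
    (fun c => by
      rw [((D x hx c h.contDiffOn_laplacian).const_mul (2 - 4 * a)).2]
      linear_combination (2 - 4 * a) * h.scalarCurv_mul_diff hx c)
    ((hQ' _).add ((hP _).const_mul 4))
  linear_combination -h2 - (2 - 4 * a) * eP x hx - a * h1 x hx

/-- The dilaton is an open map. -/
lemma image_mem_nhds (h : IsAnsatz s U g φ) (hx : x ∈ U) : φ '' U ∈ 𝓝 (φ x) := by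
  have hs : HasStrictFDerivAt φ (fderiv ℝ φ x) x :=
    (h.smooth.contDiffAt (h.isOpen.mem_nhds hx)).hasStrictFDerivAt (by simp)
  rw [← hs.map_nhds_eq_of_surj]
  · exact Filter.image_mem_map (h.isOpen.mem_nhds hx)
  · rw [LinearMap.range_eq_top]
    obtain ⟨c, hc⟩ : ∃ c, pd c φ x ≠ 0 := by
      rcases h.diff_ne_zero hx with h0 | h0 <;> exact ⟨_, h0⟩
    intro r
    refine ⟨(r / pd c φ x) • Pi.single c 1, ?_⟩
    have : fderiv ℝ φ x (Pi.single c 1) = pd c φ x := rfl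
    simp [this, hc]

end IsAnsatz

/-! ### Consistency of the reduced equations -/

lemma hasDerivAt_exp_mul_mul {a t : ℝ} {p : ℝ → ℝ} {p' : ℝ} (hp : HasDerivAt p p' t) :
    HasDerivAt (fun t => exp (a * t) * p t) (exp (a * t) * (a * p t + p')) t :=
  ((hasDerivAt_exp_mul a t).mul hp).congr_deriv (by ring)

/-- The consequences of `IsAnsatz.compatibility` for the reduced equations, in terms of the
function `q` and its derivative. -/
lemma IsAnsatz.compatibility_q {s ℓ μ α c : ℝ} {U : Set (Fin 2 → ℝ)} {g : MetricField 2}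
    {φ : (Fin 2 → ℝ) → ℝ} (h : IsAnsatz s U g φ) {a : ℝ} (ha : a = 2 * (α - 1)) {q q' : ℝ → ℝ}
    (hq : ∀ t, HasDerivAt q (q' t) t)
    (hq' : ∀ t, HasDerivAt q' (a * q' t + 2 * s * μ * (a + 1) * exp t) t)
    (H : ∀ x ∈ U, ScalarEqs s ℓ μ α c (φ x) (q (φ x)) (q' (φ x)) (normSqDiff g φ x)
        (laplacian g φ x) (scalarCurv g x)) {x : Fin 2 → ℝ} (hx : x ∈ U) {t e Q Q' Q'' : ℝ}
    (ht : t = φ x) (he : e = exp t) (hQ : Q = q t) (hQ' : Q' = q' t)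
    (hQ'' : Q'' = a * Q' + 2 * s * μ * (a + 1) * e) :
    (2 - 4 * a) * laplacian g φ x = exp (a * t) *
      (a * (c - 2 * s * μ * e * Q - 5 / 2 * Q ^ 2 + 6 / ℓ ^ 2 * e ^ 2)
        + (-(2 * s * μ * e * (Q + Q')) - 5 * Q * Q' + 12 / ℓ ^ 2 * e ^ 2)
        + 4 * (c - 2 * s * μ * e * Q - 3 * Q ^ 2)) ∧
    (4 * a + 2) * (c - 2 * s * μ * e * Q - 3 * Q ^ 2)
      + 4 * (-(2 * s * μ * e * (Q + Q')) - 6 * Q * Q')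
      + 2 * a ^ 2 * (c - 2 * s * μ * e * Q - 5 / 2 * Q ^ 2 + 6 / ℓ ^ 2 * e ^ 2)
      + 3 * a * (-(2 * s * μ * e * (Q + Q')) - 5 * Q * Q' + 12 / ℓ ^ 2 * e ^ 2)
      + (-(2 * s * μ * e * (Q + 2 * Q' + Q'')) - 5 * Q' ^ 2 - 5 * Q * Q''
        + 24 / ℓ ^ 2 * e ^ 2) = 0 := by
  have d1 : ∀ t, HasDerivAt (fun t => c - 2 * s * μ * exp t * q t - 3 * q t ^ 2)
      (-(2 * s * μ * exp t * (q t + q' t)) - 6 * q t * q' t) t := fun t =>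
    ((((Real.hasDerivAt_exp t).const_mul (2 * s * μ)).mul (hq t)).const_sub c |>.sub
      (((hq t).pow 2).const_mul 3)).congr_deriv (by simp; ring)
  have d2 : ∀ t, HasDerivAt (fun t => c - 2 * s * μ * exp t * q t - 5 / 2 * q t ^ 2
        + 6 / ℓ ^ 2 * exp t ^ 2)
      (-(2 * s * μ * exp t * (q t + q' t)) - 5 * q t * q' t + 12 / ℓ ^ 2 * exp t ^ 2) t := fun t =>
    (((((Real.hasDerivAt_exp t).const_mul (2 * s * μ)).mul (hq t)).const_sub c |>.sub
      (((hq t).pow 2).const_mul (5 / 2))).add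
      (((Real.hasDerivAt_exp t).pow 2).const_mul (6 / ℓ ^ 2))).congr_deriv (by simp; ring)
  have d3 : ∀ t, HasDerivAt (fun t => -(2 * s * μ * exp t * (q t + q' t)) - 5 * q t * q' t
        + 12 / ℓ ^ 2 * exp t ^ 2)
      (-(2 * s * μ * exp t * (q t + 2 * q' t + (a * q' t + 2 * s * μ * (a + 1) * exp t)))
        - 5 * q' t ^ 2 - 5 * q t * (a * q' t + 2 * s * μ * (a + 1) * exp t)
        + 24 / ℓ ^ 2 * exp t ^ 2) t := fun t =>
    (((((Real.hasDerivAt_exp t).const_mul (2 * s * μ)).mul ((hq t).add (hq' t))).neg.sub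
      (((hq t).const_mul 5).mul (hq' t))).add
      (((Real.hasDerivAt_exp t).pow 2).const_mul (12 / ℓ ^ 2))).congr_deriv (by simp; ring)
  obtain ⟨k1, k2⟩ := h.compatibility (a := a) (fun t => hasDerivAt_exp_mul_mul (a := a) (d1 t))
    (fun t => hasDerivAt_exp_mul_mul (a := a) (d2 t))
    (fun t => hasDerivAt_exp_mul_mul (a := a) (((d2 t).const_mul a).add (d3 t)))
    (fun y hy => by rw [ha]; exact (H y hy).1) (fun y hy => by rw [ha]; exact (H y hy).2.1) hx
  subst ht he hQ hQ' hQ''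
  refine ⟨by rw [k1]; ring, ?_⟩
  apply mul_left_cancel₀ (exp_pos (a * φ x)).ne'
  rw [mul_zero, ← k2]
  ring

/-- The function `q` of `ScalarEqs` for the prescribed field strength with `α ≠ 1`. -/
noncomputable def qFun (A k a δ t : ℝ) : ℝ := A * exp t + k * exp (a * t) + δ

lemma hasDerivAt_qFun (A k a δ t : ℝ) :
    HasDerivAt (qFun A k a δ) (A * exp t + a * k * exp (a * t)) t :=
  ((((Real.hasDerivAt_exp t).const_mul A).add ((hasDerivAt_exp_mul a t).const_mul k)).add_const
    δ).congr_deriv (by ring)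

lemma hasDerivAt_qFun_deriv {A k a s μ : ℝ} (hA : A * (a - 1) = -(2 * s * μ * (a + 1))) (t : ℝ) :
    HasDerivAt (fun t => A * exp t + a * k * exp (a * t))
      (a * (A * exp t + a * k * exp (a * t)) + 2 * s * μ * (a + 1) * exp t) t :=
  (((Real.hasDerivAt_exp t).const_mul A).add
    ((hasDerivAt_exp_mul a t).const_mul (a * k))).congr_deriv
    (by linear_combination -exp t * hA)

/-- The compatibility condition for `q = A e + k E + δ` with `e = e^t`, `E = e^{a t}`, expanded in
these exponentials. -/
lemma compatibility_expand {s μ c A k a δ e E w : ℝ} :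
    (4 * a + 2) * (c - 2 * s * μ * e * (A * e + k * E + δ) - 3 * (A * e + k * E + δ) ^ 2)
      + 4 * (-(2 * s * μ * e * ((A * e + k * E + δ) + (A * e + a * k * E)))
        - 6 * (A * e + k * E + δ) * (A * e + a * k * E))
      + 2 * a ^ 2 * (c - 2 * s * μ * e * (A * e + k * E + δ) - 5 / 2 * (A * e + k * E + δ) ^ 2
        + 6 * w * e ^ 2)
      + 3 * a * (-(2 * s * μ * e * ((A * e + k * E + δ) + (A * e + a * k * E)))
        - 5 * (A * e + k * E + δ) * (A * e + a * k * E) + 12 * w * e ^ 2)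
      + (-(2 * s * μ * e * ((A * e + k * E + δ) + 2 * (A * e + a * k * E)
        + (A * e + a ^ 2 * k * E))) - 5 * (A * e + a * k * E) ^ 2
        - 5 * (A * e + k * E + δ) * (A * e + a ^ 2 * k * E) + 24 * w * e ^ 2)
    = (2 * c * (a + 1) ^ 2 - δ ^ 2 * (5 * a ^ 2 + 12 * a + 6))
      + δ * ((4 * a + 6) * (-(2 * s * μ) - 6 * A) + (a + 1) * (2 * a + 1) * (-(2 * s * μ) - 5 * A))
        * e
      + ((4 * a + 10) * (-(2 * s * μ * A) - 3 * A ^ 2)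
        + (a + 2) * (2 * a + 2) * (-(2 * s * μ * A) - 5 / 2 * A ^ 2 + 6 * w)) * e ^ 2
      - k * δ * (30 * a ^ 2 + 48 * a + 12) * E
      + k * ((8 * a + 6) * (-(2 * s * μ) - 6 * A)
        + (2 * a + 1) * (3 * a + 1) * (-(2 * s * μ) - 5 * A)) * (e * E)
      - k ^ 2 * (30 * a ^ 2 + 36 * a + 6) * E ^ 2 := by
  ring

/-- For `α ≠ 1` the compatibility condition is a vanishing combination of exponentials of the
dilaton, whose exponents are distinct except for special `α`; the vanishing of the coefficients leaves the
three cases, up to `α = 1/4`, which the remaining equation excludes. -/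
lemma IsAnsatz.consistency_ne_one {s ℓ μ α c k δ : ℝ} {U : Set (Fin 2 → ℝ)} {g : MetricField 2}
    {φ : (Fin 2 → ℝ) → ℝ} (h : IsAnsatz s U g φ) (hne : U.Nonempty) (hs : s ^ 2 = 1) (hμ : μ ≠ 0)
    (hℓ : ℓ ≠ 0) {a A : ℝ} (ha : a = 2 * (α - 1)) (ha0 : a ≠ 0) (ha1 : a ≠ 1)
    (hA : A * (a - 1) = -(2 * s * μ * (a + 1)))
    (H : ∀ x ∈ U, ScalarEqs s ℓ μ α c (φ x) (qFun A k a δ (φ x))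
      (A * exp (φ x) + a * k * exp (a * φ x)) (normSqDiff g φ x) (laplacian g φ x)
      (scalarCurv g x)) :
    Case1 α δ ∨ Case2 α c k δ ∨ Case3 ℓ μ α c k δ := by
  have hs0 : s ≠ 0 := by rintro rfl; norm_num at hs
  have ha1' : a - 1 ≠ 0 := sub_ne_zero.2 ha1
  obtain ⟨x0, hx0⟩ := hne
  obtain ⟨I, hIU, hI, hxI⟩ := mem_nhds_iff.1 (h.image_mem_nhds hx0)
  have hIne : I.Nonempty := ⟨_, hxI⟩
  have comp := fun x (hx : x ∈ U) => h.compatibility_q ha (hasDerivAt_qFun A k a δ)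
    (hasDerivAt_qFun_deriv hA) H hx rfl rfl rfl rfl
    (Q'' := A * exp (φ x) + a ^ 2 * k * exp (a * φ x)) (by linear_combination -exp (φ x) * hA)
  obtain ⟨w, hw⟩ : ∃ w, w = 1 / ℓ ^ 2 := ⟨_, rfl⟩
  have hw1 : ∀ r : ℝ, r / ℓ ^ 2 = r * w := fun r => by rw [hw]; ring
  -- the coefficients of `e^{j t}` in the compatibility condition
  obtain ⟨c0, hc0⟩ : ∃ c0, c0 = 2 * c * (a + 1) ^ 2 - δ ^ 2 * (5 * a ^ 2 + 12 * a + 6) := ⟨_, rfl⟩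
  obtain ⟨c1, hc1⟩ : ∃ c1, c1 = δ * ((4 * a + 6) * (-(2 * s * μ) - 6 * A)
    + (a + 1) * (2 * a + 1) * (-(2 * s * μ) - 5 * A)) := ⟨_, rfl⟩
  obtain ⟨c2, hc2⟩ : ∃ c2, c2 = (4 * a + 10) * (-(2 * s * μ * A) - 3 * A ^ 2)
        + (a + 2) * (2 * a + 2) * (-(2 * s * μ * A) - 5 / 2 * A ^ 2 + 6 * w) := ⟨_, rfl⟩
  obtain ⟨d0, hd0⟩ : ∃ d0, d0 = -(k * δ * (30 * a ^ 2 + 48 * a + 12)) := ⟨_, rfl⟩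
  obtain ⟨d1, hd1⟩ : ∃ d1, d1 = k * ((8 * a + 6) * (-(2 * s * μ) - 6 * A)
        + (2 * a + 1) * (3 * a + 1) * (-(2 * s * μ) - 5 * A)) := ⟨_, rfl⟩
  obtain ⟨d2, hd2⟩ : ∃ d2, d2 = -(k ^ 2 * (30 * a ^ 2 + 36 * a + 6)) := ⟨_, rfl⟩
  have hc1' : (a - 1) * c1 = 8 * (s * μ) * δ * (2 * a + 3) * (a + 2) ^ 2 := by
    rw [hc1]
    linear_combination δ * (-6 * (4 * a + 6) - 5 * (a + 1) * (2 * a + 1)) * hA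
  have hd1' : (a - 1) * d1 = 48 * (s * μ) * k * (a + 1) ^ 2 * (a + 2) := by
    rw [hd1]
    linear_combination k * (-6 * (8 * a + 6) - 5 * (2 * a + 1) * (3 * a + 1)) * hA
  have hc2' : (a - 1) ^ 2 * c2
      = 12 * (a + 1) * (a + 2) * ((a - 1) ^ 2 * w - μ ^ 2 * (a + 3) ^ 2) := by
    have hA2 : (A * (a - 1)) ^ 2 = 4 * μ ^ 2 * (a + 1) ^ 2 := by
      rw [hA]; linear_combination 4 * μ ^ 2 * (a + 1) ^ 2 * hs
    have hA3 : s * μ * (A * (a - 1)) = -(2 * μ ^ 2 * (a + 1)) := by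
      rw [hA]; linear_combination -2 * μ ^ 2 * (a + 1) * hs
    rw [hc2]
    linear_combination ((4 * a + 10) * (-3) - 5 / 2 * (a + 2) * (2 * a + 2)) * hA2
      + (a - 1) * (-2 * (4 * a + 10) - 2 * (a + 2) * (2 * a + 2)) * hA3
  have poly : ∀ t ∈ I, c0 + c1 * exp t + c2 * exp (2 * t) + d0 * exp (a * t)
      + d1 * exp ((a + 1) * t) + d2 * exp (2 * a * t) = 0 := by
    intro t ht
    obtain ⟨x, hx, rfl⟩ := hIU ht
    have := (comp x hx).2
    simp only [hw1, qFun] at this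
    rw [compatibility_expand, ← hc0, ← hc1, ← hc2, ← hd1] at this
    have e1 : exp (2 * φ x) = exp (φ x) ^ 2 := by rw [← exp_nat_mul]; push_cast; ring_nf
    have e2 : exp ((a + 1) * φ x) = exp (φ x) * exp (a * φ x) := by rw [← exp_add]; ring_nf
    have e3 : exp (2 * a * φ x) = exp (a * φ x) ^ 2 := by
      rw [← exp_nat_mul]; push_cast; ring_nf
    rw [e1, e2, e3, hd0, hd2]
    linear_combination this
  by_cases hm1 : a = -1
  · -- here `A = 0`, and the exponents `0` and `a + 1` coincide
    left
    have hA0 : A = 0 := by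
      rw [hm1] at hA; linarith
    have key := exp_sum_isolate hI hIne _ [(1, c1), (2, c2), (-1, d0), (-2, d2)] (c0 + d1) 0 rfl
      (by intro p hp; simp at hp; rcases hp with rfl | rfl | rfl | rfl <;> norm_num) (by
        intro t ht
        have := poly t ht
        rw [hm1] at this
        norm_num at this ⊢
        linear_combination this)
    rw [hc0, hd1, hm1, hA0] at key
    refine ⟨?_, by linarith⟩
    have hδ : δ ^ 2 = 0 := by linarith
    exact pow_eq_zero_iff (two_ne_zero) |>.1 hδ
  · right
    have hm1' : a + 1 ≠ 0 := fun h => hm1 (by linarith)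
    have hk : k = 0 := by
      by_cases hm2 : a = -2
      · have key := exp_sum_isolate hI hIne _ [(0, c0), (1, c1), (2, c2), (a, d0), (a + 1, d1)]
          d2 (2 * a) rfl
          (by intro p hp; simp at hp; rcases hp with rfl | rfl | rfl | rfl | rfl <;>
              norm_num [hm2]) (by
            intro t ht
            have := poly t ht
            simp
            linear_combination this)
        rw [hd2, hm2] at key
        have : k ^ 2 = 0 := by linarith
        exact pow_eq_zero_iff (two_ne_zero) |>.1 this
      · have key := exp_sum_isolate hI hIne _ [(0, c0), (1, c1), (2, c2), (a, d0), (2 * a, d2)]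
          d1 (a + 1) rfl
          (by intro p hp; simp at hp
              rcases hp with rfl | rfl | rfl | rfl | rfl <;> simp only [ne_eq]
              · exact fun h => hm1' h.symm
              · intro h; exact ha0 (by linarith)
              · intro h; exact ha1 (by linarith)
              · intro h; linarith
              · intro h; exact ha1 (by linarith)) (by
            intro t ht
            have := poly t ht
            simp
            linear_combination this)
        rw [key, mul_zero] at hd1'
        have hm2' : a + 2 ≠ 0 := fun h => hm2 (by linarith)
        by_contra hk
        have : 48 * (s * μ) * k * (a + 1) ^ 2 * (a + 2) ≠ 0 := by positivity
        exact this hd1'.symm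
    subst hk
    have poly' : ∀ t ∈ I, c0 + c1 * exp t + c2 * exp (2 * t) = 0 := fun t ht => by
      rw [← poly t ht, hd0, hd1, hd2]; ring
    have k0 : c0 = 0 := exp_sum_isolate hI hIne _ [(1, c1), (2, c2)] c0 0 rfl
      (by intro p hp; simp at hp; rcases hp with rfl | rfl <;> norm_num) (by
        intro t ht
        simp
        linear_combination poly' t ht)
    have k1 : c1 = 0 := exp_sum_isolate hI hIne _ [(0, c0), (2, c2)] c1 1 rfl
      (by intro p hp; simp at hp; rcases hp with rfl | rfl <;> norm_num) (by
        intro t ht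
        simp
        linear_combination poly' t ht)
    have k2 : c2 = 0 := exp_sum_isolate hI hIne _ [(0, c0), (1, c1)] c2 2 rfl
      (by intro p hp; simp at hp; rcases hp with rfl | rfl <;> norm_num) (by
        intro t ht
        simp
        linear_combination poly' t ht)
    by_cases hm2 : a = -2
    · left
      refine ⟨?_, rfl, by linarith⟩
      rw [hc0, hm2] at k0
      linarith
    · right
      have hm2' : a + 2 ≠ 0 := fun h => hm2 (by linarith)
      have hμℓ : μ ^ 2 * ℓ ^ 2 * (2 * α + 1) ^ 2 = (2 * α - 3) ^ 2 := by
        rw [k2, mul_zero] at hc2'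
        have h12 : 12 * (a + 1) * (a + 2) ≠ 0 := by positivity
        have h3 := (mul_eq_zero.1 hc2'.symm).resolve_left h12
        have e1 : 2 * α + 1 = a + 3 := by rw [ha]; ring
        have e2 : 2 * α - 3 = a - 1 := by rw [ha]; ring
        rw [e1, e2]
        rw [hw] at h3
        field_simp at h3
        linear_combination -h3
      have hδ : δ = 0 := by
        by_contra hδ
        rw [k1, mul_zero] at hc1'
        have h32 : 2 * a + 3 = 0 := by
          by_contra h32
          have : 8 * (s * μ) * δ * (2 * a + 3) * (a + 2) ^ 2 ≠ 0 := by positivity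
          exact this hc1'.symm
        have ha32 : a = -3 / 2 := by linarith
        rw [hc0, ha32] at k0
        have hc : c = -3 / 2 * δ ^ 2 := by linarith
        -- the remaining possibility `α = 1/4`, `c = -3 δ² / 2` passes the compatibility condition;
        -- the constant term of the last of the reduced equations excludes it
        have hAv : A = -(2 / 5) * (s * μ) := by rw [ha32] at hA; linarith
        obtain ⟨B, hB⟩ : ∃ B, B = 2 * s * μ := ⟨_, rfl⟩
        obtain ⟨v, hv⟩ : ∃ v, v = s / (2 * μ) := ⟨_, rfl⟩
        have hα : α = 1 / 4 := by linarith
        have hvA : v * A = -(1 / 5) := by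
          rw [hv, hAv]; field_simp; linear_combination -hs
        have key := exp_sum_isolate hI hIne _
          [(1, 4 / 5 * ((c - 5 / 2 * δ ^ 2) / 2
              - (a * (c - 5 / 2 * δ ^ 2) + 4 * (c - 3 * δ ^ 2)) / 8) - 1 / 2 * δ ^ 2
              + v * (c * A - 3 * δ ^ 2 * A)),
            (2, 4 / 5 * ((-(B * δ) - 5 * A * δ) / 2 - ((a + 1) * (-(B * δ) - 5 * A * δ)
              + 4 * (-(B * δ) - 6 * A * δ)) / 8) - A * δ - 3 * v * A ^ 2 * δ),
            (3, 4 / 5 * ((-(B * A) - 5 / 2 * A ^ 2 + 6 * w) / 2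
              - ((a + 2) * (-(B * A) - 5 / 2 * A ^ 2 + 6 * w)
                + 4 * (-(B * A) - 3 * A ^ 2)) / 8) - 1 / 2 * A ^ 2 - 2 * w - v * A ^ 3)]
          (v * (c * δ - δ ^ 3)) 0 rfl
          (by intro p hp; simp at hp; rcases hp with rfl | rfl | rfl <;> norm_num) (by
            intro t ht
            obtain ⟨x, hx, rfl⟩ := hIU ht
            obtain ⟨-, q2, q3⟩ := H x hx
            have q1 := (comp x hx).1
            have e2 : exp (2 * φ x) = exp (φ x) ^ 2 := by rw [← exp_nat_mul]; push_cast; ring_nf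
            have e3 : exp (3 * φ x) = exp (φ x) ^ 3 := by rw [← exp_nat_mul]; push_cast; ring_nf
            simp only [List.map_cons, List.map_nil, List.sum_cons, List.sum_nil, e2, e3]
            rw [← ha] at q2 q3
            have z : s / μ = 2 * v := by rw [hv]; field_simp
            simp only [hw1, qFun, ← hB, ← hv, z] at q1 q2 q3
            simp only [zero_mul, exp_zero, one_mul]
            apply mul_left_cancel₀ (exp_pos (a * φ x)).ne'
            rw [hα] at q3
            rw [ha32] at q1 q2 q3 ⊢
            linear_combination q3 - 2 / 5 * exp (φ x) * q2 + 1 / 10 * exp (φ x) * q1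
              - (exp (φ x) * (laplacian g φ x - 3 / 2 * normSqDiff g φ x)) * hvA)
        have : v * (-5 / 2 * δ ^ 3) = 0 := by rw [← key, hc]; ring
        have hv0 : v ≠ 0 := by rw [hv]; positivity
        have : v * (-5 / 2 * δ ^ 3) ≠ 0 := by
          have : δ ^ 3 ≠ 0 := pow_ne_zero _ hδ
          exact mul_ne_zero hv0 (mul_ne_zero (by norm_num) this)
        contradiction
      refine ⟨hδ, ?_, rfl, hμℓ⟩
      rw [hc0, hδ] at k0
      have h2 : 2 * (a + 1) ^ 2 ≠ 0 := by positivity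
      exact (mul_eq_zero.1 (show 2 * (a + 1) ^ 2 * c = 0 by linear_combination k0)).resolve_left h2

lemma deriv_eq_zero_of_eqOn {I : Set ℝ} (hI : IsOpen I) {G : ℝ → ℝ} {G' t : ℝ}
    (h : ∀ t ∈ I, G t = 0) (hG : HasDerivAt G G' t) (ht : t ∈ I) : G' = 0 :=
  hG.unique ((hasDerivAt_const t (0 : ℝ)).congr_of_eventuallyEq
    (Filter.eventuallyEq_of_mem (hI.mem_nhds ht) h))

/-- The independence of `t ^ i e^{j t}` that is needed for `α = 1`: the compatibility condition,
with `r = k t + δ`, differentiated three times and, divided by `e^t`, twice more. -/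
lemma poly_exp_isolate {I : Set ℝ} (hI : IsOpen I) (hne : I.Nonempty) {k δ C B w : ℝ} (hB : B ≠ 0)
    (h : ∀ t ∈ I, C - 6 * (k * t + δ) ^ 2 - 24 * k * (k * t + δ)
      - B * (48 * (k * t + δ) + 40 * k) * exp t + w * exp t ^ 2 = 0) :
    k = 0 ∧ δ = 0 ∧ C = 0 ∧ w = 0 := by
  have hr : ∀ t, HasDerivAt (fun t => k * t + δ) k t := fun t =>
    (((hasDerivAt_id t).const_mul k).add_const δ).congr_deriv (by ring)
  have he := Real.hasDerivAt_exp
  have dl : ∀ b t, HasDerivAt (fun t => B * (48 * (k * t + δ) + b * k) * exp t)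
      (B * (48 * (k * t + δ) + (b + 48) * k) * exp t) t := fun b t =>
    ((((((hr t).const_mul 48).add_const (b * k)).const_mul B)).mul (he t)).congr_deriv (by ring)
  have de : ∀ w t, HasDerivAt (fun t => w * exp t ^ 2) (2 * w * exp t ^ 2) t := fun w t =>
    (((he t).pow 2).const_mul w).congr_deriv (by simp; ring)
  have g1 : ∀ t ∈ I, -(12 * k * (k * t + δ)) - 24 * k ^ 2
      - B * (48 * (k * t + δ) + (40 + 48) * k) * exp t + 2 * w * exp t ^ 2 = 0 := fun t ht =>
    deriv_eq_zero_of_eqOn hI h ((((((hr t).pow 2).const_mul 6).const_sub C).sub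
      ((hr t).const_mul (24 * k)) |>.sub (dl 40 t) |>.add (de w t)).congr_deriv
        (by simp; ring)) ht
  have g2 : ∀ t ∈ I, -(12 * k ^ 2)
      - B * (48 * (k * t + δ) + (40 + 48 + 48) * k) * exp t + 2 * (2 * w) * exp t ^ 2 = 0 :=
    fun t ht => deriv_eq_zero_of_eqOn hI g1 (((((hr t).const_mul (12 * k)).neg.sub_const
      (24 * k ^ 2)).sub (dl _ t) |>.add (de _ t)).congr_deriv (by ring)) ht
  have g3 : ∀ t ∈ I, -(B * (48 * (k * t + δ) + (40 + 48 + 48 + 48) * k))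
      + 2 * (2 * (2 * w)) * exp t = 0 := fun t ht => by
    have := deriv_eq_zero_of_eqOn hI g2 (((dl _ t).const_sub _).add (de _ t)) ht
    apply mul_left_cancel₀ (exp_pos t).ne'
    linear_combination this
  have g4 : ∀ t ∈ I, -(48 * B * k) + 2 * (2 * (2 * w)) * exp t = 0 := fun t ht =>
    deriv_eq_zero_of_eqOn hI g3 ((((((hr t).const_mul 48).add_const _).const_mul B).neg.add
      ((he t).const_mul (2 * (2 * (2 * w))))).congr_deriv (by ring)) ht
  obtain ⟨t, ht⟩ := hne
  have g5 := deriv_eq_zero_of_eqOn hI g4 (((he t).const_mul _).const_add _) ht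
  have hw : w = 0 := by
    have : 8 * exp t * w = 0 := by linear_combination g5
    simpa [(exp_pos t).ne'] using this
  have hk : k = 0 := by
    have : 48 * B * k = 0 := by rw [← neg_eq_zero, ← g4 t ht, hw]; ring
    simpa [hB] using this
  have hδ : δ = 0 := by
    have h3 := g3 t ht
    rw [hk, hw] at h3
    have : 48 * B * δ = 0 := by linear_combination -h3
    simpa [hB] using this
  refine ⟨hk, hδ, ?_, hw⟩
  have h0 := h t ht
  rw [hk, hw, hδ] at h0
  linear_combination h0

lemma hasDerivAt_qFun_one (B k δ t : ℝ) :
    HasDerivAt (fun t => B * exp t + k * t + δ) (B * exp t + k) t :=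
  ((((Real.hasDerivAt_exp t).const_mul B).add ((hasDerivAt_id t).const_mul k)).add_const
    δ).congr_deriv (by ring)

/-- For `α = 1` the compatibility condition is a combination of exponentials with coefficients
polynomial in the dilaton, and leaves only the third case. -/
lemma IsAnsatz.consistency_one {s ℓ μ c k δ : ℝ} {U : Set (Fin 2 → ℝ)} {g : MetricField 2}
    {φ : (Fin 2 → ℝ) → ℝ} (h : IsAnsatz s U g φ) (hne : U.Nonempty) (hs : s ^ 2 = 1) (hμ : μ ≠ 0)
    (hℓ : ℓ ≠ 0)
    (H : ∀ x ∈ U, ScalarEqs s ℓ μ 1 c (φ x) (2 * s * μ * exp (φ x) + k * φ x + δ)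
      (2 * s * μ * exp (φ x) + k) (normSqDiff g φ x) (laplacian g φ x) (scalarCurv g x)) :
    Case3 ℓ μ 1 c k δ := by
  have hs0 : s ≠ 0 := by rintro rfl; norm_num at hs
  obtain ⟨x0, hx0⟩ := hne
  obtain ⟨I, hIU, hI, hxI⟩ := mem_nhds_iff.1 (h.image_mem_nhds hx0)
  obtain ⟨B, hB⟩ : ∃ B, B = 2 * s * μ := ⟨_, rfl⟩
  have hB0 : B ≠ 0 := by rw [hB]; positivity
  rw [← hB] at H
  obtain ⟨hk, hδ, hC, hw⟩ := poly_exp_isolate hI ⟨_, hxI⟩ (k := k) (δ := δ)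
    (C := 2 * c - 5 * k ^ 2) (w := 24 / ℓ ^ 2 - 54 * B ^ 2) hB0 (by
      intro t ht
      obtain ⟨x, hx, rfl⟩ := hIU ht
      have := (h.compatibility_q (a := 0) (by norm_num) (hasDerivAt_qFun_one B k δ)
        (fun t => (((Real.hasDerivAt_exp t).const_mul B).add_const k).congr_deriv
          (by rw [hB]; ring))
        H hx rfl rfl rfl rfl rfl).2
      rw [← hB] at this
      linear_combination this)
  refine ⟨hδ, ?_, hk, ?_⟩
  · rw [hk] at hC
    linarith
  · have hB2 : B ^ 2 = 4 * μ ^ 2 := by rw [hB]; linear_combination 4 * μ ^ 2 * hs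
    rw [hB2] at hw
    field_simp at hw
    linear_combination -hw / 24

/-! ### The prescribed field strength -/

lemma ansatzF_of_ne_one {s μ α kt δ : ℝ} (h1 : α ≠ 1) (t : ℝ) :
    ansatzF s μ α kt δ t = exp (2 * (α - 1) * t)
      * qFun (2 * s * μ * ((1 - 2 * α) / (2 * α - 3))) kt (2 * (α - 1)) δ t := by
  rw [ansatzF, if_neg h1, qFun]
  have e1 : exp ((2 * α - 1) * t) = exp (2 * (α - 1) * t) * exp t := by rw [← exp_add]; ring_nf
  have e2 : exp ((4 * α - 4) * t) = exp (2 * (α - 1) * t) * exp (2 * (α - 1) * t) := by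
    rw [← exp_add]; ring_nf
  have e3 : exp ((2 * α - 2) * t) = exp (2 * (α - 1) * t) := by ring_nf
  rw [e1, e2, e3]
  ring

lemma ansatzF_one {s μ kt δ : ℝ} (t : ℝ) :
    ansatzF s μ 1 kt δ t = exp (2 * (1 - 1) * t) * (2 * s * μ * exp t + kt * t + δ) := by
  rw [ansatzF, if_pos rfl, sub_self, mul_zero, zero_mul, exp_zero]
  ring

lemma coeff_relation {s μ α : ℝ} (hα : α ≠ 3 / 2) :
    2 * s * μ * ((1 - 2 * α) / (2 * α - 3)) * (2 * (α - 1) - 1)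
      = -(2 * s * μ * (2 * (α - 1) + 1)) := by
  have : 2 * α - 3 ≠ 0 := fun h => hα (by linarith)
  field_simp
  ring

lemma IsAnsatz.reducedTMG_iff_of_ne_one {s ℓ μ α c kt δ : ℝ} {U : Set (Fin 2 → ℝ)}
    {g : MetricField 2} {φ : (Fin 2 → ℝ) → ℝ} (h : IsAnsatz s U g φ) (hs : s ^ 2 = 1) (hμ : μ ≠ 0)
    (hα : α ≠ 3 / 2) (h1 : α ≠ 1) {a A : ℝ} (ha : a = 2 * (α - 1))
    (hA : A = 2 * s * μ * ((1 - 2 * α) / (2 * α - 3))) :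
    ReducedTMG s ℓ μ α c U g φ (fun x => ansatzF s μ α kt δ (φ x)) ↔
      ∀ x ∈ U, ScalarEqs s ℓ μ α c (φ x) (qFun A kt a δ (φ x))
        (A * exp (φ x) + a * kt * exp (a * φ x)) (normSqDiff g φ x) (laplacian g φ x)
        (scalarCurv g x) := by
  subst ha hA
  refine h.reducedTMG_iff hs hμ (ansatzF_of_ne_one h1) (hasDerivAt_qFun _ _ _ _) fun t => ?_
  convert hasDerivAt_qFun_deriv (coeff_relation hα) t using 1
  ring

lemma IsAnsatz.reducedTMG_iff_of_eq_one {s ℓ μ c kt δ : ℝ} {U : Set (Fin 2 → ℝ)}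
    {g : MetricField 2} {φ : (Fin 2 → ℝ) → ℝ} (h : IsAnsatz s U g φ) (hs : s ^ 2 = 1)
    (hμ : μ ≠ 0) :
    ReducedTMG s ℓ μ 1 c U g φ (fun x => ansatzF s μ 1 kt δ (φ x)) ↔
      ∀ x ∈ U, ScalarEqs s ℓ μ 1 c (φ x) (2 * s * μ * exp (φ x) + kt * φ x + δ)
        (2 * s * μ * exp (φ x) + kt) (normSqDiff g φ x) (laplacian g φ x) (scalarCurv g x) := by
  refine h.reducedTMG_iff hs hμ (q := fun t => 2 * s * μ * exp t + kt * t + δ)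
    (q' := fun t => 2 * s * μ * exp t + kt) ansatzF_one (hasDerivAt_qFun_one _ _ _) fun t => ?_
  exact (((Real.hasDerivAt_exp t).const_mul _).add_const _).congr_deriv (by ring)

/-- The reduced equations are consistent in the three cases only. -/
theorem IsAnsatz.consistency {s ℓ μ α c kt δ : ℝ} {U : Set (Fin 2 → ℝ)} {g : MetricField 2}
    {φ : (Fin 2 → ℝ) → ℝ} (h : IsAnsatz s U g φ) (hne : U.Nonempty) (hs : s ^ 2 = 1) (hμ : μ ≠ 0)
    (hℓ : ℓ ≠ 0) (hα : α ≠ 3 / 2)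
    (H : ReducedTMG s ℓ μ α c U g φ (fun x => ansatzF s μ α kt δ (φ x))) :
    Case1 α δ ∨ Case2 α c kt δ ∨ Case3 ℓ μ α c kt δ := by
  by_cases h1 : α = 1
  · subst h1
    exact Or.inr (Or.inr (h.consistency_one hne hs hμ hℓ
      ((h.reducedTMG_iff_of_eq_one hs hμ).1 H)))
  · exact h.consistency_ne_one hne hs hμ hℓ rfl (fun h0 => h1 (by linarith))
      (fun h0 => hα (by linarith)) (coeff_relation hα)
      ((h.reducedTMG_iff_of_ne_one hs hμ hα h1 rfl rfl).1 H)

/-! ### The solutions -/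

lemma IsAnsatz.reducedTMG_iff_case1 {s ℓ μ α c kt δ : ℝ} {U : Set (Fin 2 → ℝ)}
    {g : MetricField 2} {φ : (Fin 2 → ℝ) → ℝ} (h : IsAnsatz s U g φ) (hs : s ^ 2 = 1) (hμ : μ ≠ 0)
    (hc : Case1 α δ) :
    ReducedTMG s ℓ μ α c U g φ (fun x => ansatzF s μ α kt δ (φ x)) ↔
      ∀ x ∈ U, normSqDiff g φ x = profile1 s ℓ μ c kt (φ x) := by
  obtain ⟨rfl, rfl⟩ := hc
  rw [h.reducedTMG_iff_of_ne_one hs hμ (by norm_num) (by norm_num) (a := -1) (A := 0)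
    (by norm_num) (by norm_num)]
  have en : ∀ t : ℝ, exp (-3 * t) = exp (-t) ^ 3 := fun t => by
    rw [← exp_nat_mul]; push_cast; ring_nf
  have ep : ∀ t : ℝ, exp t * exp (-t) = 1 := fun t => by rw [← exp_add]; simp
  obtain ⟨v, hv⟩ : ∃ v, v = s / (2 * μ) := ⟨_, rfl⟩
  have hs0 : s ≠ 0 := by rintro rfl; norm_num at hs
  have hv0 : v ≠ 0 := by rw [hv]; positivity
  have hB : s * μ = 1 / (2 * v) := by rw [hv]; field_simp; exact hs
  have hB1 : ∀ r, r * s * μ = r / (2 * v) := fun r => by rw [mul_assoc, hB]; ring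
  have hB2 : s * 2 * μ = 1 / v := by linear_combination 2 * hB
  have hz : s / μ = 2 * v := by rw [hv]; field_simp
  have hw1 : ∀ r : ℝ, r / ℓ ^ 2 = r * (1 / ℓ ^ 2) := fun r => by ring
  have hα : ∀ t : ℝ, 2 * ((1 : ℝ) / 2 - 1) * t = -t := fun t => by ring
  constructor
  · intro H x hx
    have k1 := (h.compatibility_q (a := -1) (by norm_num) (hasDerivAt_qFun 0 kt (-1) 0)
      (fun t => hasDerivAt_qFun_deriv (by norm_num) t) H hx rfl rfl rfl rfl rfl).1
    have k2 := (H x hx).2.1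
    have e0 := exp_ne_zero (φ x)
    simp only [qFun, profile1, en, hα, neg_one_mul, exp_neg, hB1, hB2, hw1 6, hw1 12] at *
    generalize exp (φ x) = e at *
    generalize 1 / ℓ ^ 2 = w at *
    -- the second equation gives `|dφ|²` in terms of `D²φ`, which compatibility determines
    rw [show normSqDiff g φ x = 1 / 2 * (4 * laplacian g φ x + 2 * normSqDiff g φ x)
      - 1 / 3 * ((2 - 4 * -1) * laplacian g φ x) by ring, k1, k2]
    field_simp
    ring
  · intro H x hx
    have he : ∀ t, HasDerivAt (fun t => exp (-t)) (-exp (-t)) t := fun t => by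
      simpa using (hasDerivAt_id t).neg.exp
    have hn : ∀ t, HasDerivAt (profile1 s ℓ μ c kt)
        ((fun t : ℝ => 1 / 2 * (c - s * 2 * μ * kt) * exp (-t) + 1 / ℓ ^ 2 * exp t
          - 3 / 4 * kt ^ 2 * exp (-t) ^ 3) t) t := by
      intro t
      unfold profile1
      simp only [en]
      exact ((((he t).const_mul _).add ((Real.hasDerivAt_exp t).const_mul _)).add
        (((he t).pow 3).const_mul _)).congr_deriv (by simp; ring)
    have hn' : ∀ t, HasDerivAt
        (fun t : ℝ => 1 / 2 * (c - s * 2 * μ * kt) * exp (-t) + 1 / ℓ ^ 2 * exp t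
          - 3 / 4 * kt ^ 2 * exp (-t) ^ 3)
        ((fun t : ℝ => -(1 / 2) * (c - s * 2 * μ * kt) * exp (-t) + 1 / ℓ ^ 2 * exp t
          + 9 / 4 * kt ^ 2 * exp (-t) ^ 3) t) t := by
      intro t
      exact ((((he t).const_mul _).add ((Real.hasDerivAt_exp t).const_mul _)).sub
        (((he t).pow 3).const_mul _)).congr_deriv (by simp; ring)
    obtain ⟨hL, hR⟩ := h.of_profile hn hn' H hx
    rw [H x hx, hL, hR]
    have e0 := exp_ne_zero (φ x)
    simp only [ScalarEqs, qFun, profile1, en, hα, neg_one_mul, exp_neg, hB1, hB2, hw1 6, hw1 2,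
      ← hv, hz] at *
    generalize exp (φ x) = e at *
    generalize 1 / ℓ ^ 2 = w at *
    refine ⟨?_, ?_, ?_⟩ <;> field_simp <;> ring

lemma IsAnsatz.reducedTMG_iff_case2 {s ℓ μ α c kt δ : ℝ} {U : Set (Fin 2 → ℝ)}
    {g : MetricField 2} {φ : (Fin 2 → ℝ) → ℝ} (h : IsAnsatz s U g φ) (hs : s ^ 2 = 1) (hμ : μ ≠ 0)
    (hc : Case2 α c kt δ) :
    ReducedTMG s ℓ μ α c U g φ (fun x => ansatzF s μ α kt δ (φ x)) ↔
      ∀ x ∈ U, normSqDiff g φ x = profile2 s ℓ μ δ (φ x) := by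
  obtain ⟨rfl, rfl, rfl⟩ := hc
  rw [h.reducedTMG_iff_of_ne_one hs hμ (by norm_num) (by norm_num) (a := -2)
    (A := -(2 / 3) * s * μ) (by norm_num) (by ring)]
  have en : ∀ t : ℝ, exp (-2 * t) = exp (-t) ^ 2 := fun t => by
    rw [← exp_nat_mul]; push_cast; ring_nf
  obtain ⟨v, hv⟩ : ∃ v, v = s / (2 * μ) := ⟨_, rfl⟩
  have hs0 : s ≠ 0 := by rintro rfl; norm_num at hs
  have hv0 : v ≠ 0 := by rw [hv]; positivity
  have hB : s * μ = 1 / (2 * v) := by rw [hv]; field_simp; exact hs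
  have hB1 : ∀ r, r * s * μ = r / (2 * v) := fun r => by rw [mul_assoc, hB]; ring
  have hB2 : s * (2 / 3) * μ = 1 / (3 * v) := by
    have : 1 / (3 * v) = 2 / 3 * (1 / (2 * v)) := by field_simp
    rw [this, ← hB]
    ring
  have hμ2 : μ ^ 2 = 1 / (4 * v ^ 2) := by
    have : 1 / (4 * v ^ 2) = (1 / (2 * v)) ^ 2 := by field_simp; norm_num
    rw [this, ← hB]
    linear_combination -μ ^ 2 * hs
  have hz : s / μ = 2 * v := by rw [hv]; field_simp
  have hw1 : ∀ r : ℝ, r / ℓ ^ 2 = r * (1 / ℓ ^ 2) := fun r => by ring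
  have hα : ∀ t : ℝ, 2 * ((0 : ℝ) - 1) * t = -2 * t := fun t => by ring
  constructor
  · intro H x hx
    obtain ⟨-, k2, k3⟩ := H x hx
    have e0 := exp_ne_zero (φ x)
    simp only [qFun, profile2, en, hα, exp_neg, hB1, hB2, hw1 6, hw1 2, hw1 3, ← hv, hz, hμ2]
      at k2 k3 ⊢
    generalize exp (φ x) = e at *
    generalize 1 / ℓ ^ 2 = w at *
    generalize laplacian g φ x = L at *
    generalize normSqDiff g φ x = N at *
    apply mul_left_cancel₀ e0
    -- `D²φ` cancels in a combination of the last two equations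
    rw [show e * N = 3 * ((e + v * (-(2 / 3) / (2 * v) * e + -2 * 0 * (e⁻¹) ^ 2)) * L
      + (2 * 0 * e + 2 * v * (0 - 1) * (-(2 / 3) / (2 * v) * e + -2 * 0 * (e⁻¹) ^ 2)) * N)
      - e / 2 * (4 * L + 2 * N) by field_simp; ring, k2, eq_neg_of_add_eq_zero_left k3]
    field_simp
    ring
  · intro H x hx
    have he : ∀ t, HasDerivAt (fun t => exp (-t)) (-exp (-t)) t := fun t => by
      simpa using (hasDerivAt_id t).neg.exp
    have hn : ∀ t, HasDerivAt (profile2 s ℓ μ δ)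
        ((fun t : ℝ => s * (2 / 3) * μ * δ * exp (-t) - 1 / 2 * δ ^ 2 * exp (-t) ^ 2) t) t := by
      intro t
      unfold profile2
      simp only [en]
      exact ((((he t).const_mul _).neg.add (((he t).pow 2).const_mul _)).add_const
        _).congr_deriv (by simp; ring)
    have hn' : ∀ t, HasDerivAt
        (fun t : ℝ => s * (2 / 3) * μ * δ * exp (-t) - 1 / 2 * δ ^ 2 * exp (-t) ^ 2)
        ((fun t : ℝ => -(s * (2 / 3) * μ * δ * exp (-t)) + δ ^ 2 * exp (-t) ^ 2) t) t := by
      intro t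
      exact (((he t).const_mul _).sub (((he t).pow 2).const_mul _)).congr_deriv (by simp; ring)
    obtain ⟨hL, hR⟩ := h.of_profile hn hn' H hx
    rw [H x hx, hL, hR]
    have e0 := exp_ne_zero (φ x)
    simp only [ScalarEqs, qFun, profile2, en, hα, exp_neg, hB1, hB2, hw1 6, hw1 2, hw1 3, ← hv,
      hz, hμ2]
    generalize exp (φ x) = e at *
    generalize 1 / ℓ ^ 2 = w at *
    refine ⟨?_, ?_, ?_⟩ <;> field_simp <;> ring

lemma IsAnsatz.reducedTMG_iff_case3 {s ℓ μ α c kt δ : ℝ} {U : Set (Fin 2 → ℝ)}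
    {g : MetricField 2} {φ : (Fin 2 → ℝ) → ℝ} (h : IsAnsatz s U g φ) (hs : s ^ 2 = 1) (hμ : μ ≠ 0)
    (hℓ : ℓ ≠ 0) (hα : α ≠ 3 / 2) (hc : Case3 ℓ μ α c kt δ) :
    ReducedTMG s ℓ μ α c U g φ (fun x => ansatzF s μ α kt δ (φ x)) ↔
      ∀ x ∈ U, normSqDiff g φ x = profile3 μ α (φ x) := by
  obtain ⟨rfl, rfl, rfl, hμℓ⟩ := hc
  have hb0 : 2 * α - 3 ≠ 0 := fun h0 => hα (by linarith)
  obtain ⟨A, hA⟩ : ∃ A, A = 2 * s * μ * ((1 - 2 * α) / (2 * α - 3)) := ⟨_, rfl⟩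
  -- for `α = 1` the two forms of the field strength agree, as `kt = 0`
  have hred : ReducedTMG s ℓ μ α 0 U g φ (fun x => ansatzF s μ α 0 0 (φ x)) ↔
      ∀ x ∈ U, ScalarEqs s ℓ μ α 0 (φ x) (A * exp (φ x)) (A * exp (φ x)) (normSqDiff g φ x)
        (laplacian g φ x) (scalarCurv g x) := by
    by_cases h1 : α = 1
    · subst h1
      have hA' : A = 2 * s * μ := by rw [hA]; norm_num
      rw [h.reducedTMG_iff_of_eq_one hs hμ]
      simp [hA']
    · rw [h.reducedTMG_iff_of_ne_one hs hμ hα h1 rfl hA]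
      simp [qFun]
  rw [hred]
  have hw : 1 / ℓ ^ 2 = μ ^ 2 * (2 * α + 1) ^ 2 / (2 * α - 3) ^ 2 := by
    field_simp; linear_combination -hμℓ
  have hw1 : ∀ r : ℝ, r / ℓ ^ 2 = r * (μ ^ 2 * (2 * α + 1) ^ 2 / (2 * α - 3) ^ 2) := fun r => by
    rw [← hw]; ring
  have ee : ∀ t : ℝ, exp (2 * α * t) = exp (2 * (α - 1) * t) * exp t ^ 2 := fun t => by
    rw [← exp_nat_mul, ← exp_add]; push_cast; ring_nf
  obtain ⟨v, hv⟩ : ∃ v, v = s / (2 * μ) := ⟨_, rfl⟩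
  have hs0 : s ≠ 0 := by rintro rfl; norm_num at hs
  have hv0 : v ≠ 0 := by rw [hv]; positivity
  have hB : s * μ = 1 / (2 * v) := by rw [hv]; field_simp; exact hs
  have hA' : A = (1 - 2 * α) / (v * (2 * α - 3)) := by
    rw [hA, mul_assoc 2 s μ, hB]; field_simp
  have hμ2 : μ ^ 2 = 1 / (4 * v ^ 2) := by
    have : 1 / (4 * v ^ 2) = (1 / (2 * v)) ^ 2 := by field_simp; norm_num
    rw [this, ← hB]
    linear_combination -μ ^ 2 * hs
  have hz : s / μ = 2 * v := by rw [hv]; field_simp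
  have hB1 : ∀ r, r * s * μ = r / (2 * v) := fun r => by rw [mul_assoc, hB]; ring
  constructor
  · intro H x hx
    obtain ⟨-, k2, k3⟩ := H x hx
    have e0 := exp_ne_zero (φ x)
    simp only [hw1, profile3, ee, hA', ← hv, hz, hμ2, hB1] at k2 k3 ⊢
    generalize exp (φ x) = e at *
    generalize laplacian g φ x = L at *
    generalize normSqDiff g φ x = N at *
    generalize exp (2 * (α - 1) * φ x) = E at *
    apply mul_left_cancel₀ e0
    -- `D²φ` cancels in a combination of the last two equations
    rw [show e * N = -(2 * α - 3) * ((e + v * ((1 - 2 * α) / (v * (2 * α - 3)) * e)) * L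
      + (2 * α * e + 2 * v * (α - 1) * ((1 - 2 * α) / (v * (2 * α - 3)) * e)) * N)
      - e / 2 * (4 * L + 2 * N) by field_simp; ring, k2, eq_neg_of_add_eq_zero_left k3]
    field_simp
    ring
  · intro H x hx
    have hn : ∀ t, HasDerivAt (profile3 μ α)
        ((fun t : ℝ => 2 * α * (4 * μ ^ 2 / (2 * α - 3) ^ 2 * exp (2 * α * t))) t) t := by
      intro t
      exact ((hasDerivAt_exp_mul (2 * α) t).const_mul _).congr_deriv (by ring)
    have hn' : ∀ t, HasDerivAt
        (fun t : ℝ => 2 * α * (4 * μ ^ 2 / (2 * α - 3) ^ 2 * exp (2 * α * t)))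
        ((fun t : ℝ => 2 * α * (2 * α * (4 * μ ^ 2 / (2 * α - 3) ^ 2 * exp (2 * α * t)))) t)
        t := by
      intro t
      exact (((hasDerivAt_exp_mul (2 * α) t).const_mul _).const_mul _).congr_deriv (by ring)
    obtain ⟨hL, hR⟩ := h.of_profile hn hn' H hx
    rw [H x hx, hL, hR]
    have e0 := exp_ne_zero (φ x)
    simp only [ScalarEqs, hw1, profile3, ee, hA', ← hv, hz, hμ2, hB1]
    generalize exp (φ x) = e at *
    generalize exp (2 * (α - 1) * φ x) = E at *
    refine ⟨?_, ?_, ?_⟩ <;> field_simp <;> ring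

/-! ### Existence of solutions -/

/-- The static metric `dt² / n(t) - s n(t) dx²`, for which `|dt|² = n`. -/
noncomputable def staticMetric (s : ℝ) (n : ℝ → ℝ) : MetricField 2 := fun x =>
  !![1 / n (x 0), 0; 0, -s * n (x 0)]

lemma staticMetric_det {s : ℝ} {n : ℝ → ℝ} {x : Fin 2 → ℝ} (h0 : n (x 0) ≠ 0) :
    (staticMetric s n x).det = -s := by
  rw [staticMetric, Matrix.det_fin_two_of]
  field_simp
  ring

lemma staticMetric_isAnsatz {s : ℝ} (hs : s = 1 ∨ s = -1) {n n' : ℝ → ℝ} {I : Set ℝ} (hI : IsOpen I)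
    (hn : ContDiff ℝ ∞ n) (hn' : ∀ t, HasDerivAt n (n' t) t) (hpos : ∀ t ∈ I, 0 < n t) :
    IsAnsatz s {x | x 0 ∈ I} (staticMetric s n) (fun x => x 0) ∧
      ∀ x : Fin 2 → ℝ, x 0 ∈ I → normSqDiff (staticMetric s n) (fun x => x 0) x = n (x 0) := by
  have hs0 : s ≠ 0 := by rcases hs with rfl | rfl <;> norm_num
  have hs2 : s ^ 2 = 1 := by rcases hs with rfl | rfl <;> norm_num
  have hU : IsOpen {x : Fin 2 → ℝ | x 0 ∈ I} := hI.preimage (continuous_apply 0)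
  have hnx : ContDiff ℝ ∞ (fun x : Fin 2 → ℝ => n (x 0)) := hn.comp (contDiff_apply ℝ ℝ 0)
  have hdet : ∀ x : Fin 2 → ℝ, x 0 ∈ I → (staticMetric s n x).det = -s :=
    fun x hx => staticMetric_det (hpos _ hx).ne'
  have hm : IsMetricOn (staticMetric s n) {x | x 0 ∈ I} := by
    refine ⟨fun i j => ?_, fun x _ => ?_, fun x hx => ?_⟩
    · have h0 : ∀ x ∈ {x : Fin 2 → ℝ | x 0 ∈ I}, n (x 0) ≠ 0 := fun x hx => (hpos _ hx).ne'
      match i, j with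
      | 0, 0 => exact (contDiffOn_const (c := (1 : ℝ))).div hnx.contDiffOn h0
      | 0, 1 => exact contDiffOn_const (c := (0 : ℝ))
      | 1, 0 => exact contDiffOn_const (c := (0 : ℝ))
      | 1, 1 => exact (contDiff_const.mul hnx).contDiffOn
    · ext i j
      fin_cases i <;> fin_cases j <;> simp [staticMetric]
    · rw [hdet x hx]
      simpa using hs0
  have hφ : ∀ a (x : Fin 2 → ℝ), pd a (fun x => x 0) x = if a = 0 then 1 else 0 :=
    fun a x => pd_coord a 0 x
  have hN : ∀ x : Fin 2 → ℝ, x 0 ∈ I →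
      normSqDiff (staticMetric s n) (fun x => x 0) x = n (x 0) := fun x hx => by
    have h0 := (hpos _ hx).ne'
    rw [normSqDiff, hm.tr_eq hx, hdet x hx, hφ, hφ]
    simp [staticMetric]
    field_simp
  refine ⟨⟨hU, hm, ?_, ?_, contDiff_apply ℝ ℝ 0 |>.contDiffOn, ?_, ?_⟩, hN⟩
  · rintro rfl x hx
    rw [hdet x hx]
    norm_num
  · rintro rfl x hx
    have : staticMetric (-1) n x = Matrix.diagonal ![1 / n (x 0), n (x 0)] := by
      ext i j
      fin_cases i <;> fin_cases j <;> simp [staticMetric]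
    rw [this]
    refine Matrix.PosDef.diagonal fun i => ?_
    have := hpos _ hx
    fin_cases i <;> simp [this]
  · intro x hx
    have h0 := (hpos _ hx).ne'
    have hinv := inv_two_apply (staticMetric s n x)
    rw [hdet x hx] at hinv
    have p00 : ∀ c : Fin 2, pd c (fun y => staticMetric s n y 0 0) x
        = if c = 0 then -n' (x 0) / n (x 0) ^ 2 else 0 := fun c => by
      refine pd_comp_coord c 0 (x := x) (F := fun t => 1 / n t) ?_
      simp only [one_div]
      exact (hn' (x 0)).fun_inv h0
    have p11 : ∀ c : Fin 2, pd c (fun y => staticMetric s n y 1 1) x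
        = if c = 0 then -s * n' (x 0) else 0 := fun c =>
      pd_comp_coord c 0 (x := x) (F := fun t => -s * n t) ((hn' (x 0)).const_mul _)
    have p01 : ∀ c : Fin 2, pd c (fun y => staticMetric s n y 0 1) x = 0 := fun c =>
      pd_const c 0 x
    have p10 : ∀ c : Fin 2, pd c (fun y => staticMetric s n y 1 0) x = 0 := fun c =>
      pd_const c 0 x
    have hcov : ∀ a b, covD (staticMetric s n) (diff fun x => x 0) x a b
        = n' (x 0) / 2 * staticMetric s n x a b := by
      intro a b
      have hpp : pd a (pd b fun x : Fin 2 → ℝ => x 0) x = 0 := by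
        rw [show (pd b fun x : Fin 2 → ℝ => x 0) = fun _ => if b = 0 then 1 else 0 from
          funext fun y => hφ b y, pd_const]
      rw [covD, Fin.sum_univ_two]
      simp only [diff, hφ, hpp]
      have v00 : staticMetric s n x 0 0 = 1 / n (x 0) := rfl
      have v01 : staticMetric s n x 0 1 = 0 := rfl
      have v10 : staticMetric s n x 1 0 = 0 := rfl
      have v11 : staticMetric s n x 1 1 = -s * n (x 0) := rfl
      rw [v00, v01, v10, v11] at hinv
      simp only [christoffel, Fin.sum_univ_two, hinv]
      match a, b with
      | 0, 0 => simp [p00, p10, v00]; field_simp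
      | 0, 1 => simp [p00, p01, p10, v01]
      | 1, 0 => simp [p00, p01, p10, v10]
      | 1, 1 => simp [p01, p11, v11]; field_simp
    have hc : covD (staticMetric s n) (diff fun x => x 0) x = fun a b =>
        n' (x 0) / 2 * staticMetric s n x a b := by
      ext a b
      exact hcov a b
    intro a b
    rw [hc, tracelessPart, hm.tr_eq hx, symPart, hdet x hx, (hm.symm x hx).apply a b]
    have hd := hdet x hx
    rw [hm.det_eq hx] at hd
    have hs' := (hm.symm x hx).apply 0 1
    rw [hs']
    push_cast
    field_simp
    linear_combination (2 * n' (x 0) * staticMetric s n x a b) * hd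
  · intro x hx
    rw [hN x hx]
    exact (hpos _ hx).ne'

/-- Solutions exist in each of the three cases: the profile is positive for large values of the
dilaton. -/
theorem exists_solution {s ℓ μ α c kt δ : ℝ} (hs : s = 1 ∨ s = -1) (hμ : μ ≠ 0)
    (hℓ : ℓ ≠ 0) (hα : α ≠ 3 / 2)
    (hc : Case1 α δ ∨ Case2 α c kt δ ∨ Case3 ℓ μ α c kt δ) :
    ∃ (U : Set (Fin 2 → ℝ)) (gb : MetricField 2) (φ : (Fin 2 → ℝ) → ℝ), U.Nonempty ∧
      IsAnsatz s U gb φ ∧ ReducedTMG s ℓ μ α c U gb φ (fun x => ansatzF s μ α kt δ (φ x)) := by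
  have hs2 : s ^ 2 = 1 := by rcases hs with rfl | rfl <;> norm_num
  have hb0 : 2 * α - 3 ≠ 0 := fun h0 => hα (by linarith)
  -- a profile that is positive somewhere gives an example on a small interval
  have key : ∀ n : ℝ → ℝ, ContDiff ℝ ∞ n → (∃ t, 0 < n t) → ∃ (U : Set (Fin 2 → ℝ))
      (gb : MetricField 2) (φ : (Fin 2 → ℝ) → ℝ), U.Nonempty ∧ IsAnsatz s U gb φ ∧
        ∀ x ∈ U, normSqDiff gb φ x = n (φ x) := by
    rintro n hn ⟨t, ht⟩
    obtain ⟨h1, h2⟩ := staticMetric_isAnsatz hs (isOpen_lt continuous_const hn.continuous) hn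
      (fun t => (hn.differentiable (by simp) t).hasDerivAt) (fun t ht => ht)
    exact ⟨_, _, _, ⟨fun _ => t, ht⟩, h1, h2⟩
  rcases hc with hc | hc | hc
  · obtain ⟨U, gb, φ, h1, h2, h3⟩ := key (profile1 s ℓ μ c kt)
      (by unfold profile1; fun_prop) (by
        -- `e^t |dφ|² ≥ e^{2 t} / ℓ² - |c - 2 s μ kt| / 2`
        obtain ⟨D, hD⟩ : ∃ D, D = c - s * 2 * μ * kt := ⟨_, rfl⟩
        refine ⟨log (1 + ℓ ^ 2 * |D|), ?_⟩
        have hr : 0 < 1 + ℓ ^ 2 * |D| := by positivity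
        rw [profile1, exp_neg, exp_log hr, ← hD]
        have h3 : 0 ≤ 1 / 4 * kt ^ 2 * exp (-3 * log (1 + ℓ ^ 2 * |D|)) := by positivity
        have h4 : D ≤ |D| := le_abs_self D
        have h5 : 0 < -(1 / 2) * D * (1 + ℓ ^ 2 * |D|)⁻¹ + 1 / ℓ ^ 2 * (1 + ℓ ^ 2 * |D|) := by
          have : -(1 / 2) * D * (1 + ℓ ^ 2 * |D|)⁻¹ + 1 / ℓ ^ 2 * (1 + ℓ ^ 2 * |D|)
            = (-(1 / 2) * D * ℓ ^ 2 + (1 + ℓ ^ 2 * |D|) ^ 2) / (ℓ ^ 2 * (1 + ℓ ^ 2 * |D|)) := by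
            field_simp
          rw [this]
          apply div_pos _ (by positivity)
          have h6 : ℓ ^ 2 * D ≤ ℓ ^ 2 * |D| := by gcongr
          nlinarith [sq_nonneg (ℓ ^ 2 * |D|), mul_nonneg (sq_nonneg ℓ) (abs_nonneg D)]
        linarith)
    exact ⟨U, gb, φ, h1, h2, (h2.reducedTMG_iff_case1 hs2 hμ hc).2 h3⟩
  · obtain ⟨U, gb, φ, h1, h2, h3⟩ := key (profile2 s ℓ μ δ)
      (by unfold profile2; fun_prop) (by
        have hlim : Filter.Tendsto (profile2 s ℓ μ δ) Filter.atTop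
            (𝓝 (-(s * (2 / 3) * μ * δ * 0) + 1 / 4 * δ ^ 2 * 0 + (3 / ℓ ^ 2 + μ ^ 2 / 9))) := by
          unfold profile2
          have e1 : Filter.Tendsto (fun t : ℝ => exp (-t)) Filter.atTop (𝓝 0) :=
            tendsto_exp_neg_atTop_nhds_zero
          have e2 : Filter.Tendsto (fun t : ℝ => exp (-2 * t)) Filter.atTop (𝓝 0) :=
            Real.tendsto_exp_atBot.comp (Filter.tendsto_id.const_mul_atTop_of_neg (by norm_num))
          exact (((e1.const_mul _).neg).add (e2.const_mul _)).add_const _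
        have hp : 0 < -(s * (2 / 3) * μ * δ * 0) + 1 / 4 * δ ^ 2 * 0
            + (3 / ℓ ^ 2 + μ ^ 2 / 9) := by
          have : 0 < 3 / ℓ ^ 2 + μ ^ 2 / 9 := by positivity
          simpa using this
        exact (hlim.eventually (lt_mem_nhds hp)).exists)
    exact ⟨U, gb, φ, h1, h2, (h2.reducedTMG_iff_case2 hs2 hμ hc).2 h3⟩
  · obtain ⟨U, gb, φ, h1, h2, h3⟩ := key (profile3 μ α)
      (by unfold profile3; fun_prop) ⟨0, by unfold profile3; positivity⟩
    exact ⟨U, gb, φ, h1, h2, (h2.reducedTMG_iff_case3 hs2 hμ hℓ hα hc).2 h3⟩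

/-! ### Adapted coordinates -/

/-- The Poincaré lemma for one-forms in two variables. -/
lemma exists_primitive {V : Set (Fin 2 → ℝ)} (hV : IsOpen V) (hc : Convex ℝ V)
    {ω0 ω1 : (Fin 2 → ℝ) → ℝ} (h0 : ContDiffOn ℝ ∞ ω0 V) (h1 : ContDiffOn ℝ ∞ ω1 V)
    (hclosed : ∀ x ∈ V, pd 0 ω1 x = pd 1 ω0 x) :
    ∃ ψ : (Fin 2 → ℝ) → ℝ, ContDiffOn ℝ ∞ ψ V ∧
      ∀ x ∈ V, pd 0 ψ x = ω0 x ∧ pd 1 ψ x = ω1 x := by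
  let e0 : (Fin 2 → ℝ) →L[ℝ] ℝ := ContinuousLinearMap.proj 0
  let e1 : (Fin 2 → ℝ) →L[ℝ] ℝ := ContinuousLinearMap.proj 1
  have hω : ContDiffOn ℝ ∞ (fun x => ω0 x • e0 + ω1 x • e1) V :=
    (h0.smul contDiffOn_const).add (h1.smul contDiffOn_const)
  have hdiff : DifferentiableOn ℝ (fun x => ω0 x • e0 + ω1 x • e1) V :=
    fun x hx => (diffAt_of_smooth hV hω hx).differentiableWithinAt
  obtain ⟨ψ, hψ⟩ := hc.exists_forall_hasFDerivAt_of_fderiv_symmetric hV hdiff (by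
      intro a ha x y
      have d0 := diffAt_of_smooth hV h0 ha
      have d1 := diffAt_of_smooth hV h1 ha
      have hd : fderiv ℝ (fun x => ω0 x • e0 + ω1 x • e1) a
          = (fderiv ℝ ω0 a).smulRight e0 + (fderiv ℝ ω1 a).smulRight e1 :=
        ((d0.hasFDerivAt.smul_const e0).add (d1.hasFDerivAt.smul_const e1)).fderiv
      rw [hd]
      have z0 : ∀ v, e0 v = v 0 := fun v => rfl
      have z1 : ∀ v, e1 v = v 1 := fun v => rfl
      simp only [add_apply, ContinuousLinearMap.smulRight_apply,
        smul_apply, smul_eq_mul, fderiv_eq_sum_pd, Fin.sum_univ_two, z0, z1]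
      linear_combination (x 0 * y 1 - x 1 * y 0) * hclosed a ha)
  refine ⟨ψ, ?_, fun x hx => ?_⟩
  · rw [contDiffOn_infty_iff_fderiv_of_isOpen hV]
    exact ⟨fun x hx => (hψ x hx).differentiableAt.differentiableWithinAt,
      hω.congr fun x hx => (hψ x hx).fderiv⟩
  · simp [pd, (hψ x hx).fderiv, e0, e1]

namespace IsAnsatz

variable {s : ℝ} {U : Set (Fin 2 → ℝ)} {g : MetricField 2} {φ : (Fin 2 → ℝ) → ℝ}
  {x : Fin 2 → ℝ}

lemma neg_mul_det_pos (h : IsAnsatz s U g φ) (hs : s = 1 ∨ s = -1) (hx : x ∈ U) :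
    0 < -s * (g x).det := by
  rcases hs with hs | hs
  · have := h.lorentzian hs x hx
    rw [hs]; linarith
  · have := (h.riemannian hs x hx).det_pos
    rw [hs]; linarith

lemma abs_det (h : IsAnsatz s U g φ) (hs : s = 1 ∨ s = -1) (hx : x ∈ U) :
    |(g x).det| = -s * (g x).det := by
  have := h.neg_mul_det_pos hs hx
  rcases hs with rfl | rfl
  · rw [abs_of_neg (by linarith)]; ring
  · rw [abs_of_pos (by linarith)]; ring

/-- Near every point the dilaton is complemented to a coordinate system by a function `ψ` with
`dψ = *dφ / |dφ|²`, in which the metric is static. -/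
lemma exists_static_coordinate (h : IsAnsatz s U g φ) (hs : s = 1 ∨ s = -1)
    {V : Set (Fin 2 → ℝ)} (hV : IsOpen V) (hc : Convex ℝ V) (hVU : V ⊆ U) :
    ∃ ψ : (Fin 2 → ℝ) → ℝ, ContDiffOn ℝ ∞ ψ V ∧ ∀ x ∈ V,
      pd 0 φ x * pd 1 ψ x - pd 1 φ x * pd 0 ψ x = √|(g x).det| ∧
      ∀ a b, g x a b = pd a φ x * pd b φ x / normSqDiff g φ x
        - s * normSqDiff g φ x * (pd a ψ x * pd b ψ x) := by
  have hU := h.isOpen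
  have hg := h.metric
  have hs0 : s ≠ 0 := by rcases hs with rfl | rfl <;> norm_num
  have hs2 : s ^ 2 = 1 := by rcases hs with rfl | rfl <;> norm_num
  -- the volume density
  set r : (Fin 2 → ℝ) → ℝ := fun x => √|(g x).det| with hr
  have hr2 : ∀ x ∈ U, r x * r x = -s * (g x).det := fun x hx => by
    rw [hr]
    simp only
    rw [Real.mul_self_sqrt (abs_nonneg _), h.abs_det hs hx]
  have hr0 : ∀ x ∈ U, r x ≠ 0 := fun x hx => by
    intro h0
    have := hr2 x hx
    rw [h0] at this
    have := h.neg_mul_det_pos hs hx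
    linarith
  have hrs : ContDiffOn ℝ ∞ r U := by
    have : ContDiffOn ℝ ∞ (fun x => √(-s * (g x).det)) U :=
      (contDiffOn_const.mul hg.contDiffOn_det).sqrt fun x hx => (h.neg_mul_det_pos hs hx).ne'
    refine this.congr fun x hx => ?_
    rw [hr]
    simp only
    rw [h.abs_det hs hx]
  have hN := h.contDiffOn_normSqDiff
  have hφ : ∀ a, ContDiffOn ℝ ∞ (pd a φ) U := fun a => contDiffOn_pd hU h.smooth
  have hrN : ∀ x ∈ U, r x * normSqDiff g φ x ≠ 0 := fun x hx =>
    mul_ne_zero (hr0 x hx) (h.nonnull x hx)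
  have hY1 : ContDiffOn ℝ ∞ (fun x => g x 1 1 * pd 0 φ x - g x 0 1 * pd 1 φ x) U :=
    ((hg.smooth 1 1).mul (hφ 0)).sub ((hg.smooth 0 1).mul (hφ 1))
  have hY0 : ContDiffOn ℝ ∞ (fun x => g x 0 1 * pd 0 φ x - g x 0 0 * pd 1 φ x) U :=
    ((hg.smooth 0 1).mul (hφ 0)).sub ((hg.smooth 0 0).mul (hφ 1))
  -- `*dφ / |dφ|²` is closed, as `d *dφ = (D²φ) dvol` and `d|dφ|² = (D²φ) dφ`
  have hclosed : ∀ x ∈ V,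
      pd 0 (fun x => -s * (g x 1 1 * pd 0 φ x - g x 0 1 * pd 1 φ x)
        * (r x * normSqDiff g φ x)⁻¹) x
      = pd 1 (fun x => -s * (g x 0 1 * pd 0 φ x - g x 0 0 * pd 1 φ x)
        * (r x * normSqDiff g φ x)⁻¹) x := by
    intro x hxV
    have hx := hVU hxV
    have D : ∀ {F : (Fin 2 → ℝ) → ℝ} (c : Fin 2), ContDiffOn ℝ ∞ F U → HasPd c F (pd c F x) x :=
      fun c hF => HasPd.of_diff (diffAt_of_smooth hU hF hx)
    have dg := fun c a b => D c (hg.smooth a b)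
    have dp := fun c a => D c (hφ a)
    have dr : ∀ c, pd c r x = r x * (christoffel g 0 c 0 x + christoffel g 1 c 1 x) := by
      intro c
      have e1 := pd_congr_on (i := c) hU hr2 hx
      have e2 := pd_congr_on (i := c) hU (fun y hy => hg.det_eq hy) hx
      rw [(((dg c 0 0).mul (dg c 1 1)).sub ((dg c 0 1).mul (dg c 0 1))).2] at e2
      rw [((D c hrs).mul (D c hrs)).2, ((D c hg.contDiffOn_det).const_mul (-s)).2, e2] at e1
      obtain ⟨p0, p1, p2⟩ := hg.pd_eq_christoffel hU hx c
      rw [p0, p1, p2] at e1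
      have h2 := hr2 x hx
      rw [hg.det_eq hx] at h2
      apply mul_left_cancel₀ (hr0 x hx)
      linear_combination 1 / 2 * e1
        - (christoffel g 0 c 0 x + christoffel g 1 c 1 x) * h2
    have y1 := (((((dg 0 1 1).mul (dp 0 0)).sub ((dg 0 0 1).mul (dp 0 1))).const_mul (-s)).mul
      (((D 0 hrs).mul (D 0 hN)).inv (hrN x hx))).2
    have y0 := (((((dg 1 0 1).mul (dp 1 0)).sub ((dg 1 0 0).mul (dp 1 1))).const_mul (-s)).mul
      (((D 1 hrs).mul (D 1 hN)).inv (hrN x hx))).2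
    rw [y1, y0, dr, dr, h.pd_normSqDiff hx, h.pd_normSqDiff hx]
    obtain ⟨e0, f0, k0⟩ := hg.pd_eq_christoffel hU hx 0
    obtain ⟨e1, f1, k1⟩ := hg.pd_eq_christoffel hU hx 1
    have hcs : ∀ k, christoffel g k 1 0 x = christoffel g k 0 1 x :=
      fun k => hg.christoffel_symm hU hx k 1 0
    have hNd := h.normSqDiff_mul_det hx
    have hgs : g x 1 0 = g x 0 1 := (hg.symm x hx).apply 0 1
    rw [hg.det_eq hx] at hNd
    simp only [h.hessian hx, f0, k0, e1, f1, hcs, hgs]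
    have h1 := hr0 x hx
    have h2 := h.nonnull x hx
    field_simp
    linear_combination -2 * laplacian g φ x * hNd
  obtain ⟨ψ, hψ, hp⟩ := exists_primitive hV hc
    (((contDiffOn_const.mul hY0).mul ((hrs.mul hN).inv hrN)).mono hVU)
    (((contDiffOn_const.mul hY1).mul ((hrs.mul hN).inv hrN)).mono hVU) hclosed
  refine ⟨ψ, hψ, fun x hxV => ?_⟩
  have hx := hVU hxV
  obtain ⟨p0, p1⟩ := hp x hxV
  simp only [Pi.inv_apply] at p0 p1
  have h1 := hr0 x hx
  have h2 := h.nonnull x hx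
  have hNd := h.normSqDiff_mul_det hx
  have h3 := hr2 x hx
  have hd : (g x).det = -s * (r x * r x) := by rw [h3]; linear_combination -(g x).det * hs2
  have hgs : g x 1 0 = g x 0 1 := (hg.symm x hx).apply 0 1
  have hdet := hg.det_eq hx
  constructor
  · rw [p0, p1]
    change _ = r x
    rw [hd] at hNd
    field_simp
    linear_combination s * hNd + normSqDiff g φ x * r x ^ 2 * hs2
  · have key : ∀ a b : Fin 2, ∀ Ya Yb : ℝ, pd a ψ x = -s * Ya * (r x * normSqDiff g φ x)⁻¹ →
        pd b ψ x = -s * Yb * (r x * normSqDiff g φ x)⁻¹ →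
        g x a b * (normSqDiff g φ x * (g x).det) = (g x).det * (pd a φ x * pd b φ x) + Ya * Yb →
        g x a b = pd a φ x * pd b φ x / normSqDiff g φ x
        - s * normSqDiff g φ x * (pd a ψ x * pd b ψ x) := by
      intro a b Ya Yb ha hb hab
      rw [hd] at hab
      rw [ha, hb]
      field_simp
      linear_combination -s * hab + (Ya * Yb * s - normSqDiff g φ x * r x ^ 2 * g x a b
        + r x ^ 2 * (pd a φ x * pd b φ x)) * hs2
    intro a b
    match a, b with
    | 0, 0 => exact key 0 0 _ _ p0 p0 (by rw [hNd, hdet]; ring)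
    | 0, 1 => exact key 0 1 _ _ p0 p1 (by rw [hNd, hdet]; ring)
    | 1, 0 => exact key 1 0 _ _ p1 p0 (by rw [hNd, hdet, hgs]; ring)
    | 1, 1 => exact key 1 1 _ _ p1 p1 (by rw [hNd, hdet]; ring)

end IsAnsatz

/-! ### Pulling back metrics -/

/-- On `N` the map `Ψ` is smooth, and `g` is the pullback of `h` along it. -/
structure PullsBack {n m : ℕ} (Ψ : (Fin n → ℝ) → Fin m → ℝ) (g : MetricField n)
    (h : MetricField m) (N : Set (Fin n → ℝ)) : Prop where
  smooth : ContDiffOn ℝ ∞ Ψ N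
  pullback : ∀ x ∈ N, g x = (jac Ψ x)ᵀ * h (Ψ x) * jac Ψ x

lemma jac_comp {n m l : ℕ} {Θ : (Fin m → ℝ) → Fin l → ℝ} {Ψ : (Fin n → ℝ) → Fin m → ℝ}
    {x : Fin n → ℝ} (hΘ : DifferentiableAt ℝ Θ (Ψ x)) (hΨ : DifferentiableAt ℝ Ψ x) :
    jac (fun y => Θ (Ψ y)) x = jac Θ (Ψ x) * jac Ψ x := by
  ext a i
  rw [Matrix.mul_apply]
  exact pd_comp_map (F := fun z => Θ z a) (differentiableAt_pi.1 hΘ a) hΨ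

lemma PullsBack.comp {n m l : ℕ} {Θ : (Fin m → ℝ) → Fin l → ℝ} {Ψ : (Fin n → ℝ) → Fin m → ℝ}
    {g : MetricField n} {h : MetricField m} {k : MetricField l} {N : Set (Fin n → ℝ)}
    {N' : Set (Fin m → ℝ)} (hΘ : PullsBack Θ h k N') (hΨ : PullsBack Ψ g h N) (hN : IsOpen N)
    (hN' : IsOpen N') (hm : MapsTo Ψ N N') : PullsBack (fun y => Θ (Ψ y)) g k N := by
  refine ⟨hΘ.smooth.comp hΨ.smooth hm, fun x hx => ?_⟩
  rw [jac_comp (diffAt_of_smooth hN' hΘ.smooth (hm hx)) (diffAt_of_smooth hN hΨ.smooth hx),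
    hΨ.pullback x hx, hΘ.pullback _ (hm hx), Matrix.transpose_mul]
  simp only [Matrix.mul_assoc]

lemma PullsBack.mono {n m : ℕ} {Ψ : (Fin n → ℝ) → Fin m → ℝ} {g : MetricField n}
    {h : MetricField m} {N N' : Set (Fin n → ℝ)} (hΨ : PullsBack Ψ g h N) (hN : N' ⊆ N) :
    PullsBack Ψ g h N' :=
  ⟨hΨ.smooth.mono hN, fun x hx => hΨ.pullback x (hN hx)⟩

lemma fderiv_eq_jac_mulVec {n m : ℕ} {Ψ : (Fin n → ℝ) → Fin m → ℝ} {x : Fin n → ℝ}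
    (hΨ : DifferentiableAt ℝ Ψ x) (v : Fin n → ℝ) : fderiv ℝ Ψ x v = jac Ψ x *ᵥ v := by
  ext a
  have h := (hasFDerivAt_pi'.1 hΨ.hasFDerivAt a).fderiv
  have : fderiv ℝ Ψ x v a = fderiv ℝ (fun y => Ψ y a) x v := by rw [h]; rfl
  rw [this, fderiv_eq_sum_pd]
  rfl

lemma PullsBack.det_jac_ne_zero {n : ℕ} {Ψ : (Fin n → ℝ) → Fin n → ℝ} {g h : MetricField n}
    {N : Set (Fin n → ℝ)} (hΨ : PullsBack Ψ g h N) {x : Fin n → ℝ} (hx : x ∈ N)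
    (hd : (g x).det ≠ 0) : (jac Ψ x).det ≠ 0 := by
  intro h0
  apply hd
  rw [hΨ.pullback x hx, Matrix.det_mul, h0, mul_zero]

/-- A map that pulls back `h` to a nondegenerate metric is a local isometry, by the inverse
function theorem. -/
lemma PullsBack.exists_isLocalIsometry {n : ℕ} {Ψ : (Fin n → ℝ) → Fin n → ℝ} {g h : MetricField n}
    {N : Set (Fin n → ℝ)} (hΨ : PullsBack Ψ g h N) (hN : IsOpen N)
    (hd : ∀ x ∈ N, (g x).det ≠ 0) {p : Fin n → ℝ} (hp : p ∈ N) :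
    ∃ Φ : OpenPartialHomeomorph (Fin n → ℝ) (Fin n → ℝ), p ∈ Φ.source ∧ Φ.source ⊆ N ∧
      (∀ x, Φ x = Ψ x) ∧ IsLocalIsometry Φ g h := by
  have hequiv : ∀ x ∈ N, ∃ e : (Fin n → ℝ) ≃L[ℝ] (Fin n → ℝ),
      HasFDerivAt Ψ (e : (Fin n → ℝ) →L[ℝ] (Fin n → ℝ)) x := by
    intro x hx
    have hdx := diffAt_of_smooth hN hΨ.smooth hx
    have hdet := hΨ.det_jac_ne_zero hx (hd x hx)
    have hinj : Function.Injective (fderiv ℝ Ψ x : (Fin n → ℝ) →ₗ[ℝ] (Fin n → ℝ)) := by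
      rw [← LinearMap.ker_eq_bot, LinearMap.ker_eq_bot']
      intro v hv
      have hv' : jac Ψ x *ᵥ v = 0 := by rw [← fderiv_eq_jac_mulVec hdx]; exact hv
      exact Matrix.eq_zero_of_mulVec_eq_zero hdet hv'
    refine ⟨(LinearEquiv.ofInjectiveEndo _ hinj).toContinuousLinearEquiv, ?_⟩
    have he : (((LinearEquiv.ofInjectiveEndo _ hinj).toContinuousLinearEquiv :
        (Fin n → ℝ) ≃L[ℝ] (Fin n → ℝ)) : (Fin n → ℝ) →L[ℝ] (Fin n → ℝ)) = fderiv ℝ Ψ x :=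
      ContinuousLinearMap.ext fun v => rfl
    rw [he]
    exact hdx.hasFDerivAt
  have hC : ∀ x ∈ N, ContDiffAt ℝ ∞ Ψ x := fun x hx => hΨ.smooth.contDiffAt (hN.mem_nhds hx)
  obtain ⟨e, he⟩ := hequiv p hp
  let Φ0 := (hC p hp).toOpenPartialHomeomorph Ψ he (by simp)
  have hΦ0 : ∀ x, Φ0 x = Ψ x := fun x => rfl
  let Φ := Φ0.restrOpen N hN
  have hΦ : ∀ x, Φ x = Ψ x := fun x => rfl
  have hsrc : Φ.source ⊆ N := fun x hx => by
    have := Φ0.restrOpen_source N hN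
    rw [show Φ.source = Φ0.source ∩ N from this] at hx
    exact hx.2
  have hjac : ∀ x, jac Φ x = jac Ψ x := fun x => rfl
  refine ⟨Φ, ?_, hsrc, hΦ, hΨ.smooth.mono hsrc, ?_, ?_⟩
  · rw [show Φ.source = Φ0.source ∩ N from Φ0.restrOpen_source N hN]
    exact ⟨(hC p hp).mem_toOpenPartialHomeomorph_source he (by simp), hp⟩
  · intro y hy
    have hx := hsrc (Φ.map_target hy)
    obtain ⟨e', he'⟩ := hequiv _ hx
    exact (Φ.contDiffAt_symm hy he' (hC _ hx)).contDiffWithinAt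
  · intro x hx
    rw [hjac, hΦ]
    exact hΨ.pullback x (hsrc hx)

/-- Local isometries to `h` exist if every point has a neighbourhood on which `g` is a pullback
of `h`. -/
lemma locallyIsometric_of_pullsBack {n : ℕ} {g h : MetricField n} {W V : Set (Fin n → ℝ)}
    (hd : ∀ x ∈ W, (g x).det ≠ 0)
    (H : ∀ p ∈ W, ∃ (N : Set (Fin n → ℝ)) (Ψ : (Fin n → ℝ) → Fin n → ℝ), IsOpen N ∧ p ∈ N ∧
      N ⊆ W ∧ MapsTo Ψ N V ∧ PullsBack Ψ g h N) : LocallyIsometric g W h V := by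
  intro p hp
  obtain ⟨N, Ψ, hN, hpN, hNW, hm, hΨ⟩ := H p hp
  obtain ⟨Φ, h1, h2, h3, h4⟩ := hΨ.exists_isLocalIsometry hN (fun x hx => hd x (hNW hx)) hpN
  refine ⟨Φ, h1, h2.trans hNW, fun y hy => ?_, h4⟩
  have h5 := Φ.map_target hy
  rw [← Φ.right_inv hy, h3]
  exact hm (h2 h5)

/-- The canonical form may be read off from metrics of which `g` is a pullback. -/
lemma hasCanonicalForm_of_pullsBack {g : MetricField 3} {W : Set (Fin 3 → ℝ)}
    {J : Matrix (Fin 3) (Fin 3) ℝ} (hd : ∀ x ∈ W, (g x).det ≠ 0)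
    (H : ∀ p ∈ W, ∃ (N : Set (Fin 3 → ℝ)) (Ψ : (Fin 3 → ℝ) → Fin 3 → ℝ) (h : MetricField 3),
      IsOpen N ∧ p ∈ N ∧ N ⊆ W ∧ PullsBack Ψ g h N ∧
        ∃ Q : Matrix (Fin 3) (Fin 3) ℝ, IsUnit Q.det ∧ tracelessRicci h (Ψ p) * Q = Q * J) :
    HasCanonicalForm g W J := by
  intro p hp
  obtain ⟨N, Ψ, h, hN, hpN, hNW, hΨ, hQ⟩ := H p hp
  obtain ⟨Φ, h1, h2, h3, h4⟩ := hΨ.exists_isLocalIsometry hN (fun x hx => hd x (hNW hx)) hpN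
  exact ⟨Φ, h, h1, h4, by rwa [h3]⟩

/-! ### The normal form of the Kaluza-Klein metric -/

/-- The Kaluza-Klein metric in adapted coordinates `(t, x, w)`:
`e^{2 α t} (dt² / n - s n dx²) + s e^{2 t} (dw + F dx)²`. -/
noncomputable def kkModel (s α : ℝ) (n F : ℝ → ℝ) : MetricField 3 := fun y =>
  let t := y 0
  let E := exp (2 * α * t)
  let W := s * exp (2 * t)
  !![E / n t, 0, 0;
     0, -s * E * n t + W * F t ^ 2, W * F t;
     0, W * F t, W]

lemma isOpen_cylinder {U : Set (Fin 2 → ℝ)} (hU : IsOpen U) : IsOpen (cylinder U) := by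
  refine hU.preimage (continuous_pi fun i => ?_)
  fin_cases i
  · exact continuous_apply 0
  · exact continuous_apply 1

lemma kkMetric_det_ne_zero {s α : ℝ} {U : Set (Fin 2 → ℝ)} {gb : MetricField 2}
    {φ : (Fin 2 → ℝ) → ℝ} {A : OneForm 2} (hs : s ≠ 0) (hg : IsMetricOn gb U) :
    ∀ p ∈ cylinder U, (kkMetric s α gb φ A p).det ≠ 0 := by
  intro p hp
  have h1 : (kkMetric s α gb φ A p).det = exp (2 * α * φ (base p)) ^ 2
      * (s * exp (2 * φ (base p))) * (gb (base p)).det := by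
    rw [Matrix.det_fin_three, Matrix.det_fin_two]
    simp [kkMetric]
    ring
  rw [h1]
  have := hg.nondegenerate _ hp
  positivity

lemma contDiff_base : ContDiff ℝ ∞ base := by
  refine contDiff_pi.2 fun i => ?_
  fin_cases i
  · exact contDiff_apply ℝ ℝ 0
  · exact contDiff_apply ℝ ℝ 1

lemma pd_base {f : (Fin 2 → ℝ) → ℝ} {y : Fin 3 → ℝ} (hf : DifferentiableAt ℝ f (base y)) :
    pd 0 (fun y => f (base y)) y = pd 0 f (base y) ∧
      pd 1 (fun y => f (base y)) y = pd 1 f (base y) ∧ pd 2 (fun y => f (base y)) y = 0 := by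
  have h := fun i => pd_comp_map (i := i) hf ((contDiff_base.differentiable (by simp)) y)
  have h0 : ∀ i : Fin 3, pd i (fun y => base y 0) y = if i = 0 then 1 else 0 := fun i =>
    pd_coord i 0 y
  have h1 : ∀ i : Fin 3, pd i (fun y => base y 1) y = if i = 1 then 1 else 0 := fun i =>
    pd_coord i 1 y
  refine ⟨?_, ?_, ?_⟩ <;> rw [h, Fin.sum_univ_two, h0, h1] <;> simp

/-- Near every point the Kaluza-Klein metric takes its normal form in coordinates
`(φ, ψ, z + χ)`, where `A = F(φ) dψ + dχ`. -/
lemma IsAnsatz.exists_pullsBack_kkModel {s α : ℝ} {U : Set (Fin 2 → ℝ)} {gb : MetricField 2}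
    {φ : (Fin 2 → ℝ) → ℝ} {A : OneForm 2} (h : IsAnsatz s U gb φ) (hs : s = 1 ∨ s = -1)
    {n f F : ℝ → ℝ} (hn : ∀ x ∈ U, normSqDiff gb φ x = n (φ x)) (hFs : ContDiff ℝ ∞ F)
    (hF : ∀ t, HasDerivAt F (f t) t) (hA : IsPotential U gb (fun x => f (φ x)) A)
    {p : Fin 3 → ℝ} (hp : p ∈ cylinder U) :
    ∃ (N : Set (Fin 3 → ℝ)) (ψ χ : (Fin 2 → ℝ) → ℝ), IsOpen N ∧ p ∈ N ∧ N ⊆ cylinder U ∧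
      PullsBack (fun y => ![φ (base y), ψ (base y), y 2 + χ (base y)]) (kkMetric s α gb φ A)
        (kkModel s α n F) N := by
  have hU := h.isOpen
  obtain ⟨ρ, hρ, hball⟩ := Metric.isOpen_iff.1 hU (base p) hp
  have hV : IsOpen (Metric.ball (base p) ρ) := Metric.isOpen_ball
  have hc : Convex ℝ (Metric.ball (base p) ρ) := convex_ball _ _
  obtain ⟨ψ, hψ, hψ'⟩ := h.exists_static_coordinate hs hV hc hball
  have hFφ : ContDiffOn ℝ ∞ (fun x => F (φ x)) U := hFs.comp_contDiffOn h.smooth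
  have hω : ∀ a, ContDiffOn ℝ ∞ (fun x => A a x - F (φ x) * pd a ψ x) (Metric.ball (base p) ρ) :=
    fun a => ((hA.smooth a).mono hball).sub ((hFφ.mono hball).mul (contDiffOn_pd hV hψ))
  obtain ⟨χ, hχ, hχ'⟩ := exists_primitive hV hc (hω 0) (hω 1) (by
    intro x hx
    have hxU := hball hx
    have dF : ∀ c, HasPd c (fun x => F (φ x)) (f (φ x) * pd c φ x) x := fun c =>
      (HasPd.of_diff (h.differentiableAt hxU)).comp (hF _)
    have dA : ∀ c a, HasPd c (A a) (pd c (A a) x) x := fun c a =>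
      HasPd.of_diff (diffAt_of_smooth hU (hA.smooth a) hxU)
    have dψ : ∀ c a, HasPd c (pd a ψ) (pd c (pd a ψ) x) x := fun c a =>
      HasPd.of_diff (diffAt_of_smooth hV (contDiffOn_pd hV hψ) hx)
    rw [((dA 0 1).sub ((dF 0).mul (dψ 0 1))).2, ((dA 1 0).sub ((dF 1).mul (dψ 1 0))).2,
      pd_pd_comm (i := 0) (j := 1) hV hψ hx]
    linear_combination hA.curl x hxU - f (φ x) * (hψ' x hx).1)
  refine ⟨cylinder (Metric.ball (base p) ρ), ψ, χ, isOpen_cylinder hV, Metric.mem_ball_self hρ,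
    fun y hy => hball hy, ?_, ?_⟩
  · have hb : MapsTo base (cylinder (Metric.ball (base p) ρ)) (Metric.ball (base p) ρ) :=
      fun y hy => hy
    have hbs := contDiff_base.contDiffOn (s := cylinder (Metric.ball (base p) ρ))
    refine contDiffOn_pi.2 fun i => ?_
    fin_cases i
    · exact (h.smooth.mono hball).comp hbs hb
    · exact hψ.comp hbs hb
    · exact (contDiff_apply ℝ ℝ (2 : Fin 3)).contDiffOn.add (hχ.comp hbs hb)
  · intro y hy
    have hx : base y ∈ Metric.ball (base p) ρ := hy
    have hxU := hball hx
    obtain ⟨f0, f1, f2⟩ := pd_base (h.differentiableAt hxU)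
    obtain ⟨p0, p1, p2⟩ := pd_base (diffAt_of_smooth hV hψ hx)
    have dχ := diffAt_of_smooth hV hχ hx
    obtain ⟨c0, c1, c2⟩ := pd_base dχ
    have hz : ∀ i, pd i (fun y : Fin 3 → ℝ => y 2 + χ (base y)) y
        = (if i = 2 then 1 else 0) + pd i (fun y => χ (base y)) y := fun i => by
      have hdc : DifferentiableAt ℝ (fun y => χ (base y)) y :=
        dχ.comp y ((contDiff_base.differentiable (by simp)) y)
      rw [pd_add (F := fun y : Fin 3 → ℝ => y 2) (G := fun y => χ (base y)) (by fun_prop) hdc,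
        pd_coord]
    have hj : jac (fun y => ![φ (base y), ψ (base y), y 2 + χ (base y)]) y =
        !![pd 0 φ (base y), pd 1 φ (base y), 0; pd 0 ψ (base y), pd 1 ψ (base y), 0;
          pd 0 χ (base y), pd 1 χ (base y), 1] := by
      ext a i
      fin_cases a <;> fin_cases i <;> simp [jac, f0, f1, f2, p0, p1, p2, c0, c1, c2, hz]
    obtain ⟨hχ0, hχ1⟩ := hχ' _ hx
    have hA0 : A 0 (base y) = F (φ (base y)) * pd 0 ψ (base y) + pd 0 χ (base y) := by
      rw [hχ0]; ring
    have hA1 : A 1 (base y) = F (φ (base y)) * pd 1 ψ (base y) + pd 1 χ (base y) := by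
      rw [hχ1]; ring
    have hgb := (hψ' _ hx).2
    rw [hn _ hxU] at hgb
    rw [hj]
    ext i j
    fin_cases i <;> fin_cases j <;>
      simp [kkMetric, kkModel, Matrix.mul_apply, Fin.sum_univ_three, hA0, hA1, hgb] <;> ring

/-! ### The curvature of cohomogeneity-one metrics -/

/-- The metric `d dτ² + a du² + 2 b du dv + c dv²` in coordinates `(τ, u, v)`, with a constant `d`
and functions `a`, `b`, `c` of `τ`. -/
def blockMetric (d : ℝ) (a b c : ℝ → ℝ) : MetricField 3 := fun y =>
  !![d, 0, 0; 0, a (y 0), b (y 0); 0, b (y 0), c (y 0)]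

section Block

variable {d : ℝ} {a b c a' b' c' : ℝ → ℝ}

lemma blockMetric_det (y : Fin 3 → ℝ) :
    (blockMetric d a b c y).det = d * (a (y 0) * c (y 0) - b (y 0) ^ 2) := by
  rw [Matrix.det_fin_three]
  simp [blockMetric]
  ring

lemma blockMetric_inv {y : Fin 3 → ℝ} (hd : d ≠ 0) (hD : a (y 0) * c (y 0) - b (y 0) ^ 2 ≠ 0) :
    (blockMetric d a b c y)⁻¹ = !![1 / d, 0, 0;
      0, c (y 0) / (a (y 0) * c (y 0) - b (y 0) ^ 2), -b (y 0) / (a (y 0) * c (y 0) - b (y 0) ^ 2);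
      0, -b (y 0) / (a (y 0) * c (y 0) - b (y 0) ^ 2),
        a (y 0) / (a (y 0) * c (y 0) - b (y 0) ^ 2)] := by
  apply Matrix.inv_eq_right_inv
  ext i j
  fin_cases i <;> fin_cases j <;>
    simp [blockMetric, Matrix.mul_apply, Fin.sum_univ_three] <;> field_simp <;> ring

/-- The Christoffel symbols of `blockMetric d a b c`, as functions of `τ`; the second index of the
matrices `Γ k` is the form index of the connection. -/
noncomputable def blockGamma (d : ℝ) (a b c a' b' c' : ℝ → ℝ) (k i j : Fin 3) (τ : ℝ) : ℝ :=
  let D := a τ * c τ - b τ ^ 2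
  let K11 := (c τ * a' τ - b τ * b' τ) / (2 * D)
  let K12 := (c τ * b' τ - b τ * c' τ) / (2 * D)
  let K21 := (a τ * b' τ - b τ * a' τ) / (2 * D)
  let K22 := (a τ * c' τ - b τ * b' τ) / (2 * D)
  (![!![0, 0, 0; 0, -a' τ / (2 * d), -b' τ / (2 * d); 0, -b' τ / (2 * d), -c' τ / (2 * d)],
    !![0, K11, K12; K11, 0, 0; K12, 0, 0],
    !![0, K21, K22; K21, 0, 0; K22, 0, 0]] : Fin 3 → Matrix (Fin 3) (Fin 3) ℝ) k i j

lemma pd_blockMetric (ha : ∀ t, HasDerivAt a (a' t) t) (hb : ∀ t, HasDerivAt b (b' t) t)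
    (hc : ∀ t, HasDerivAt c (c' t) t) (k i j : Fin 3) (y : Fin 3 → ℝ) :
    pd k (fun y => blockMetric d a b c y i j) y =
      if k = 0 then !![0, 0, 0; 0, a' (y 0), b' (y 0); 0, b' (y 0), c' (y 0)] i j else 0 := by
  have h1 := pd_comp_coord (x := y) k 0 (ha _)
  have h2 := pd_comp_coord (x := y) k 0 (hb _)
  have h3 := pd_comp_coord (x := y) k 0 (hc _)
  fin_cases i <;> fin_cases j <;> simp [blockMetric, h1, h2, h3]

lemma christoffel_blockMetric (ha : ∀ t, HasDerivAt a (a' t) t) (hb : ∀ t, HasDerivAt b (b' t) t)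
    (hc : ∀ t, HasDerivAt c (c' t) t) (hd : d ≠ 0) (k i j : Fin 3) {y : Fin 3 → ℝ}
    (hD : a (y 0) * c (y 0) - b (y 0) ^ 2 ≠ 0) :
    christoffel (blockMetric d a b c) k i j y = blockGamma d a b c a' b' c' k i j (y 0) := by
  simp only [christoffel, blockMetric_inv hd hD, pd_blockMetric ha hb hc, Fin.sum_univ_three]
  fin_cases k <;> fin_cases i <;> fin_cases j <;> simp [blockGamma] <;> field_simp <;> ring

/-- The `τ`-derivative of `blockGamma`. -/
noncomputable def blockGamma' (d : ℝ) (a b c a' b' c' a'' b'' c'' : ℝ → ℝ) (k i j : Fin 3)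
    (τ : ℝ) : ℝ :=
  let D := a τ * c τ - b τ ^ 2
  let D' := a' τ * c τ + a τ * c' τ - 2 * b τ * b' τ
  let K11 := (c τ * a'' τ - b τ * b'' τ + c' τ * a' τ - b' τ * b' τ) / (2 * D)
    - D' * (c τ * a' τ - b τ * b' τ) / (2 * D ^ 2)
  let K12 := (c τ * b'' τ - b τ * c'' τ + c' τ * b' τ - b' τ * c' τ) / (2 * D)
    - D' * (c τ * b' τ - b τ * c' τ) / (2 * D ^ 2)
  let K21 := (a τ * b'' τ - b τ * a'' τ + a' τ * b' τ - b' τ * a' τ) / (2 * D)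
    - D' * (a τ * b' τ - b τ * a' τ) / (2 * D ^ 2)
  let K22 := (a τ * c'' τ - b τ * b'' τ + a' τ * c' τ - b' τ * b' τ) / (2 * D)
    - D' * (a τ * c' τ - b τ * b' τ) / (2 * D ^ 2)
  (![!![0, 0, 0; 0, -a'' τ / (2 * d), -b'' τ / (2 * d); 0, -b'' τ / (2 * d), -c'' τ / (2 * d)],
    !![0, K11, K12; K11, 0, 0; K12, 0, 0],
    !![0, K21, K22; K21, 0, 0; K22, 0, 0]] : Fin 3 → Matrix (Fin 3) (Fin 3) ℝ) k i j

variable {a'' b'' c'' : ℝ → ℝ}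

lemma hasDerivAt_quotient {f g h k D f' g' h' k' D' : ℝ → ℝ} {τ : ℝ} 
    (hf : HasDerivAt f (f' τ) τ) (hg : HasDerivAt g (g' τ) τ) (hh : HasDerivAt h (h' τ) τ)
    (hk : HasDerivAt k (k' τ) τ) (hD : HasDerivAt D (D' τ) τ) (hD0 : D τ ≠ 0) :
    HasDerivAt (fun t => (f t * g t - h t * k t) / (2 * D t))
      ((f τ * g' τ - h τ * k' τ + f' τ * g τ - h' τ * k τ) / (2 * D τ)
        - D' τ * (f τ * g τ - h τ * k τ) / (2 * D τ ^ 2)) τ := by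
  refine (((hf.mul hg).sub (hh.mul hk)).div (hD.const_mul 2) (by simpa using hD0)).congr_deriv ?_
  simp
  field_simp
  ring

lemma hasDerivAt_blockGamma (ha : ∀ t, HasDerivAt a (a' t) t) (hb : ∀ t, HasDerivAt b (b' t) t)
    (hc : ∀ t, HasDerivAt c (c' t) t) (ha' : ∀ t, HasDerivAt a' (a'' t) t)
    (hb' : ∀ t, HasDerivAt b' (b'' t) t) (hc' : ∀ t, HasDerivAt c' (c'' t) t) (k i j : Fin 3)
    {τ : ℝ} (hD : a τ * c τ - b τ ^ 2 ≠ 0) :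
    HasDerivAt (blockGamma d a b c a' b' c' k i j)
      (blockGamma' d a b c a' b' c' a'' b'' c'' k i j τ) τ := by
  have hD' : HasDerivAt (fun t => a t * c t - b t ^ 2)
      (a' τ * c τ + a τ * c' τ - 2 * b τ * b' τ) τ :=
    (((ha τ).mul (hc τ)).sub ((hb τ).pow 2)).congr_deriv (by simp)
  have h11 := hasDerivAt_quotient (D' := fun _ => _) (hc τ) (ha' τ) (hb τ) (hb' τ) hD' hD
  have h12 := hasDerivAt_quotient (D' := fun _ => _) (hc τ) (hb' τ) (hb τ) (hc' τ) hD' hD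
  have h21 := hasDerivAt_quotient (D' := fun _ => _) (ha τ) (hb' τ) (hb τ) (ha' τ) hD' hD
  have h22 := hasDerivAt_quotient (D' := fun _ => _) (ha τ) (hc' τ) (hb τ) (hb' τ) hD' hD
  have ea := (ha' τ).neg.div_const (2 * d)
  have eb := (hb' τ).neg.div_const (2 * d)
  have ec := (hc' τ).neg.div_const (2 * d)
  have e0 := hasDerivAt_const τ (0 : ℝ)
  fin_cases k <;> fin_cases i <;> fin_cases j <;>
    first
    | exact e0
    | exact ea
    | exact eb
    | exact ec
    | exact h11
    | exact h12
    | exact h21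
    | exact h22

/-- The Ricci tensor of a cohomogeneity-one metric, in terms of `D = ac - b²`. -/
lemma ricci_blockMetric (ha : ∀ t, HasDerivAt a (a' t) t) (hb : ∀ t, HasDerivAt b (b' t) t)
    (hc : ∀ t, HasDerivAt c (c' t) t) (ha' : ∀ t, HasDerivAt a' (a'' t) t)
    (hb' : ∀ t, HasDerivAt b' (b'' t) t) (hc' : ∀ t, HasDerivAt c' (c'' t) t) (hd : d ≠ 0)
    {y : Fin 3 → ℝ} (hD : a (y 0) * c (y 0) - b (y 0) ^ 2 ≠ 0) :
    ricci (blockMetric d a b c) y = Matrix.of fun i j =>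
      (∑ k, ((if k = 0 then blockGamma' d a b c a' b' c' a'' b'' c'' k i j (y 0) else 0)
        - (if j = 0 then blockGamma' d a b c a' b' c' a'' b'' c'' k i k (y 0) else 0))) +
      ∑ k, ∑ l, (blockGamma d a b c a' b' c' k k l (y 0) * blockGamma d a b c a' b' c' l i j (y 0) -
        blockGamma d a b c a' b' c' k j l (y 0) * blockGamma d a b c a' b' c' l i k (y 0)) := by
  have hpd : ∀ m k i j, pd m (christoffel (blockMetric d a b c) k i j) y
      = if m = 0 then blockGamma' d a b c a' b' c' a'' b'' c'' k i j (y 0) else 0 := by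
    intro m k i j
    rw [← pd_comp_coord m 0 (hasDerivAt_blockGamma ha hb hc ha' hb' hc' k i j hD)]
    have hcont : ContinuousAt (fun z : Fin 3 → ℝ => a (z 0) * c (z 0) - b (z 0) ^ 2) y := by
      have h0 : ContinuousAt (fun z : Fin 3 → ℝ => z 0) y := (continuous_apply 0).continuousAt
      have h1 : ContinuousAt (fun z : Fin 3 → ℝ => a (z 0)) y :=
        ContinuousAt.comp (f := fun z : Fin 3 → ℝ => z 0) (ha _).continuousAt h0
      have h2 : ContinuousAt (fun z : Fin 3 → ℝ => b (z 0)) y :=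
        ContinuousAt.comp (f := fun z : Fin 3 → ℝ => z 0) (hb _).continuousAt h0
      have h3 : ContinuousAt (fun z : Fin 3 → ℝ => c (z 0)) y :=
        ContinuousAt.comp (f := fun z : Fin 3 → ℝ => z 0) (hc _).continuousAt h0
      exact (h1.mul h3).sub (h2.pow 2)
    refine pd_congr ?_
    filter_upwards [hcont.eventually_ne hD] with z hz
    exact christoffel_blockMetric ha hb hc hd k i j hz
  ext i j
  simp only [ricci, Matrix.of_apply, hpd, christoffel_blockMetric ha hb hc hd _ _ _ hD]

end Block

/-- If `Ric = g X` then `X` is the Ricci tensor with one index raised. -/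
lemma tracelessRicci_eq {g : MetricField 3} {x : Fin 3 → ℝ} {X : Matrix (Fin 3) (Fin 3) ℝ}
    (hg : (g x).det ≠ 0) (hs : (ricci g x).IsSymm) (hX : ricci g x = g x * X) :
    tracelessRicci g x = X - (X.trace / 3) • (1 : Matrix (Fin 3) (Fin 3) ℝ) := by
  have h1 : (g x)⁻¹ * ricci g x = X := by
    rw [hX, ← Matrix.mul_assoc, Matrix.nonsing_inv_mul _ (isUnit_iff_ne_zero.2 hg), one_mul]
  have h2 : scalarCurv g x = X.trace := by
    rw [← h1, scalarCurv, tr, Matrix.trace]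
    refine Finset.sum_congr rfl fun i _ => ?_
    rw [Matrix.diag_apply, Matrix.mul_apply]
    exact Finset.sum_congr rfl fun j _ => by rw [hs.apply]
  rw [tracelessRicci, h1, h2]
  norm_num

/-- The metrics `ℓ² (m dτ² + p du² + 2 Y du dv + q dv²)` with `Y'² = 4 m (Y² - p q)` have constant
curvature. -/
lemma tracelessRicci_block_AdS {ℓ m p q : ℝ} {Y Y' : ℝ → ℝ} (hℓ : ℓ ≠ 0) (hm : m ≠ 0)
    (hY : ∀ t, HasDerivAt Y (Y' t) t) (hY' : ∀ t, HasDerivAt Y' (4 * m * Y t) t)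
    (hYY : ∀ t, Y' t ^ 2 = 4 * m * (Y t ^ 2 - p * q)) {y : Fin 3 → ℝ}
    (hy : Y (y 0) ^ 2 - p * q ≠ 0) :
    tracelessRicci (blockMetric (ℓ ^ 2 * m) (fun _ => ℓ ^ 2 * p) (fun t => ℓ ^ 2 * Y t)
      (fun _ => ℓ ^ 2 * q)) y = 0 := by
  have hD : ℓ ^ 2 * p * (ℓ ^ 2 * q) - (ℓ ^ 2 * Y (y 0)) ^ 2 ≠ 0 := by
    intro h0
    have h1 : ℓ ^ 4 * (Y (y 0) ^ 2 - p * q) = 0 := by linear_combination -h0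
    have : ℓ ^ 4 ≠ 0 := by positivity
    exact (mul_ne_zero this hy) h1
  have hD2 : p * q - Y (y 0) ^ 2 ≠ 0 := fun h0 => hy (by linear_combination -h0)
  have hR : ricci (blockMetric (ℓ ^ 2 * m) (fun _ => ℓ ^ 2 * p) (fun t => ℓ ^ 2 * Y t)
      (fun _ => ℓ ^ 2 * q)) y = blockMetric (ℓ ^ 2 * m) (fun _ => ℓ ^ 2 * p) (fun t => ℓ ^ 2 * Y t)
      (fun _ => ℓ ^ 2 * q) y * ((-2 / ℓ ^ 2) • (1 : Matrix (Fin 3) (Fin 3) ℝ)) := by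
    rw [ricci_blockMetric (a' := fun _ => 0) (b' := fun t => ℓ ^ 2 * Y' t) (c' := fun _ => 0)
      (a'' := fun _ => 0) (b'' := fun t => ℓ ^ 2 * (4 * m * Y t)) (c'' := fun _ => 0)
      (fun _ => hasDerivAt_const _ _) (fun t => (hY t).const_mul _) (fun _ => hasDerivAt_const _ _)
      (fun _ => hasDerivAt_const _ _) (fun t => (hY' t).const_mul _)
      (fun _ => hasDerivAt_const _ _) (by positivity) hD]
    obtain ⟨D, hDdef⟩ : ∃ D, D = p * q - Y (y 0) ^ 2 := ⟨_, rfl⟩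
    have hE : ℓ ^ 2 * p * (ℓ ^ 2 * q) - (ℓ ^ 2 * Y (y 0)) ^ 2 = ℓ ^ 4 * D := by rw [hDdef]; ring
    rw [← hDdef] at hD2
    have hm' : m = -Y' (y 0) ^ 2 / (4 * D) := by
      field_simp
      linear_combination hYY (y 0) + 4 * m * hDdef
    have hY1 : Y' (y 0) ≠ 0 := fun h0 => hm (by rw [hm', h0]; ring)
    have hpq : p * q = D + Y (y 0) ^ 2 := by linear_combination -hDdef
    ext i j
    simp only [Matrix.of_apply, Fin.sum_univ_three]
    fin_cases i <;> fin_cases j <;>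
      simp [blockGamma, blockGamma', blockMetric] <;> rw [hE, hm'] <;> field_simp <;>
      first | ring1 | linear_combination (-8) * hpq
  have hsymm : (ricci (blockMetric (ℓ ^ 2 * m) (fun _ => ℓ ^ 2 * p) (fun t => ℓ ^ 2 * Y t)
      (fun _ => ℓ ^ 2 * q)) y).IsSymm := by
    rw [hR]
    ext i j
    fin_cases i <;> fin_cases j <;> simp [blockMetric]
  rw [tracelessRicci_eq (by rw [blockMetric_det]; positivity) hsymm hR]
  simp

/-- The traceless Ricci tensor of warped AdS₃, in the coordinate `τ = log y`. -/
lemma tracelessRicci_block_warped {ℓ ν ε κ w : ℝ} (hε : ε = 1 ∨ ε = -1) (hℓ : ℓ ≠ 0) (hν : ν ≠ 0)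
    (hκ : κ = ℓ ^ 2 / (ν ^ 2 + 3)) (hw : w = 4 * ν ^ 2 / (ν ^ 2 + 3)) (y : Fin 3 → ℝ) :
    tracelessRicci (blockMetric κ (fun t => κ * ε * (w - 1) * exp (2 * t))
        (fun t => κ * ε * w * exp t) (fun _ => κ * ε * w)) y =
      !![(ν ^ 2 - 1) / ℓ ^ 2, 0, 0; 0, (ν ^ 2 - 1) / ℓ ^ 2, 0;
        0, -3 * ((ν ^ 2 - 1) / ℓ ^ 2) * exp (y 0), -2 * ((ν ^ 2 - 1) / ℓ ^ 2)] := by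
  have hκ0 : κ ≠ 0 := by rw [hκ]; positivity
  have hw0 : w ≠ 0 := by rw [hw]; positivity
  have hν3 : ν ^ 2 + 3 ≠ 0 := by positivity
  have hE : exp (2 * y 0) = exp (y 0) ^ 2 := by rw [← exp_nat_mul]; norm_num
  have hE0 : exp (y 0) ≠ 0 := (exp_pos _).ne'
  have hDE : κ * ε * (w - 1) * exp (2 * y 0) * (κ * ε * w) - (κ * ε * w * exp (y 0)) ^ 2
      = -(κ ^ 2 * w * exp (y 0) ^ 2) := by
    rw [hE]
    rcases hε with rfl | rfl <;> ring
  have hD : κ * ε * (w - 1) * exp (2 * y 0) * (κ * ε * w) - (κ * ε * w * exp (y 0)) ^ 2 ≠ 0 := by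
    rw [hDE]
    exact neg_ne_zero.2 (by positivity)
  have h1 : ∀ t, HasDerivAt (fun t => κ * ε * (w - 1) * exp (2 * t))
      (2 * (κ * ε * (w - 1)) * exp (2 * t)) t := fun t =>
    ((hasDerivAt_exp_mul 2 t).const_mul _).congr_deriv (by ring)
  have h1' : ∀ t, HasDerivAt (fun t => 2 * (κ * ε * (w - 1)) * exp (2 * t))
      (4 * (κ * ε * (w - 1)) * exp (2 * t)) t := fun t =>
    ((hasDerivAt_exp_mul 2 t).const_mul _).congr_deriv (by ring)
  have h2 : ∀ t, HasDerivAt (fun t => κ * ε * w * exp t) (κ * ε * w * exp t) t := fun t =>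
    (Real.hasDerivAt_exp t).const_mul _
  have hR : ricci (blockMetric κ (fun t => κ * ε * (w - 1) * exp (2 * t))
        (fun t => κ * ε * w * exp t) (fun _ => κ * ε * w)) y =
      blockMetric κ (fun t => κ * ε * (w - 1) * exp (2 * t))
        (fun t => κ * ε * w * exp t) (fun _ => κ * ε * w) y *
      !![(ν ^ 2 - 3) / ℓ ^ 2, 0, 0; 0, (ν ^ 2 - 3) / ℓ ^ 2, 0;
        0, -3 * ((ν ^ 2 - 1) / ℓ ^ 2) * exp (y 0), -2 * ν ^ 2 / ℓ ^ 2] := by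
    rw [ricci_blockMetric h1 h2 (fun _ => hasDerivAt_const _ _) h1' h2
      (fun _ => hasDerivAt_const _ _) hκ0 hD]
    ext i j
    simp only [Matrix.of_apply, Matrix.mul_apply, Fin.sum_univ_three]
    fin_cases i <;> fin_cases j <;>
      simp [blockGamma, blockGamma', blockMetric] <;> try simp only [hDE]
    all_goals
      try simp only [hE]
      clear hDE hD
      subst hκ hw
      rcases hε with rfl | rfl <;> field_simp <;> ring
  have hsymm : (ricci (blockMetric κ (fun t => κ * ε * (w - 1) * exp (2 * t))
        (fun t => κ * ε * w * exp t) (fun _ => κ * ε * w)) y).IsSymm := by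
    rw [hR]
    ext i j
    subst hκ hw
    fin_cases i <;> fin_cases j <;>
      simp [blockMetric, hE, Matrix.mul_apply, Fin.sum_univ_three] <;> field_simp <;> ring
  rw [tracelessRicci_eq (by rw [blockMetric_det]; exact mul_ne_zero hκ0 hD) hsymm hR]
  ext i j
  fin_cases i <;> fin_cases j <;> simp [Matrix.trace, Fin.sum_univ_three] <;> ring

/-- The traceless Ricci tensor of the AdS pp-wave, in the coordinate `τ = log ρ`, is nilpotent. -/
lemma tracelessRicci_block_ppWave {ℓ s r : ℝ} (hℓ : ℓ ≠ 0) (y : Fin 3 → ℝ) :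
    tracelessRicci (blockMetric (ℓ ^ 2 / 4) (fun t => s * exp (r * t))
        (fun t => 1 / 2 * exp t) (fun _ => 0)) y =
      !![0, 0, 0; 0, 0, 0; 0, -(4 * s * r * (r - 1) / ℓ ^ 2) * exp (r * y 0) * exp (-y 0), 0] := by
  have hE0 : exp (y 0) ≠ 0 := (exp_pos _).ne'
  have hDE : s * exp (r * y 0) * 0 - (1 / 2 * exp (y 0)) ^ 2 = -(exp (y 0) ^ 2 / 4) := by ring
  have hD : s * exp (r * y 0) * 0 - (1 / 2 * exp (y 0)) ^ 2 ≠ 0 := by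
    rw [hDE]
    exact neg_ne_zero.2 (by positivity)
  have h1 : ∀ t, HasDerivAt (fun t => s * exp (r * t)) (s * r * exp (r * t)) t := fun t =>
    ((hasDerivAt_exp_mul r t).const_mul _).congr_deriv (by ring)
  have h1' : ∀ t, HasDerivAt (fun t => s * r * exp (r * t)) (s * r ^ 2 * exp (r * t)) t := fun t =>
    ((hasDerivAt_exp_mul r t).const_mul _).congr_deriv (by ring)
  have h2 : ∀ t, HasDerivAt (fun t => 1 / 2 * exp t) (1 / 2 * exp t) t := fun t =>
    (Real.hasDerivAt_exp t).const_mul _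
  have hR : ricci (blockMetric (ℓ ^ 2 / 4) (fun t => s * exp (r * t))
        (fun t => 1 / 2 * exp t) (fun _ => 0)) y =
      blockMetric (ℓ ^ 2 / 4) (fun t => s * exp (r * t)) (fun t => 1 / 2 * exp t) (fun _ => 0) y *
      !![-2 / ℓ ^ 2, 0, 0; 0, -2 / ℓ ^ 2, 0;
        0, -(4 * s * r * (r - 1) / ℓ ^ 2) * exp (r * y 0) * exp (-y 0), -2 / ℓ ^ 2] := by
    rw [ricci_blockMetric h1 h2 (fun _ => hasDerivAt_const _ _) h1' h2
      (fun _ => hasDerivAt_const _ _) (by positivity) hD]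
    ext i j
    simp only [Matrix.of_apply, Matrix.mul_apply, Fin.sum_univ_three, exp_neg]
    fin_cases i <;> fin_cases j <;> simp [blockGamma, blockGamma', blockMetric]
    all_goals field_simp
    all_goals ring
  have hsymm : (ricci (blockMetric (ℓ ^ 2 / 4) (fun t => s * exp (r * t))
        (fun t => 1 / 2 * exp t) (fun _ => 0)) y).IsSymm := by
    rw [hR]
    ext i j
    fin_cases i <;> fin_cases j <;>
      simp [blockMetric, Matrix.mul_apply, Fin.sum_univ_three]
  rw [tracelessRicci_eq (by rw [blockMetric_det]; exact mul_ne_zero (by positivity) hD) hsymm hR]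
  ext i j
  fin_cases i <;> fin_cases j <;> simp [Matrix.trace, Fin.sum_univ_three] <;> ring

/-! ### One-parameter subgroups and coordinates on `SL(2, ℝ)` -/

/-- The generalized hyperbolic functions: `C² - m S² = 1`, `C' = m S` and `S' = C`. The
exponential of a traceless matrix `n` with `n² = m` is `C(t) + S(t) n`. -/
lemma exists_generalized_cosh_sinh (m : ℝ) : ∃ C S : ℝ → ℝ, ContDiff ℝ ∞ C ∧ ContDiff ℝ ∞ S ∧
    (∀ t, HasDerivAt C (m * S t) t) ∧ (∀ t, HasDerivAt S (C t) t) ∧ C 0 = 1 ∧ S 0 = 0 ∧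
    ∀ t, C t ^ 2 - m * S t ^ 2 = 1 := by
  rcases lt_trichotomy m 0 with hm | rfl | hm
  · obtain ⟨k, hk, rfl⟩ : ∃ k, 0 < k ∧ m = -k ^ 2 :=
      ⟨√(-m), Real.sqrt_pos.2 (by linarith), by rw [Real.sq_sqrt (by linarith)]; ring⟩
    refine ⟨fun t => cos (k * t), fun t => sin (k * t) / k, by fun_prop, by fun_prop,
      fun t => ?_, fun t => ?_, by simp, by simp, fun t => ?_⟩
    · exact (((hasDerivAt_id t).const_mul k).cos).congr_deriv (by simp; field_simp)
    · exact ((((hasDerivAt_id t).const_mul k).sin).div_const k).congr_deriv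
        (by simp; field_simp)
    · have := Real.sin_sq_add_cos_sq (k * t)
      field_simp
      linear_combination this
  · exact ⟨fun _ => 1, fun t => t, contDiff_const, contDiff_id,
      fun t => (hasDerivAt_const t 1).congr_deriv (by simp), fun t => hasDerivAt_id t, rfl, rfl,
      fun t => by simp⟩
  · obtain ⟨k, hk, rfl⟩ : ∃ k, 0 < k ∧ m = k ^ 2 :=
      ⟨√m, Real.sqrt_pos.2 hm, (Real.sq_sqrt hm.le).symm⟩
    refine ⟨fun t => cosh (k * t), fun t => sinh (k * t) / k, by fun_prop, by fun_prop,
      fun t => ?_, fun t => ?_, by simp, by simp, fun t => ?_⟩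
    · exact (((hasDerivAt_id t).const_mul k).cosh).congr_deriv (by simp; field_simp)
    · exact ((((hasDerivAt_id t).const_mul k).sinh).div_const k).congr_deriv
        (by simp; field_simp)
    · have := Real.cosh_sq_sub_sinh_sq (k * t)
      field_simp
      linear_combination this

/-- A real quadratic polynomial takes a nonnegative value if its discriminant or its leading
coefficient is positive. -/
lemma exists_quadratic_nonneg {p q y : ℝ} (h : 0 < y ^ 2 - p * q ∨ 0 < q) :
    ∃ β, 0 ≤ p - 2 * y * β + q * β ^ 2 := by
  by_cases hq : 0 < q
  · refine ⟨y / q + (|p - y ^ 2 / q| + 1) / q + (|p - y ^ 2 / q| + 1), ?_⟩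
    have h1 : p - 2 * y * (y / q + (|p - y ^ 2 / q| + 1) / q + (|p - y ^ 2 / q| + 1))
        + q * (y / q + (|p - y ^ 2 / q| + 1) / q + (|p - y ^ 2 / q| + 1)) ^ 2
        = (p - y ^ 2 / q) + (|p - y ^ 2 / q| + 1) ^ 2 * (1 / q + 2 + q) := by
      field_simp
      ring
    rw [h1]
    have h2 := neg_abs_le (p - y ^ 2 / q)
    have h3 := abs_nonneg (p - y ^ 2 / q)
    have h4 : 0 < 1 / q + q := by positivity
    nlinarith [mul_nonneg (sq_nonneg (|p - y ^ 2 / q| + 1)) h4.le]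
  · have hm : 0 < y ^ 2 - p * q := h.resolve_right hq
    rcases lt_or_eq_of_le (not_lt.1 hq) with hq' | rfl
    · refine ⟨y / q, ?_⟩
      have : p - 2 * y * (y / q) + q * (y / q) ^ 2 = (y ^ 2 - p * q) / -q := by
        have := hq'.ne
        field_simp
        ring
      rw [this]
      exact div_nonneg hm.le (by linarith)
    · have hy : y ≠ 0 := by rintro rfl; simp at hm
      exact ⟨p / (2 * y), by rw [zero_mul, add_zero]; field_simp; simp⟩

/-- The bilinear form on `2 × 2` matrices whose quadratic form is `-det`. -/
noncomputable def negDetForm (V W : Matrix (Fin 2) (Fin 2) ℝ) : ℝ :=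
  -(V 0 0 * W 1 1 + V 1 1 * W 0 0 - V 0 1 * W 1 0 - V 1 0 * W 0 1) / 2

lemma negDetForm_mul (G V W H : Matrix (Fin 2) (Fin 2) ℝ) :
    negDetForm (G * V * H) (G * W * H) = G.det * H.det * negDetForm V W := by
  simp only [negDetForm, Matrix.det_fin_two, Matrix.mul_apply, Fin.sum_univ_two]
  ring

/-- The matrix of `i`-th partial derivatives. -/
noncomputable def pdMatrix {n : ℕ} (i : Fin n) (M : (Fin n → ℝ) → Matrix (Fin 2) (Fin 2) ℝ)
    (x : Fin n → ℝ) : Matrix (Fin 2) (Fin 2) ℝ :=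
  Matrix.of fun a b => pd i (fun y => M y a b) x

/-- A map `M` to `SL(2, ℝ)` in coordinates `(τ, u, v)`. It pulls back the metric `-det dM` of AdS₃
to `m dτ² + p du² + 2 Y du dv + q dv²`, where `∂_v` generates the right multiplication by the
exponential of `b = [[0, 1], [q, 0]]`, and the invariant one-form `tr (b M⁻¹ dM) / 2` to
`Y du + q dv`. -/
structure IsSL2Chart (m p q : ℝ) (Y : ℝ → ℝ)
    (M : (Fin 3 → ℝ) → Matrix (Fin 2) (Fin 2) ℝ) : Prop where
  smooth : ∀ a b, ContDiff ℝ ∞ fun x => M x a b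
  det : ∀ x, (M x).det = 1
  one : M 0 = 1
  metric : ∀ x i j, negDetForm (pdMatrix i M x) (pdMatrix j M x) =
    blockMetric m (fun _ => p) Y (fun _ => q) x i j
  form : ∀ x i, (!![0, 1; q, 0] * (M x).adjugate * pdMatrix i M x).trace / 2 = ![0, Y (x 0), q] i

/-- The exponential of `t N`, for generalized hyperbolic functions `C` and `S`. -/
def expMatrix (C S : ℝ → ℝ) (N : Matrix (Fin 2) (Fin 2) ℝ) (t : ℝ) : Matrix (Fin 2) (Fin 2) ℝ :=
  C t • 1 + S t • N

section expMatrix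

variable {C S : ℝ → ℝ} {N : Matrix (Fin 2) (Fin 2) ℝ} {m : ℝ}

lemma hasDerivAt_expMatrix (hC : ∀ t, HasDerivAt C (m * S t) t) (hS : ∀ t, HasDerivAt S (C t) t)
    (hN : N * N = m • 1) (t : ℝ) (a b : Fin 2) :
    HasDerivAt (fun t => expMatrix C S N t a b) ((N * expMatrix C S N t) a b) t := by
  have h1 : N * expMatrix C S N t = (m * S t) • 1 + C t • N := by
    rw [expMatrix, mul_add, Matrix.mul_smul, Matrix.mul_smul, mul_one, hN, smul_smul, add_comm,
      mul_comm]
  rw [h1]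
  simp only [expMatrix, Matrix.add_apply, Matrix.smul_apply, smul_eq_mul]
  exact ((hC t).mul_const _).add ((hS t).mul_const _)

lemma expMatrix_comm (t : ℝ) : N * expMatrix C S N t = expMatrix C S N t * N := by
  simp [expMatrix, mul_add, add_mul]

lemma det_expMatrix (hCS : ∀ t, C t ^ 2 - m * S t ^ 2 = 1) (htr : N 1 1 = -N 0 0)
    (hN : N.det = -m) (t : ℝ) : (expMatrix C S N t).det = 1 := by
  rw [Matrix.det_fin_two] at hN
  simp [expMatrix, Matrix.det_fin_two]
  rw [htr] at hN ⊢
  linear_combination hCS t + S t ^ 2 * hN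

lemma mul_self_of_trace_zero (htr : N 1 1 = -N 0 0) (hN : N.det = -m) : N * N = m • 1 := by
  rw [Matrix.det_fin_two] at hN
  rw [htr] at hN
  ext i j
  fin_cases i <;> fin_cases j <;> simp [Matrix.mul_apply, htr] <;>
    first | ring1 | linear_combination -hN

end expMatrix

/-- The product rule for `A(u) T(τ) B(v)`. -/
lemma pdMatrix_mul {A T B A' T' B' : ℝ → Matrix (Fin 2) (Fin 2) ℝ}
    (hA : ∀ t a b, HasDerivAt (fun t => A t a b) (A' t a b) t)
    (hT : ∀ t a b, HasDerivAt (fun t => T t a b) (T' t a b) t)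
    (hB : ∀ t a b, HasDerivAt (fun t => B t a b) (B' t a b) t) (x : Fin 3 → ℝ) (i : Fin 3) :
    pdMatrix i (fun x => A (x 1) * T (x 0) * B (x 2)) x =
      ![A (x 1) * T' (x 0) * B (x 2), A' (x 1) * T (x 0) * B (x 2),
        A (x 1) * T (x 0) * B' (x 2)] i := by
  have hc : ∀ (j : Fin 3) {f f' : ℝ → ℝ}, HasDerivAt f (f' (x j)) (x j) →
      HasPd i (fun y => f (y j)) (if i = j then f' (x j) else 0) x := fun j f f' hf =>
    ⟨hf.differentiableAt.comp x (by fun_prop), pd_comp_coord i j hf⟩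
  ext a b
  have h1 := fun a b => hc 1 (f' := fun t => A' t a b) (hA (x 1) a b)
  have h2 := fun a b => hc 0 (f' := fun t => T' t a b) (hT (x 0) a b)
  have h3 := fun a b => hc 2 (f' := fun t => B' t a b) (hB (x 2) a b)
  have h4 : ∀ a b, HasPd i (fun y => (A (y 1) * T (y 0) * B (y 2)) a b) _ x := fun a b => by
    simp only [Matrix.mul_apply, Fin.sum_univ_two]
    exact ((((h1 a 0).mul (h2 0 0)).add ((h1 a 1).mul (h2 1 0))).mul (h3 0 b)).add
      ((((h1 a 0).mul (h2 0 1)).add ((h1 a 1).mul (h2 1 1))).mul (h3 1 b))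
  rw [pdMatrix, Matrix.of_apply, (h4 a b).2]
  fin_cases i <;> simp [Matrix.mul_apply, Fin.sum_univ_two]

/-- Coordinates on `SL(2, ℝ)` about the identity. The chart is `e^{u a} e^{τ n} e^{v b}` with
traceless matrices `a` and `b` of determinants `-p` and `-q`, `tr (a b) = 2 y₀`, and `n` the
traceless part of `a b`. The hypothesis ensures that there is such an `a` with real entries. -/
lemma exists_isSL2Chart {p q y₀ : ℝ} (h : 0 < y₀ ^ 2 - p * q ∨ 0 < q) :
    ∃ (Y Y' : ℝ → ℝ) (M : (Fin 3 → ℝ) → Matrix (Fin 2) (Fin 2) ℝ), ContDiff ℝ ∞ Y ∧ Y 0 = y₀ ∧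
      Y' 0 = -2 * (y₀ ^ 2 - p * q) ∧ (∀ t, HasDerivAt Y (Y' t) t) ∧
      (∀ t, HasDerivAt Y' (4 * (y₀ ^ 2 - p * q) * Y t) t) ∧
      (∀ t, Y' t ^ 2 = 4 * (y₀ ^ 2 - p * q) * (Y t ^ 2 - p * q)) ∧
      IsSL2Chart (y₀ ^ 2 - p * q) p q Y M := by
  obtain ⟨β, hβ⟩ := exists_quadratic_nonneg h
  obtain ⟨η, hη⟩ : ∃ η, η ^ 2 = p - 2 * y₀ * β + q * β ^ 2 := ⟨_, Real.sq_sqrt hβ⟩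
  have hp : p = η ^ 2 + 2 * y₀ * β - q * β ^ 2 := by linear_combination -hη
  obtain ⟨m, hm⟩ : ∃ m, m = y₀ ^ 2 - p * q := ⟨_, rfl⟩
  rw [← hm]
  obtain ⟨C, S, hC, hS, hC', hS', hC0, hS0, hCS⟩ := exists_generalized_cosh_sinh m
  obtain ⟨Cp, Sp, hCp, hSp, hCp', hSp', hCp0, hSp0, hCSp⟩ := exists_generalized_cosh_sinh p
  obtain ⟨Cq, Sq, hCq, hSq, hCq', hSq', hCq0, hSq0, hCSq⟩ := exists_generalized_cosh_sinh q
  let a : Matrix (Fin 2) (Fin 2) ℝ := !![η, β; 2 * y₀ - q * β, -η]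
  let b : Matrix (Fin 2) (Fin 2) ℝ := !![0, 1; q, 0]
  let n : Matrix (Fin 2) (Fin 2) ℝ := !![β * q - y₀, η; -η * q, y₀ - β * q]
  have ha : a.det = -p := by
    simp only [a, Matrix.det_fin_two_of]; linear_combination -hη
  have hb : b.det = -q := by simp [b, Matrix.det_fin_two_of]
  have hn : n.det = -m := by
    simp only [n, Matrix.det_fin_two_of]; linear_combination hm + q * hη
  have hA := hasDerivAt_expMatrix hCp' hSp' (mul_self_of_trace_zero (by simp [a]) ha)
  have hT := hasDerivAt_expMatrix hC' hS' (mul_self_of_trace_zero (by simp [n]) hn)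
  have hB := hasDerivAt_expMatrix hCq' hSq' (mul_self_of_trace_zero (by simp [b]) hb)
  have dA := det_expMatrix hCSp (N := a) (by simp [a]) ha
  have dT := det_expMatrix hCS (N := n) (by simp [n]) hn
  have dB := det_expMatrix hCSq (N := b) (by simp [b]) hb
  have hpd := pdMatrix_mul hA hT hB
  -- all derivatives are translates of derivatives at `e^{τ n}`
  have hpd' : ∀ x i, pdMatrix i (fun x => expMatrix Cp Sp a (x 1) * expMatrix C S n (x 0) *
      expMatrix Cq Sq b (x 2)) x = expMatrix Cp Sp a (x 1) *
        (![n * expMatrix C S n (x 0), a * expMatrix C S n (x 0), expMatrix C S n (x 0) * b] i) *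
        expMatrix Cq Sq b (x 2) := by
    intro x i
    rw [hpd x i]
    fin_cases i
    · rfl
    · simp [expMatrix_comm, Matrix.mul_assoc]
    · simp [Matrix.mul_assoc]
  refine ⟨fun t => y₀ * (C t ^ 2 + m * S t ^ 2) - 2 * m * (C t * S t),
    fun t => 4 * m * y₀ * (C t * S t) - 2 * m * (C t ^ 2 + m * S t ^ 2),
    fun x => expMatrix Cp Sp a (x 1) * expMatrix C S n (x 0) * expMatrix Cq Sq b (x 2),
    by fun_prop, by simp [hC0, hS0], by simp [hC0, hS0], fun t => ?_, fun t => ?_, fun t => ?_,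
    ⟨fun i j => ?_, fun x => ?_, ?_, fun x i j => ?_, fun x i => ?_⟩⟩
  · exact (((((hC' t).pow 2).add (((hS' t).pow 2).const_mul m)).const_mul y₀).sub
      (((hC' t).mul (hS' t)).const_mul (2 * m))).congr_deriv (by simp; ring)
  · exact ((((hC' t).mul (hS' t)).const_mul (4 * m * y₀)).sub
      ((((hC' t).pow 2).add (((hS' t).pow 2).const_mul m)).const_mul (2 * m))).congr_deriv
        (by simp; ring)
  · linear_combination 4 * m * (m - y₀ ^ 2) * (C t ^ 2 - m * S t ^ 2 + 1) * hCS t + 4 * m * hm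
  · simp only [Matrix.mul_apply, Fin.sum_univ_two, expMatrix, Matrix.add_apply, Matrix.smul_apply]
    fun_prop
  · rw [Matrix.det_mul, Matrix.det_mul, dA, dT, dB]
    norm_num
  · simp [expMatrix, hC0, hS0, hCp0, hSp0, hCq0, hSq0]
  · rw [hpd', hpd', negDetForm_mul, dA, dB]
    have hmul : ∀ V W, negDetForm (V * expMatrix C S n (x 0)) (W * expMatrix C S n (x 0))
        = negDetForm V W := fun V W => by
      have := negDetForm_mul 1 V W (expMatrix C S n (x 0))
      rwa [one_mul, one_mul, Matrix.det_one, dT, one_mul, one_mul] at this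
    have hmul' : ∀ V W, negDetForm (expMatrix C S n (x 0) * V) (expMatrix C S n (x 0) * W)
        = negDetForm V W := fun V W => by
      have := negDetForm_mul (expMatrix C S n (x 0)) V W 1
      rwa [mul_one, mul_one, Matrix.det_one, dT, one_mul, one_mul] at this
    have h01 : negDetForm n a = 0 := by simp [negDetForm, n, a]; ring
    have h02 : negDetForm n b = 0 := by simp [negDetForm, n, b]
    have h12 : negDetForm (a * expMatrix C S n (x 0)) (expMatrix C S n (x 0) * b) =
        y₀ * (C (x 0) ^ 2 + m * S (x 0) ^ 2) - 2 * m * (C (x 0) * S (x 0)) := by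
      rw [hm, hp]
      simp [negDetForm, expMatrix, n, a, b, Matrix.mul_apply, Fin.sum_univ_two]
      ring
    have hself : ∀ V : Matrix (Fin 2) (Fin 2) ℝ, negDetForm V V = -V.det := fun V => by
      rw [negDetForm, Matrix.det_fin_two]; ring
    have hsymm : ∀ V W, negDetForm V W = negDetForm W V := fun V W => by
      simp only [negDetForm]; ring
    simp only [one_mul]
    match i, j with
    | 0, 0 => exact (hmul n n).trans (by rw [hself, hn, neg_neg]; rfl)
    | 0, 1 => exact (hmul n a).trans h01
    | 0, 2 =>
      change negDetForm (n * expMatrix C S n (x 0)) _ = 0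
      rw [expMatrix_comm]
      exact (hmul' n b).trans h02
    | 1, 0 => exact (hmul a n).trans ((hsymm _ _).trans h01)
    | 1, 1 => exact (hmul a a).trans (by rw [hself, ha, neg_neg]; rfl)
    | 1, 2 => exact h12
    | 2, 0 =>
      change negDetForm _ (n * expMatrix C S n (x 0)) = 0
      rw [expMatrix_comm]
      exact (hmul' b n).trans ((hsymm _ _).trans h02)
    | 2, 1 => exact (hsymm _ _).trans h12
    | 2, 2 => exact (hmul' b b).trans (by rw [hself, hb, neg_neg]; rfl)
  · have hadj : ∀ V : Matrix (Fin 2) (Fin 2) ℝ, V.det = 1 → V.adjugate * V = 1 ∧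
        V * V.adjugate = 1 := fun V hV => by
      rw [Matrix.adjugate_mul, Matrix.mul_adjugate, hV, one_smul]; exact ⟨rfl, rfl⟩
    have hred : ∀ X, (b * (expMatrix Cp Sp a (x 1) * expMatrix C S n (x 0) *
        expMatrix Cq Sq b (x 2)).adjugate * (expMatrix Cp Sp a (x 1) * X *
        expMatrix Cq Sq b (x 2))).trace = (b * (expMatrix C S n (x 0)).adjugate * X).trace := by
      intro X
      rw [Matrix.adjugate_mul_distrib, Matrix.adjugate_mul_distrib]
      calc _ = (b * (expMatrix Cq Sq b (x 2)).adjugate * (expMatrix C S n (x 0)).adjugate *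
          ((expMatrix Cp Sp a (x 1)).adjugate * expMatrix Cp Sp a (x 1)) * X *
          expMatrix Cq Sq b (x 2)).trace := by simp only [Matrix.mul_assoc]
        _ = (expMatrix Cq Sq b (x 2) * (b * (expMatrix Cq Sq b (x 2)).adjugate *
          (expMatrix C S n (x 0)).adjugate * X)).trace := by
            rw [(hadj _ (dA _)).1, mul_one, Matrix.trace_mul_comm]
        _ = (b * (expMatrix Cq Sq b (x 2) * (expMatrix Cq Sq b (x 2)).adjugate) *
          (expMatrix C S n (x 0)).adjugate * X).trace := by
            simp only [← Matrix.mul_assoc, expMatrix_comm]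
        _ = _ := by rw [(hadj _ (dB _)).2, mul_one]
    rw [hpd' x i]
    refine (congrArg (· / 2) (hred _)).trans ?_
    match i with
    | 0 =>
      change (b * (expMatrix C S n (x 0)).adjugate * (n * expMatrix C S n (x 0))).trace / 2 = 0
      rw [expMatrix_comm, Matrix.mul_assoc, ← Matrix.mul_assoc _ _ n, (hadj _ (dT _)).1]
      simp [b, n, Matrix.trace, Fin.sum_univ_two]
      ring
    | 1 =>
      change (b * (expMatrix C S n (x 0)).adjugate * (a * expMatrix C S n (x 0))).trace / 2 =
        y₀ * (C (x 0) ^ 2 + m * S (x 0) ^ 2) - 2 * m * (C (x 0) * S (x 0))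
      rw [hm, hp, Matrix.adjugate_fin_two]
      simp only [Matrix.trace_fin_two, Matrix.mul_apply, Fin.sum_univ_two]
      simp [expMatrix, b, n, a]
      ring
    | 2 =>
      change (b * (expMatrix C S n (x 0)).adjugate * (expMatrix C S n (x 0) * b)).trace / 2 = q
      rw [Matrix.mul_assoc, ← Matrix.mul_assoc _ _ b, (hadj _ (dT _)).1]
      simp [b, Matrix.trace, Fin.sum_univ_two]

/-- A smooth function can be lifted along `Y` near a point at which `Y` is a local
diffeomorphism. -/
lemma exists_smooth_lift {Y Y' f f' : ℝ → ℝ} (hY : ContDiff ℝ ∞ Y)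
    (hY' : ∀ t, HasDerivAt Y (Y' t) t) (hc : Continuous Y') (h0 : Y' 0 ≠ 0) (hf : ContDiff ℝ ∞ f)
    (hf' : ∀ t, HasDerivAt f (f' t) t) {t₀ : ℝ} (h : f t₀ = Y 0) :
    ∃ (J : Set ℝ) (θ : ℝ → ℝ), IsOpen J ∧ t₀ ∈ J ∧ ContDiffOn ℝ ∞ θ J ∧ θ t₀ = 0 ∧
      ∀ t ∈ J, Y (θ t) = f t ∧ Y' (θ t) ≠ 0 ∧ HasDerivAt θ (f' t / Y' (θ t)) t := by
  have hd : ∀ t (ht : Y' t ≠ 0),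
      HasFDerivAt Y (ContinuousLinearEquiv.unitsEquivAut ℝ (Units.mk0 _ ht) : ℝ →L[ℝ] ℝ) t := by
    intro t ht
    refine (hY' t).hasFDerivAt.congr_fderiv ?_
    ext
    simp
  let Φ0 := (hY.contDiffAt (x := 0)).toOpenPartialHomeomorph Y (hd 0 h0) (by simp)
  have hopen : IsOpen {t | Y' t ≠ 0} := isOpen_ne_fun hc continuous_const
  let Φ := Φ0.restrOpen {t | Y' t ≠ 0} hopen
  have hΦ : ∀ t, Φ t = Y t := fun t => rfl
  have hsrc : Φ.source = Φ0.source ∩ {t | Y' t ≠ 0} := Φ0.restrOpen_source _ hopen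
  have h0s : (0 : ℝ) ∈ Φ.source := by
    rw [hsrc]
    exact ⟨(hY.contDiffAt (x := 0)).mem_toOpenPartialHomeomorph_source (hd 0 h0) (by simp), h0⟩
  have hne : ∀ y ∈ Φ.target, Y' (Φ.symm y) ≠ 0 := fun y hy => by
    have := Φ.map_target hy
    rw [hsrc] at this
    exact this.2
  have hsymm : ContDiffOn ℝ ∞ Φ.symm Φ.target := fun y hy =>
    (Φ.contDiffAt_symm hy (hd _ (hne y hy)) hY.contDiffAt).contDiffWithinAt
  have hJ : IsOpen (f ⁻¹' Φ.target) := Φ.open_target.preimage hf.continuous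
  have hθ : ContDiffOn ℝ ∞ (fun t => Φ.symm (f t)) (f ⁻¹' Φ.target) :=
    hsymm.comp hf.contDiffOn fun t ht => ht
  have hYθ : ∀ t ∈ f ⁻¹' Φ.target, Y (Φ.symm (f t)) = f t := fun t ht => by
    rw [← hΦ, Φ.right_inv ht]
  refine ⟨f ⁻¹' Φ.target, fun t => Φ.symm (f t), hJ, ?_, hθ, ?_, fun t ht =>
    ⟨hYθ t ht, hne _ ht, ?_⟩⟩
  · change f t₀ ∈ Φ.target
    rw [h, ← hΦ]
    exact Φ.map_source h0s
  · change Φ.symm (f t₀) = 0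
    rw [h, ← hΦ, Φ.left_inv h0s]
  · have hθt : DifferentiableAt ℝ (fun t => Φ.symm (f t)) t :=
      (hθ.contDiffAt (hJ.mem_nhds ht)).differentiableAt (by simp)
    have h1 := (hY' (Φ.symm (f t))).comp t hθt.hasDerivAt
    have h2 : (Y ∘ fun t => Φ.symm (f t)) =ᶠ[𝓝 t] f :=
      Filter.eventuallyEq_of_mem (hJ.mem_nhds ht) hYθ
    have h3 := (h1.congr_of_eventuallyEq h2.symm).unique (hf' t)
    refine hθt.hasDerivAt.congr_deriv ?_
    rw [← h3, mul_div_cancel_left₀ _ (hne _ ht)]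

/-- Changes of coordinates `(t, x, w) ↦ (θ(t), u, v)`, with `u` and `v` affine in `x` and `w`. -/
lemma kkModel_pullsBack_blockMetric {s α d u₁ u₂ u₀ v₁ v₂ v₀ : ℝ} {n F a b c θ θ' : ℝ → ℝ}
    {J : Set ℝ} (hθ : ContDiffOn ℝ ∞ θ J) (hθ' : ∀ t ∈ J, HasDerivAt θ (θ' t) t)
    (h0 : ∀ t ∈ J, exp (2 * α * t) / n t = d * θ' t ^ 2)
    (h1 : ∀ t ∈ J, -s * exp (2 * α * t) * n t + s * exp (2 * t) * F t ^ 2 =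
      a (θ t) * u₁ ^ 2 + 2 * b (θ t) * u₁ * v₁ + c (θ t) * v₁ ^ 2)
    (h2 : ∀ t ∈ J, s * exp (2 * t) * F t =
      a (θ t) * u₁ * u₂ + b (θ t) * (u₁ * v₂ + u₂ * v₁) + c (θ t) * v₁ * v₂)
    (h3 : ∀ t ∈ J, s * exp (2 * t) =
      a (θ t) * u₂ ^ 2 + 2 * b (θ t) * u₂ * v₂ + c (θ t) * v₂ ^ 2) :
    PullsBack (fun y => ![θ (y 0), u₁ * y 1 + u₂ * y 2 + u₀, v₁ * y 1 + v₂ * y 2 + v₀])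
      (kkModel s α n F) (blockMetric d a b c) {y | y 0 ∈ J} := by
  refine ⟨contDiffOn_pi.2 fun i => ?_, fun y hy => ?_⟩
  · match i with
    | 0 => exact hθ.comp (contDiff_apply ℝ ℝ (0 : Fin 3)).contDiffOn fun y hy => hy
    | 1 =>
      change ContDiffOn ℝ ∞ (fun y : Fin 3 → ℝ => u₁ * y 1 + u₂ * y 2 + u₀) _
      fun_prop
    | 2 =>
      change ContDiffOn ℝ ∞ (fun y : Fin 3 → ℝ => v₁ * y 1 + v₂ * y 2 + v₀) _
      fun_prop
  · have hl : ∀ (k₁ k₂ k₀ : ℝ) (i : Fin 3), pd i (fun y : Fin 3 → ℝ => k₁ * y 1 + k₂ * y 2 + k₀) y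
        = k₁ * (if i = 1 then 1 else 0) + k₂ * (if i = 2 then 1 else 0) + 0 := fun k₁ k₂ k₀ i => by
      have hc : ∀ j : Fin 3, HasPd i (fun y : Fin 3 → ℝ => y j) (if i = j then 1 else 0) y :=
        fun j => ⟨by fun_prop, pd_coord i j y⟩
      exact ((((hc 1).const_mul k₁).add ((hc 2).const_mul k₂)).add (HasPd.const k₀)).2
    have hj : jac (fun y => ![θ (y 0), u₁ * y 1 + u₂ * y 2 + u₀, v₁ * y 1 + v₂ * y 2 + v₀]) y =
        !![θ' (y 0), 0, 0; 0, u₁, u₂; 0, v₁, v₂] := by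
      have ht := fun i => pd_comp_coord i 0 (hθ' _ hy)
      ext k i
      fin_cases k <;> fin_cases i <;> simp [jac, ht, hl]
    have e0 := h0 _ hy
    have e1 := h1 _ hy
    have e2 := h2 _ hy
    have e3 := h3 _ hy
    rw [hj]
    ext i j
    match i, j with
    | 0, 0 =>
      simp [kkModel, blockMetric, Matrix.mul_apply, Fin.sum_univ_three]
      linear_combination e0
    | 0, 1 => simp [kkModel, blockMetric, Matrix.mul_apply, Fin.sum_univ_three]
    | 0, 2 => simp [kkModel, blockMetric, Matrix.mul_apply, Fin.sum_univ_three]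
    | 1, 0 => simp [kkModel, blockMetric, Matrix.mul_apply, Fin.sum_univ_three]
    | 2, 0 => simp [kkModel, blockMetric, Matrix.mul_apply, Fin.sum_univ_three]
    | 1, 1 =>
      simp [kkModel, blockMetric, Matrix.mul_apply, Fin.sum_univ_three]
      linear_combination e1
    | 1, 2 =>
      simp [kkModel, blockMetric, Matrix.mul_apply, Fin.sum_univ_three]
      linear_combination e2
    | 2, 1 =>
      simp [kkModel, blockMetric, Matrix.mul_apply, Fin.sum_univ_three]
      linear_combination e2
    | 2, 2 =>
      simp [kkModel, blockMetric, Matrix.mul_apply, Fin.sum_univ_three]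
      linear_combination e3

/-- The group `SL(2, ℝ)`, rescaled by `ℓ`, as the quadric in `ℝ^{2,2}`. -/
noncomputable def quadricEmbedding (ℓ : ℝ) (M : (Fin 3 → ℝ) → Matrix (Fin 2) (Fin 2) ℝ)
    (x : Fin 3 → ℝ) : Fin 4 → ℝ :=
  ![ℓ / 2 * M x 0 0 + ℓ / 2 * M x 1 1, ℓ / 2 * M x 0 1 + (-(ℓ / 2)) * M x 1 0,
    ℓ / 2 * M x 0 0 + (-(ℓ / 2)) * M x 1 1, ℓ / 2 * M x 0 1 + ℓ / 2 * M x 1 0]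

lemma IsSL2Chart.pd_eq {m p q : ℝ} {Y : ℝ → ℝ} {M : (Fin 3 → ℝ) → Matrix (Fin 2) (Fin 2) ℝ}
    (h : IsSL2Chart m p q Y M) (i : Fin 3) (a b : Fin 2) (x : Fin 3 → ℝ) :
    HasPd i (fun y => M y a b) (pdMatrix i M x a b) x :=
  ⟨(h.smooth a b).differentiable (by simp) x, rfl⟩

lemma IsSL2Chart.pullsBack_quadric {ℓ m p q : ℝ} {Y : ℝ → ℝ}
    {M : (Fin 3 → ℝ) → Matrix (Fin 2) (Fin 2) ℝ} (h : IsSL2Chart m p q Y M) :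
    PullsBack (quadricEmbedding ℓ M) (blockMetric (ℓ ^ 2 * m) (fun _ => ℓ ^ 2 * p)
      (fun t => ℓ ^ 2 * Y t) (fun _ => ℓ ^ 2 * q)) (fun _ => flat22) univ := by
  refine ⟨contDiffOn_univ.2 (contDiff_pi.2 fun i => ?_), fun x _ => ?_⟩
  · have h00 := h.smooth 0 0
    have h01 := h.smooth 0 1
    have h10 := h.smooth 1 0
    have h11 := h.smooth 1 1
    fin_cases i <;> simp only [quadricEmbedding] <;> simp <;> fun_prop
  · have hj : ∀ k i, jac (quadricEmbedding ℓ M) x k i =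
        ![ℓ / 2 * pdMatrix i M x 0 0 + ℓ / 2 * pdMatrix i M x 1 1,
          ℓ / 2 * pdMatrix i M x 0 1 + (-(ℓ / 2)) * pdMatrix i M x 1 0,
          ℓ / 2 * pdMatrix i M x 0 0 + (-(ℓ / 2)) * pdMatrix i M x 1 1,
          ℓ / 2 * pdMatrix i M x 0 1 + ℓ / 2 * pdMatrix i M x 1 0] k := by
      intro k i
      match k with
      | 0 => exact (((h.pd_eq i 0 0 x).const_mul _).add ((h.pd_eq i 1 1 x).const_mul _)).2
      | 1 => exact (((h.pd_eq i 0 1 x).const_mul _).add ((h.pd_eq i 1 0 x).const_mul _)).2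
      | 2 => exact (((h.pd_eq i 0 0 x).const_mul _).add ((h.pd_eq i 1 1 x).const_mul _)).2
      | 3 => exact (((h.pd_eq i 0 1 x).const_mul _).add ((h.pd_eq i 1 0 x).const_mul _)).2
    have hg : ∀ i j, blockMetric (ℓ ^ 2 * m) (fun _ => ℓ ^ 2 * p) (fun t => ℓ ^ 2 * Y t)
        (fun _ => ℓ ^ 2 * q) x i j = ℓ ^ 2 * blockMetric m (fun _ => p) Y (fun _ => q) x i j := by
      intro i j
      fin_cases i <;> fin_cases j <;> simp [blockMetric]
    ext i j
    rw [hg, ← h.metric]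
    simp only [Matrix.mul_apply, Matrix.transpose_apply, hj, flat22, Matrix.diagonal_apply,
      Fin.sum_univ_four, negDetForm]
    simp
    ring

lemma IsSL2Chart.quadricEmbedding_mem {ℓ m p q : ℝ} {Y : ℝ → ℝ}
    {M : (Fin 3 → ℝ) → Matrix (Fin 2) (Fin 2) ℝ} (h : IsSL2Chart m p q Y M) (x : Fin 3 → ℝ) :
    quadricEmbedding ℓ M x ⬝ᵥ (flat22 *ᵥ quadricEmbedding ℓ M x) = -ℓ ^ 2 := by
  have hd := h.det x
  rw [Matrix.det_fin_two] at hd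
  simp [quadricEmbedding, flat22, Matrix.mulVec_diagonal, dotProduct, Fin.sum_univ_four]
  linear_combination (-ℓ ^ 2) * hd

/-! ### The first case: AdS₃ -/

/-- The normal form with the first profile is AdS₃ in the coordinates `u, v = w ± x / ℓ`. -/
lemma kkModel_profile1_pullsBack {s ℓ μ c k t₀ : ℝ} (hs : s = 1 ∨ s = -1) (hℓ : 0 < ℓ)
    (hN : profile1 s ℓ μ c k t₀ ≠ 0) (hsN : s = 1 ∨ 0 < profile1 s ℓ μ c k t₀) :
    ∃ (m p q : ℝ) (Y Y' : ℝ → ℝ) (M : (Fin 3 → ℝ) → Matrix (Fin 2) (Fin 2) ℝ) (J : Set ℝ)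
      (Θ : (Fin 3 → ℝ) → Fin 3 → ℝ), IsOpen J ∧ t₀ ∈ J ∧ m ≠ 0 ∧
      (∀ t, HasDerivAt Y (Y' t) t) ∧ (∀ t, HasDerivAt Y' (4 * m * Y t) t) ∧
      (∀ t, Y' t ^ 2 = 4 * m * (Y t ^ 2 - p * q)) ∧ IsSL2Chart m p q Y M ∧
      (∀ y, y 0 = t₀ → Y (Θ y 0) ^ 2 - p * q ≠ 0) ∧
      PullsBack Θ (kkModel s (1 / 2) (profile1 s ℓ μ c k) fun t => -(k / 2) * exp (-2 * t))
        (blockMetric (ℓ ^ 2 * m) (fun _ => ℓ ^ 2 * p) (fun t => ℓ ^ 2 * Y t) (fun _ => ℓ ^ 2 * q))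
        {y | y 0 ∈ J} := by
  obtain ⟨C, hC⟩ : ∃ C, C = c - s * 2 * μ * k := ⟨_, rfl⟩
  -- the coefficients of `dx²`, `dx dw` and `dw²` determine `p`, `q` and `f = Y ∘ θ`
  obtain ⟨p, hp⟩ : ∃ p, p = s * C / 8 - s * k / (4 * ℓ) := ⟨_, rfl⟩
  obtain ⟨q, hq⟩ : ∃ q, q = s * C / 8 + s * k / (4 * ℓ) := ⟨_, rfl⟩
  obtain ⟨f, hf⟩ : ∃ f : ℝ → ℝ, f = fun t => s / (2 * ℓ ^ 2) * exp (2 * t) - s * C / 8 := ⟨_, rfl⟩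
  have hs2 : s ^ 2 = 1 := by rcases hs with rfl | rfl <;> norm_num
  have e1 : ∀ t, exp (-t) = (exp t)⁻¹ := fun t => exp_neg t
  have e2 : ∀ t, exp (2 * t) = exp t ^ 2 := fun t => by rw [← exp_nat_mul]; norm_num
  have e3 : ∀ t, exp (-3 * t) = (exp t ^ 3)⁻¹ := fun t => by
    rw [← exp_nat_mul, ← exp_neg]; norm_num
  have e4 : ∀ t, exp (-2 * t) = (exp t ^ 2)⁻¹ := fun t => by
    rw [← exp_nat_mul, ← exp_neg]; norm_num
  have hdet : ∀ t, f t ^ 2 - p * q = exp t ^ 3 / (4 * ℓ ^ 2) * profile1 s ℓ μ c k t := fun t => by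
    have hE := exp_pos t
    rw [hf, hp, hq, profile1, ← hC]
    simp only [e1, e2, e3]
    rw [show ∀ a b : ℝ, a = b ↔ a = s ^ 2 * b from fun a b => by rw [hs2, one_mul]]
    field_simp
    ring
  -- where the profile is negative, `s = 1`, and `q` is positive
  have hpos : 0 < f t₀ ^ 2 - p * q ∨ 0 < q := by
    have hE := exp_pos t₀
    by_cases h0 : 0 < profile1 s ℓ μ c k t₀
    · left
      rw [hdet]
      positivity
    · right
      have h1 : profile1 s ℓ μ c k t₀ < 0 := lt_of_le_of_ne (not_lt.1 h0) hN
      have h2 : q = ((exp t₀ / ℓ + k / (2 * exp t₀)) ^ 2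
          - exp t₀ * profile1 s ℓ μ c k t₀) / 4 := by
        rw [hq, profile1, ← hC, hsN.resolve_right h0]
        simp only [e1, e3]
        field_simp
        ring
      rw [h2]
      have h3 := mul_neg_of_pos_of_neg hE h1
      have h4 := sq_nonneg (exp t₀ / ℓ + k / (2 * exp t₀))
      linarith
  obtain ⟨Y, Y', M, hYs, hY0, hY'0, hY, hY', hYY, hM⟩ := exists_isSL2Chart hpos
  obtain ⟨m, hmd⟩ : ∃ m, m = f t₀ ^ 2 - p * q := ⟨_, rfl⟩
  rw [← hmd] at hY'0 hY' hYY hM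
  have hm : m ≠ 0 := by
    rw [hmd, hdet]
    have := exp_pos t₀
    positivity
  have hfd : ∀ t, HasDerivAt f (s / ℓ ^ 2 * exp (2 * t)) t := fun t => by
    rw [hf]
    exact (((hasDerivAt_exp_mul 2 t).const_mul _).sub_const _).congr_deriv (by field_simp)
  obtain ⟨J, θ, hJ, htJ, hθ, hθ0, hθJ⟩ := exists_smooth_lift (t₀ := t₀) hYs hY
    (continuous_iff_continuousAt.2 fun t => (hY' t).continuousAt)
    (by rw [hY'0]; exact mul_ne_zero (by norm_num) hm) (by rw [hf]; fun_prop) hfd hY0.symm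
  refine ⟨m, p, q, Y, Y', M, J, _, hJ, htJ, hm, hY, hY', hYY, hM, ?_,
    kkModel_pullsBack_blockMetric (u₁ := 1 / ℓ) (u₂ := 1) (u₀ := 0) (v₁ := -(1 / ℓ)) (v₂ := 1)
      (v₀ := 0) hθ (fun t ht => (hθJ t ht).2.2) ?_ ?_ ?_ ?_⟩
  · intro y hy
    simp only [Matrix.cons_val_zero, hy, hθ0, hY0, ← hmd]
    exact hm
  · intro t ht
    obtain ⟨h1, h2, -⟩ := hθJ t ht
    have hE := exp_pos t
    have h3 := hYY (θ t)
    rw [h1, hdet] at h3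
    have hn : profile1 s ℓ μ c k t ≠ 0 := fun h0 => h2 (by
      rw [h0] at h3
      exact pow_eq_zero_iff two_ne_zero |>.1 (by rw [h3]; ring))
    rw [div_pow, h3, e2, show 2 * (1 / 2) * t = t by ring]
    field_simp
    linear_combination -hs2
  · intro t ht
    have hE := exp_pos t
    rw [(hθJ t ht).1, hf, hp, hq, profile1, ← hC, show 2 * (1 / 2) * t = t by ring]
    simp only [e1, e2, e3, e4]
    field_simp
    ring
  · intro t ht
    have hE := exp_pos t
    rw [hp, hq]
    simp only [e2, e4]
    field_simp
    ring
  · intro t ht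
    rw [(hθJ t ht).1, hf, hp, hq]
    field_simp
    ring

lemma IsAnsatz.normSqDiff_pos {s : ℝ} {U : Set (Fin 2 → ℝ)} {gb : MetricField 2}
    {φ : (Fin 2 → ℝ) → ℝ} (h : IsAnsatz s U gb φ) (hs : s = 1 ∨ s = -1) {x : Fin 2 → ℝ}
    (hx : x ∈ U) : s = 1 ∨ 0 < normSqDiff gb φ x := by
  refine hs.imp_right fun hs => ?_
  have hP := h.riemannian hs x hx
  have hd := hP.det_pos
  have h00 : 0 < gb x 0 0 := hP.diag_pos
  have h1 := h.normSqDiff_mul_det hx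
  have h2 := h.metric.det_eq hx
  have h3 : gb x 0 0 * (gb x).det * normSqDiff gb φ x =
      (gb x 0 0 * pd 1 φ x - gb x 0 1 * pd 0 φ x) ^ 2 + (gb x).det * pd 0 φ x ^ 2 := by
    linear_combination gb x 0 0 * h1 - pd 0 φ x ^ 2 * h2
  have h4 : 0 ≤ gb x 0 0 * (gb x).det * normSqDiff gb φ x := by rw [h3]; positivity
  exact lt_of_le_of_ne (nonneg_of_mul_nonneg_right h4 (by positivity)) (h.nonnull x hx).symm

/-- The Kaluza-Klein metric is transformed by a coordinate change of its normal form. -/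
lemma IsAnsatz.exists_pullsBack_of_kkModel {s α : ℝ} {U : Set (Fin 2 → ℝ)} {gb : MetricField 2}
    {φ : (Fin 2 → ℝ) → ℝ} {A : OneForm 2} (h : IsAnsatz s U gb φ) (hs : s = 1 ∨ s = -1)
    {n f F : ℝ → ℝ} (hn : ∀ x ∈ U, normSqDiff gb φ x = n (φ x)) (hFs : ContDiff ℝ ∞ F)
    (hF : ∀ t, HasDerivAt F (f t) t) (hA : IsPotential U gb (fun x => f (φ x)) A)
    {p : Fin 3 → ℝ} (hp : p ∈ cylinder U) :
    ∃ (N : Set (Fin 3 → ℝ)) (Ψ : (Fin 3 → ℝ) → Fin 3 → ℝ), IsOpen N ∧ p ∈ N ∧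
      N ⊆ cylinder U ∧ (∀ y, Ψ y 0 = φ (base y)) ∧
      PullsBack Ψ (kkMetric s α gb φ A) (kkModel s α n F) N := by
  obtain ⟨N, ψ, χ, h1, h2, h3, h4⟩ := h.exists_pullsBack_kkModel hs hn hFs hF hA hp
  exact ⟨N, _, h1, h2, h3, fun y => rfl, h4⟩

lemma PullsBack.exists_comp {n m l : ℕ} {Ψ : (Fin n → ℝ) → Fin m → ℝ}
    {g : MetricField n} {h : MetricField m} {N : Set (Fin n → ℝ)} {k : MetricField l}
    {Θ : (Fin m → ℝ) → Fin l → ℝ} {N' : Set (Fin m → ℝ)} (hΨ : PullsBack Ψ g h N)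
    (hΘ : PullsBack Θ h k N') (hN : IsOpen N) (hN' : IsOpen N') :
    IsOpen (N ∩ Ψ ⁻¹' N') ∧ PullsBack (fun y => Θ (Ψ y)) g k (N ∩ Ψ ⁻¹' N') := by
  have ho := hΨ.smooth.continuousOn.isOpen_inter_preimage hN hN'
  exact ⟨ho, hΘ.comp (hΨ.mono inter_subset_left) ho hN' fun y hy => hy.2⟩

/-- In the first case the normal form of the metric lies in AdS₃, realized as `SL(2, ℝ)`, and has
constant curvature. -/
theorem IsAnsatz.case1_geometry {s ℓ μ c k : ℝ} {U : Set (Fin 2 → ℝ)} {gb : MetricField 2}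
    {φ : (Fin 2 → ℝ) → ℝ} {A : OneForm 2} (h : IsAnsatz s U gb φ) (hs : s = 1 ∨ s = -1)
    (hℓ : 0 < ℓ) (hn : ∀ x ∈ U, normSqDiff gb φ x = profile1 s ℓ μ c k (φ x))
    (hA : IsPotential U gb (fun x => ansatzF s μ (1 / 2) k 0 (φ x)) A) :
    LocallyAdS3 ℓ (kkMetric s (1 / 2) gb φ A) (cylinder U) ∧
      PetrovO (kkMetric s (1 / 2) gb φ A) (cylinder U) := by
  have hf : ∀ t, ansatzF s μ (1 / 2) k 0 t = k * exp (-2 * t) := fun t => by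
    rw [ansatzF, if_neg (by norm_num)]
    norm_num
  have hF : ∀ t, HasDerivAt (fun t => -(k / 2) * exp (-2 * t)) (ansatzF s μ (1 / 2) k 0 t) t :=
    fun t => by
      rw [hf]
      exact ((hasDerivAt_exp_mul (-2) t).const_mul _).congr_deriv (by ring)
  have hs0 : s ≠ 0 := by rcases hs with rfl | rfl <;> norm_num
  have hd := kkMetric_det_ne_zero (α := 1 / 2) (φ := φ) (A := A) hs0 h.metric
  have key : ∀ p ∈ cylinder U, ∃ (m P q : ℝ) (Y Y' : ℝ → ℝ)
      (M : (Fin 3 → ℝ) → Matrix (Fin 2) (Fin 2) ℝ) (N : Set (Fin 3 → ℝ))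
      (Ψ : (Fin 3 → ℝ) → Fin 3 → ℝ), IsOpen N ∧ p ∈ N ∧ N ⊆ cylinder U ∧ m ≠ 0 ∧
      (∀ t, HasDerivAt Y (Y' t) t) ∧ (∀ t, HasDerivAt Y' (4 * m * Y t) t) ∧
      (∀ t, Y' t ^ 2 = 4 * m * (Y t ^ 2 - P * q)) ∧ IsSL2Chart m P q Y M ∧
      Y (Ψ p 0) ^ 2 - P * q ≠ 0 ∧ PullsBack Ψ (kkMetric s (1 / 2) gb φ A) (blockMetric
        (ℓ ^ 2 * m) (fun _ => ℓ ^ 2 * P) (fun t => ℓ ^ 2 * Y t) (fun _ => ℓ ^ 2 * q)) N := by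
    intro p hp
    obtain ⟨N, Ψ, hN, hpN, hNU, hΨ0, hΨ⟩ :=
      h.exists_pullsBack_of_kkModel (α := 1 / 2) hs hn (by fun_prop) hF hA hp
    obtain ⟨m, P, q, Y, Y', M, J, Θ, hJ, htJ, hm, hY, hY', hYY, hM, hne, hΘ⟩ :=
      kkModel_profile1_pullsBack (μ := μ) (c := c) (k := k) (t₀ := φ (base p)) hs hℓ
        (by rw [← hn _ hp]; exact h.nonnull _ hp) (by rw [← hn _ hp]; exact h.normSqDiff_pos hs hp)
    obtain ⟨ho, hc⟩ := hΨ.exists_comp hΘ hN (hJ.preimage (continuous_apply 0))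
    refine ⟨m, P, q, Y, Y', M, _, _, ho, ⟨hpN, ?_⟩, fun y hy => hNU hy.1, hm, hY, hY', hYY, hM,
      hne (Ψ p) (hΨ0 p), hc⟩
    change Ψ p 0 ∈ J
    rwa [hΨ0]
  constructor
  · intro p hp
    obtain ⟨m, P, q, Y, Y', M, N, Ψ, hN, hpN, hNU, -, -, -, -, hM, -, hΨ⟩ := key p hp
    have hX := (hM.pullsBack_quadric (ℓ := ℓ)).comp hΨ hN isOpen_univ (mapsTo_univ _ _)
    exact ⟨N, hN, hpN, hNU, _, hX.smooth, fun x _ => hM.quadricEmbedding_mem _, hX.pullback⟩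
  · refine hasCanonicalForm_of_pullsBack hd fun p hp => ?_
    obtain ⟨m, P, q, Y, Y', M, N, Ψ, hN, hpN, hNU, hm, hY, hY', hYY, -, hne, hΨ⟩ := key p hp
    refine ⟨N, Ψ, _, hN, hpN, hNU, hΨ, 1, by simp, ?_⟩
    rw [tracelessRicci_block_AdS hℓ.ne' hm hY hY' hYY hne, zero_mul, mul_zero]

/-! ### The second case: warped AdS₃ -/

/-- The inverse of the generalized hyperbolic tangent. -/
lemma exists_generalized_artanh {ε : ℝ} (hε : ε = 1 ∨ ε = -1) : ∃ T : ℝ → ℝ, ∀ r,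
    0 < 1 - ε * r ^ 2 → ContDiffAt ℝ ∞ T r ∧ HasDerivAt T (1 / (1 - ε * r ^ 2)) r := by
  rcases hε with rfl | rfl
  · refine ⟨fun r => (log (1 + r) - log (1 - r)) / 2, fun r hr => ?_⟩
    have h1 : 1 + r ≠ 0 := by
      intro h0
      rw [show r = -1 by linarith] at hr
      norm_num at hr
    have h2 : 1 - r ≠ 0 := by
      intro h0
      rw [show r = 1 by linarith] at hr
      norm_num at hr
    refine ⟨?_, ?_⟩
    · have d1 : ContDiffAt ℝ ∞ (fun r : ℝ => log (1 + r)) r := ContDiffAt.log (by fun_prop) h1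
      have d2 : ContDiffAt ℝ ∞ (fun r : ℝ => log (1 - r)) r := ContDiffAt.log (by fun_prop) h2
      exact (d1.sub d2).div_const 2
    · refine (((((hasDerivAt_id r).const_add 1).log h1).sub
        (((hasDerivAt_id r).const_sub 1).log h2)).div_const 2).congr_deriv ?_
      have h3 : 1 - 1 * r ^ 2 ≠ 0 := hr.ne'
      rw [show 1 - 1 * r ^ 2 = (1 + r) * (1 - r) by ring] at *
      simp only [id]
      field_simp
      ring
  · refine ⟨arctan, fun r hr => ⟨Real.contDiff_arctan.contDiffAt, ?_⟩⟩
    refine (Real.hasDerivAt_arctan r).congr_deriv ?_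
    ring

/-- Coordinates `(y, u, t)` on `SL(2, ℝ)`, given by the decomposition of a matrix into
`[[1, 0], [u, 1]]`, `diag(√y, 1 / √y)` and the exponential of `(ε t / 2) [[0, 1], [ε, 0]]`, of which
`T` is the parameter as a function of the quotient of the upper entries. -/
noncomputable def warpedCoordinates (ε : ℝ) (T : ℝ → ℝ)
    (M : (Fin 3 → ℝ) → Matrix (Fin 2) (Fin 2) ℝ) (x : Fin 3 → ℝ) : Fin 3 → ℝ :=
  ![M x 0 0 * M x 0 0 - ε * (M x 0 1 * M x 0 1),
    (M x 0 0 * M x 1 0 - ε * (M x 0 1 * M x 1 1)) *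
      (M x 0 0 * M x 0 0 - ε * (M x 0 1 * M x 0 1))⁻¹,
    2 * ε * T (M x 0 1 * (M x 0 0)⁻¹)]

/-- The metric on warped AdS₃ as a combination of the biinvariant metric of `SL(2, ℝ)` and the
square of a left invariant one-form. -/
lemma warped_algebra {ε a b c d y u y₁ u₁ t₁ y₂ u₂ t₂ : ℝ} {V W : Matrix (Fin 2) (Fin 2) ℝ}
    (hε : ε = 1 ∨ ε = -1) (w : ℝ) (ha : a ≠ 0) (hy : y ≠ 0) (hdet : a * d - b * c = 1)
    (hV : V 0 0 * d + a * V 1 1 - V 0 1 * c - b * V 1 0 = 0)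
    (hW : W 0 0 * d + a * W 1 1 - W 0 1 * c - b * W 1 0 = 0)
    (hyd : y = a * a - ε * (b * b)) (hu : y * u = a * c - ε * (b * d))
    (hy₁ : y₁ = 2 * (a * V 0 0 - ε * (b * V 0 1)))
    (hy₂ : y₂ = 2 * (a * W 0 0 - ε * (b * W 0 1)))
    (hu₁ : y * u₁ = V 0 0 * c + a * V 1 0 - ε * (V 0 1 * d + b * V 1 1) - u * y₁)
    (hu₂ : y * u₂ = W 0 0 * c + a * W 1 0 - ε * (W 0 1 * d + b * W 1 1) - u * y₂)
    (ht₁ : y * t₁ = 2 * ε * (a * V 0 1 - b * V 0 0))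
    (ht₂ : y * t₂ = 2 * ε * (a * W 0 1 - b * W 0 0)) :
    4 * (negDetForm V W + ε * (w - 1) *
      ((!![0, 1; ε, 0] * !![d, -b; -c, a] * V).trace / 2 *
        ((!![0, 1; ε, 0] * !![d, -b; -c, a] * W).trace / 2))) =
      y₁ * y₂ / y ^ 2 - ε * y ^ 2 * (u₁ * u₂) + ε * w * ((t₁ + y * u₁) * (t₂ + y * u₂)) := by
  have hd : d = (1 + b * c) / a := by field_simp; linear_combination hdet
  have hV' : V 1 1 = (V 0 1 * c + b * V 1 0 - V 0 0 * d) / a := by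
    field_simp; linear_combination hV
  have hW' : W 1 1 = (W 0 1 * c + b * W 1 0 - W 0 0 * d) / a := by
    field_simp; linear_combination hW
  have hu' : u = (a * c - ε * (b * d)) / y := by field_simp; linear_combination hu
  have hu₁' : u₁ = (V 0 0 * c + a * V 1 0 - ε * (V 0 1 * d + b * V 1 1) - u * y₁) / y := by
    field_simp; linear_combination hu₁
  have hu₂' : u₂ = (W 0 0 * c + a * W 1 0 - ε * (W 0 1 * d + b * W 1 1) - u * y₂) / y := by
    field_simp; linear_combination hu₂
  have ht₁' : t₁ = 2 * ε * (a * V 0 1 - b * V 0 0) / y := by field_simp; linear_combination ht₁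
  have ht₂' : t₂ = 2 * ε * (a * W 0 1 - b * W 0 0) / y := by field_simp; linear_combination ht₂
  have hβV : (!![0, 1; ε, 0] * !![d, -b; -c, a] * V).trace = t₁ + y * u₁ := by
    rw [Matrix.trace_fin_two, ht₁', hu₁', hu', hy₁]
    simp only [Matrix.mul_apply, Fin.sum_univ_two]
    simp
    rw [hV', hd]
    rcases hε with rfl | rfl <;> field_simp <;> rw [hyd] <;> ring
  have hβW : (!![0, 1; ε, 0] * !![d, -b; -c, a] * W).trace = t₂ + y * u₂ := by
    rw [Matrix.trace_fin_two, ht₂', hu₂', hu', hy₂]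
    simp only [Matrix.mul_apply, Fin.sum_univ_two]
    simp
    rw [hW', hd]
    rcases hε with rfl | rfl <;> field_simp <;> rw [hyd] <;> ring
  have hmain : 4 * negDetForm V W = y₁ * y₂ / y ^ 2 - ε * y ^ 2 * (u₁ * u₂)
      + ε * ((t₁ + y * u₁) * (t₂ + y * u₂)) := by
    rw [negDetForm, ht₁', ht₂', hu₁', hu₂', hu', hy₁, hy₂, hV', hW', hd]
    rcases hε with rfl | rfl <;> field_simp <;> rw [hyd] <;> ring
  rw [hβV, hβW]
  linear_combination hmain

/-- The domain of `warpedCoordinates`. -/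
def warpedDomain (ε : ℝ) (M : (Fin 3 → ℝ) → Matrix (Fin 2) (Fin 2) ℝ) : Set (Fin 3 → ℝ) :=
  {x | 0 < M x 0 0 ∧ 0 < M x 0 0 * M x 0 0 - ε * (M x 0 1 * M x 0 1)}

namespace IsSL2Chart

variable {ε m p : ℝ} {Y : ℝ → ℝ} {M : (Fin 3 → ℝ) → Matrix (Fin 2) (Fin 2) ℝ}

lemma isOpen_warpedDomain (h : IsSL2Chart m p ε Y M) : IsOpen (warpedDomain ε M) := by
  have h0 := (h.smooth 0 0).continuous
  have h1 := (h.smooth 0 1).continuous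
  exact (isOpen_lt continuous_const h0).inter
    (isOpen_lt continuous_const ((h0.mul h0).sub (continuous_const.mul (h1.mul h1))))

lemma zero_mem_warpedDomain (h : IsSL2Chart m p ε Y M) : 0 ∈ warpedDomain ε M := by
  simp [warpedDomain, h.one]

/-- The warped AdS₃ metric on `SL(2, ℝ)`. -/
lemma pullsBack_warped {ℓ ν κ w : ℝ} {T : ℝ → ℝ} (h : IsSL2Chart m p ε Y M)
    (hε : ε = 1 ∨ ε = -1) (hκ : κ = ℓ ^ 2 / (ν ^ 2 + 3)) (hw : w = 4 * ν ^ 2 / (ν ^ 2 + 3))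
    (hT : ∀ r, 0 < 1 - ε * r ^ 2 → ContDiffAt ℝ ∞ T r ∧ HasDerivAt T (1 / (1 - ε * r ^ 2)) r) :
    PullsBack (warpedCoordinates ε T M) (blockMetric (4 * κ * m)
      (fun t => 4 * κ * (p + ε * (w - 1) * Y t ^ 2)) (fun t => 4 * κ * (w * Y t))
      (fun _ => 4 * κ * (ε * w))) (warpedAdS3 ℓ ν ε) (warpedDomain ε M) := by
  have hr : ∀ x ∈ warpedDomain ε M, 1 - ε * (M x 0 1 * (M x 0 0)⁻¹) ^ 2 =
      (M x 0 0 * M x 0 0 - ε * (M x 0 1 * M x 0 1)) / (M x 0 0 * M x 0 0) := fun x hx => by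
    have := hx.1.ne'
    field_simp
  have hr' : ∀ x ∈ warpedDomain ε M, 0 < 1 - ε * (M x 0 1 * (M x 0 0)⁻¹) ^ 2 := fun x hx => by
    rw [hr x hx]
    exact div_pos hx.2 (mul_pos hx.1 hx.1)
  refine ⟨fun x hx => ?_, fun x hx => ?_⟩
  · have h00 := (h.smooth 0 0).contDiffAt (x := x)
    have h01 := (h.smooth 0 1).contDiffAt (x := x)
    have h10 := (h.smooth 1 0).contDiffAt (x := x)
    have h11 := (h.smooth 1 1).contDiffAt (x := x)
    have hy := (h00.mul h00).sub ((contDiffAt_const (c := ε)).mul (h01.mul h01))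
    refine ContDiffAt.contDiffWithinAt (contDiffAt_pi.2 fun i => ?_)
    match i with
    | 0 => exact hy
    | 1 =>
      exact ((h00.mul h10).sub ((contDiffAt_const (c := ε)).mul (h01.mul h11))).mul
        (hy.inv hx.2.ne')
    | 2 =>
      exact (contDiffAt_const (c := 2 * ε)).mul
        (ContDiffAt.comp x (hT _ (hr' x hx)).1 (h01.mul (h00.inv hx.1.ne')))
  · have ha := hx.1.ne'
    have hy := hx.2.ne'
    have hy2 : M x 0 0 ^ 2 - ε * M x 0 1 ^ 2 ≠ 0 := by simpa only [sq] using hy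
    have d := fun i a b => h.pd_eq i a b x
    have dy := fun i => ((d i 0 0).mul (d i 0 0)).sub (((d i 0 1).mul (d i 0 1)).const_mul ε)
    have du := fun i => (((d i 0 0).mul (d i 1 0)).sub
      (((d i 0 1).mul (d i 1 1)).const_mul ε)).mul ((dy i).inv hy)
    have dt := fun i => (HasPd.comp (hT _ (hr' x hx)).2
      ((d i 0 1).mul ((d i 0 0).inv ha))).const_mul (2 * ε)
    have hdet := h.det x
    rw [Matrix.det_fin_two] at hdet
    have hddet : ∀ i, pdMatrix i M x 0 0 * M x 1 1 + M x 0 0 * pdMatrix i M x 1 1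
        - pdMatrix i M x 0 1 * M x 1 0 - M x 0 1 * pdMatrix i M x 1 0 = 0 := fun i => by
      have h1 := (((d i 0 0).mul (d i 1 1)).sub ((d i 0 1).mul (d i 1 0))).2
      have h2 : (fun y => M y 0 0 * M y 1 1 - M y 0 1 * M y 1 0) = fun _ => 1 := by
        funext y
        rw [← Matrix.det_fin_two, h.det]
      rw [h2, pd_const] at h1
      linear_combination -h1
    have e0 : ∀ i, jac (warpedCoordinates ε T M) x 0 i =
        2 * (M x 0 0 * pdMatrix i M x 0 0 - ε * (M x 0 1 * pdMatrix i M x 0 1)) := fun i => by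
      refine (dy i).2.trans ?_
      ring
    have e1 : ∀ i, (M x 0 0 * M x 0 0 - ε * (M x 0 1 * M x 0 1)) *
        jac (warpedCoordinates ε T M) x 1 i = pdMatrix i M x 0 0 * M x 1 0 +
          M x 0 0 * pdMatrix i M x 1 0 - ε * (pdMatrix i M x 0 1 * M x 1 1 +
          M x 0 1 * pdMatrix i M x 1 1) -
          warpedCoordinates ε T M x 1 * jac (warpedCoordinates ε T M) x 0 i := fun i => by
      rw [e0, show jac (warpedCoordinates ε T M) x 1 i = _ from (du i).2]
      simp only [warpedCoordinates, Matrix.cons_val_one, Matrix.cons_val_zero]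
      field_simp
      ring
    have e2 : ∀ i, (M x 0 0 * M x 0 0 - ε * (M x 0 1 * M x 0 1)) *
        jac (warpedCoordinates ε T M) x 2 i = 2 * ε * (M x 0 0 * pdMatrix i M x 0 1
          - M x 0 1 * pdMatrix i M x 0 0) := fun i => by
      rw [show jac (warpedCoordinates ε T M) x 2 i = _ from (dt i).2, hr x hx]
      field_simp
      ring
    have hu : (M x 0 0 * M x 0 0 - ε * (M x 0 1 * M x 0 1)) * warpedCoordinates ε T M x 1 =
        M x 0 0 * M x 1 0 - ε * (M x 0 1 * M x 1 1) := by
      simp only [warpedCoordinates, Matrix.cons_val_one, Matrix.cons_val_zero]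
      field_simp
    have halg := fun i j => warped_algebra hε w ha hy hdet (hddet i) (hddet j) rfl hu (e0 i)
      (e0 j) (e1 i) (e1 j) (e2 i) (e2 j)
    have hadj : !![M x 1 1, -M x 0 1; -M x 1 0, M x 0 0] = (M x).adjugate :=
      (Matrix.adjugate_fin_two _).symm
    have hε2 : ε * ε = 1 := by rcases hε with rfl | rfl <;> norm_num
    have hlhs : ∀ i j, blockMetric (4 * κ * m)
        (fun t => 4 * κ * (p + ε * (w - 1) * Y t ^ 2)) (fun t => 4 * κ * (w * Y t))
        (fun _ => 4 * κ * (ε * w)) x i j = κ * (4 * (blockMetric m (fun _ => p) Y (fun _ => ε) x i j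
          + ε * (w - 1) * (![0, Y (x 0), ε] i * ![0, Y (x 0), ε] j))) := by
      intro i j
      fin_cases i <;> fin_cases j <;> simp [blockMetric] <;>
        first
        | ring1
        | linear_combination (-(4 * κ * Y (x 0) * (w - 1))) * hε2
        | linear_combination (-(4 * κ * ε * (w - 1))) * hε2
    ext i j
    rw [hlhs, ← h.metric, ← h.form, ← h.form, ← hadj, halg]
    simp only [Matrix.mul_apply, Matrix.transpose_apply, Fin.sum_univ_three, warpedAdS3, ← hκ, ← hw]
    rw [show warpedCoordinates ε T M x 0 = M x 0 0 * M x 0 0 - ε * (M x 0 1 * M x 0 1) from rfl]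
    simp
    ring

end IsSL2Chart

/-- The normal form with the second profile is warped AdS₃: up to a constant rescaling of `x` and a
shear, `w` and `x` are the coordinates `u` and `v` of an `IsSL2Chart` with `q = ε`, translated such
that the given point becomes the identity. -/
lemma kkModel_profile2_pullsBack {s ℓ ν δ ε : ℝ} (hs : s = 1 ∨ s = -1) (hℓ : 0 < ℓ) (hν : ν ≠ 0)
    (hε : ε = 1 ∨ ε = -1) (hεs : 0 < ε * (s * (ν ^ 2 - 1))) {y₀ : Fin 3 → ℝ}
    (hN : profile2 s ℓ (3 * ν / ℓ) δ (y₀ 0) ≠ 0)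
    (hsN : s = 1 ∨ 0 < profile2 s ℓ (3 * ν / ℓ) δ (y₀ 0)) :
    ∃ (N : Set (Fin 3 → ℝ)) (Θ : (Fin 3 → ℝ) → Fin 3 → ℝ), IsOpen N ∧ y₀ ∈ N ∧
      MapsTo Θ N halfSpace ∧
      PullsBack Θ (kkModel s 0 (profile2 s ℓ (3 * ν / ℓ) δ)
        fun t => 2 * s * ν / ℓ * exp (-t) - δ / 2 * exp (-2 * t)) (warpedAdS3 ℓ ν ε) N := by
  have hs2 : s ^ 2 = 1 := by rcases hs with rfl | rfl <;> norm_num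
  have hε2 : ε ^ 2 = 1 := by rcases hε with rfl | rfl <;> norm_num
  have hν3 : ν ^ 2 + 3 ≠ 0 := by positivity
  -- `A` is real because `ε` is the sign of `s (ν² - 1)`
  obtain ⟨A, hA0, hA⟩ : ∃ A, 0 < A ∧ A ^ 2 * ℓ ^ 2 = 3 * (ε * (s * (ν ^ 2 - 1))) :=
    ⟨√(3 * (ε * (s * (ν ^ 2 - 1)))) / ℓ, by positivity, by
      rw [div_pow, Real.sq_sqrt (by positivity)]; field_simp⟩
  have hA' : A ^ 2 = 3 * (ε * (s * (ν ^ 2 - 1))) / ℓ ^ 2 := by field_simp; linear_combination hA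
  have hA4 : A ^ 4 = (3 * (ε * (s * (ν ^ 2 - 1))) / ℓ ^ 2) ^ 2 := by rw [← hA']; ring
  obtain ⟨κ, hκ⟩ : ∃ κ, κ = ℓ ^ 2 / (ν ^ 2 + 3) := ⟨_, rfl⟩
  obtain ⟨w, hw⟩ : ∃ w, w = 4 * ν ^ 2 / (ν ^ 2 + 3) := ⟨_, rfl⟩
  -- the coefficients of `dx²`, `dx dw` and `dw²` determine `p`, the factor `σ` and `f = Y ∘ θ`
  obtain ⟨p, hp⟩ : ∃ p, p = s * δ ^ 2 / 16 := ⟨_, rfl⟩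
  obtain ⟨σ, hσ⟩ : ∃ σ, σ = A * (ν ^ 2 + 3) / (4 * ν * ℓ) := ⟨_, rfl⟩
  obtain ⟨f, hf⟩ : ∃ f : ℝ → ℝ, f = fun t =>
    (ν ^ 2 + 3) / (2 * A * ℓ ^ 2) * exp t - s * ν * δ / (2 * A * ℓ) := ⟨_, rfl⟩
  have e1 : ∀ t, exp (-t) = (exp t)⁻¹ := fun t => exp_neg t
  have e2 : ∀ t, exp (2 * t) = exp t ^ 2 := fun t => by rw [← exp_nat_mul]; norm_num
  have e4 : ∀ t, exp (-2 * t) = (exp t ^ 2)⁻¹ := fun t => by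
    rw [← exp_nat_mul, ← exp_neg]; norm_num
  have hdet : ∀ t, f t ^ 2 - p * ε =
      exp t ^ 2 / (4 * A ^ 2 * κ) * profile2 s ℓ (3 * ν / ℓ) δ t := fun t => by
    have hE := exp_pos t
    rw [hf, hp, hκ, profile2]
    simp only [e1, e4]
    field_simp
    rw [hA']
    rcases hs with rfl | rfl <;> rcases hε with rfl | rfl <;> field_simp <;> ring
  have hfd : ∀ t, HasDerivAt f ((ν ^ 2 + 3) / (2 * A * ℓ ^ 2) * exp t) t := fun t => by
    rw [hf]
    exact ((Real.hasDerivAt_exp t).const_mul _).sub_const _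
  have hpos : 0 < f (y₀ 0) ^ 2 - p * ε ∨ 0 < ε := by
    rcases hε with rfl | rfl
    · exact Or.inr one_pos
    · left
      rcases hs with rfl | rfl
      · refine lt_of_le_of_ne ?_ (Ne.symm ?_)
        · rw [hp]
          have := sq_nonneg (f (y₀ 0))
          have := sq_nonneg δ
          linarith
        · rw [hdet, hκ]
          have := exp_pos (y₀ 0)
          positivity
      · rw [hdet, hκ]
        have := hsN.resolve_left (by norm_num)
        have := exp_pos (y₀ 0)
        positivity
  obtain ⟨Y, Y', M, hYs, hY0, hY'0, hY, hY', hYY, hM⟩ := exists_isSL2Chart hpos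
  obtain ⟨m, hmd⟩ : ∃ m, m = f (y₀ 0) ^ 2 - p * ε := ⟨_, rfl⟩
  rw [← hmd] at hY'0 hY' hYY hM
  have hm : m ≠ 0 := by
    rw [hmd, hdet, hκ]
    have := exp_pos (y₀ 0)
    positivity
  obtain ⟨J, θ, hJ, htJ, hθ, hθ0, hθJ⟩ := exists_smooth_lift (t₀ := y₀ 0) hYs hY
    (continuous_iff_continuousAt.2 fun t => (hY' t).continuousAt)
    (by rw [hY'0]; exact mul_ne_zero (by norm_num) hm) (by rw [hf]; fun_prop) hfd hY0.symm
  obtain ⟨T, hT⟩ := exists_generalized_artanh hε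
  have hΘ : PullsBack (fun y => ![θ (y 0), 0 * y 1 + 1 * y 2 + -y₀ 2,
      σ * y 1 + σ * (δ * κ / 2) * y 2 + -(σ * y₀ 1 + σ * (δ * κ / 2) * y₀ 2)])
      (kkModel s 0 (profile2 s ℓ (3 * ν / ℓ) δ)
        fun t => 2 * s * ν / ℓ * exp (-t) - δ / 2 * exp (-2 * t)) (blockMetric (4 * κ * m)
      (fun t => 4 * κ * (p + ε * (w - 1) * Y t ^ 2)) (fun t => 4 * κ * (w * Y t))
      (fun _ => 4 * κ * (ε * w))) {y | y 0 ∈ J} := by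
    refine kkModel_pullsBack_blockMetric hθ (fun t ht => (hθJ t ht).2.2) ?_ ?_ ?_ ?_
    · intro t ht
      obtain ⟨h1, h2, -⟩ := hθJ t ht
      have hE := exp_pos t
      have h3 := hYY (θ t)
      rw [h1, hdet] at h3
      have hn : profile2 s ℓ (3 * ν / ℓ) δ t ≠ 0 := fun h0 => h2 (by
        rw [h0] at h3
        exact pow_eq_zero_iff two_ne_zero |>.1 (by rw [h3]; ring))
      rw [div_pow, h3, mul_zero, zero_mul, exp_zero, hκ]
      field_simp
      ring
    · intro t ht
      have hE := exp_pos t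
      rw [mul_zero, zero_mul, exp_zero, hσ, hκ, hw, profile2]
      simp only [e1, e2, e4]
      field_simp
      simp only [hA']
      rcases hs with rfl | rfl <;> rcases hε with rfl | rfl <;> field_simp <;> ring
    · intro t ht
      have hE := exp_pos t
      rw [(hθJ t ht).1, hf, hσ, hκ, hw]
      simp only [e1, e2, e4]
      field_simp
      simp only [hA', hA4]
      rcases hs with rfl | rfl <;> rcases hε with rfl | rfl <;> field_simp <;> ring
    · intro t ht
      have hE := exp_pos t
      rw [(hθJ t ht).1, hf, hσ, hκ, hw, hp]
      simp only [e2]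
      field_simp
      simp only [hA', hA4]
      rcases hs with rfl | rfl <;> rcases hε with rfl | rfl <;> field_simp <;> ring
  have hW := hM.pullsBack_warped hε hκ hw hT
  obtain ⟨ho, hc⟩ := hΘ.exists_comp hW (hJ.preimage (continuous_apply 0)) hM.isOpen_warpedDomain
  refine ⟨_, _, ho, ⟨htJ, ?_⟩, fun y hy => hy.2.2, hc⟩
  have h0 : ![θ (y₀ 0), 0 * y₀ 1 + 1 * y₀ 2 + -y₀ 2,
      σ * y₀ 1 + σ * (δ * κ / 2) * y₀ 2 + -(σ * y₀ 1 + σ * (δ * κ / 2) * y₀ 2)] = 0 := by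
    ext i
    fin_cases i <;> simp [hθ0]
  rw [mem_preimage, h0]
  exact hM.zero_mem_warpedDomain

/-- The logarithmic coordinate `τ = log y` turns metrics on the half space into `blockMetric`. -/
lemma blockMetric_log_pullsBack {d : ℝ} {a b c : ℝ → ℝ} {g : MetricField 3}
    (hg : ∀ y ∈ halfSpace, g y = !![d / y 0 ^ 2, 0, 0; 0, a (log (y 0)), b (log (y 0));
      0, b (log (y 0)), c (log (y 0))]) :
    PullsBack (fun y => ![log (y 0), y 1, y 2]) g (blockMetric d a b c) halfSpace := by
  refine ⟨fun y hy => ?_, fun y hy => ?_⟩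
  · refine ContDiffAt.contDiffWithinAt (contDiffAt_pi.2 fun i => ?_)
    match i with
    | 0 => exact ContDiffAt.log (contDiff_apply ℝ ℝ (0 : Fin 3)).contDiffAt (ne_of_gt hy)
    | 1 => exact (contDiff_apply ℝ ℝ (1 : Fin 3)).contDiffAt
    | 2 => exact (contDiff_apply ℝ ℝ (2 : Fin 3)).contDiffAt
  · have hj : jac (fun y : Fin 3 → ℝ => ![log (y 0), y 1, y 2]) y =
        !![(y 0)⁻¹, 0, 0; 0, 1, 0; 0, 0, 1] := by
      have h0 := fun i => pd_comp_coord (x := y) i 0 (Real.hasDerivAt_log (ne_of_gt hy))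
      ext i j
      fin_cases i <;> fin_cases j <;> simp [jac, h0, pd_coord]
    rw [hj, hg y hy]
    ext i j
    fin_cases i <;> fin_cases j <;>
      simp [blockMetric, Matrix.mul_apply, Fin.sum_univ_three] <;> ring

lemma isOpen_halfSpace : IsOpen halfSpace :=
  isOpen_lt continuous_const (continuous_apply 0)

lemma warpedAdS3_eq_log {ℓ ν ε κ w : ℝ} (hκ : κ = ℓ ^ 2 / (ν ^ 2 + 3))
    (hw : w = 4 * ν ^ 2 / (ν ^ 2 + 3)) {y : Fin 3 → ℝ} (hy : y ∈ halfSpace) :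
    warpedAdS3 ℓ ν ε y = !![κ / y 0 ^ 2, 0, 0;
      0, κ * ε * (w - 1) * exp (2 * log (y 0)), κ * ε * w * exp (log (y 0));
      0, κ * ε * w * exp (log (y 0)), κ * ε * w] := by
  have h1 : exp (log (y 0)) = y 0 := exp_log hy
  have h2 : exp (2 * log (y 0)) = y 0 ^ 2 := by rw [two_mul, exp_add, h1, sq]
  rw [h1, h2, warpedAdS3, ← hκ, ← hw]
  ext i j
  fin_cases i <;> fin_cases j <;> simp <;> ring

/-- In the second case the normal form of the metric is warped AdS₃, whose traceless Ricci tensor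
has the double eigenvalue `κ = (ν² - 1) / ℓ²`. -/
theorem IsAnsatz.case2_geometry {s ℓ ν δ ε : ℝ} {U : Set (Fin 2 → ℝ)} {gb : MetricField 2}
    {φ : (Fin 2 → ℝ) → ℝ} {A : OneForm 2} (h : IsAnsatz s U gb φ) (hs : s = 1 ∨ s = -1)
    (hℓ : 0 < ℓ) (hν : ν ≠ 0) (hε : ε = 1 ∨ ε = -1) (hεs : 0 < ε * (s * (ν ^ 2 - 1)))
    (hn : ∀ x ∈ U, normSqDiff gb φ x = profile2 s ℓ (3 * ν / ℓ) δ (φ x))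
    (hA : IsPotential U gb (fun x => ansatzF s (3 * ν / ℓ) 0 0 δ (φ x)) A) :
    LocallyIsometric (kkMetric s 0 gb φ A) (cylinder U) (warpedAdS3 ℓ ν ε) halfSpace ∧
      PetrovD ((ν ^ 2 - 1) / ℓ ^ 2) (kkMetric s 0 gb φ A) (cylinder U) := by
  have hf : ∀ t, ansatzF s (3 * ν / ℓ) 0 0 δ t =
      -(2 * s * ν / ℓ) * exp (-1 * t) + δ * exp (-2 * t) := fun t => by
    rw [ansatzF, if_neg (by norm_num)]
    norm_num
    ring
  have hF : ∀ t, HasDerivAt (fun t => 2 * s * ν / ℓ * exp (-t) - δ / 2 * exp (-2 * t))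
      (ansatzF s (3 * ν / ℓ) 0 0 δ t) t := fun t => by
    rw [hf]
    have h1 := hasDerivAt_exp_mul (-1) t
    simp only [neg_one_mul] at h1 ⊢
    exact ((h1.const_mul _).sub ((hasDerivAt_exp_mul (-2) t).const_mul _)).congr_deriv (by ring)
  have hs0 : s ≠ 0 := by rcases hs with rfl | rfl <;> norm_num
  have hd := kkMetric_det_ne_zero (α := 0) (φ := φ) (A := A) hs0 h.metric
  have key : ∀ p ∈ cylinder U, ∃ (N : Set (Fin 3 → ℝ)) (Ψ : (Fin 3 → ℝ) → Fin 3 → ℝ),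
      IsOpen N ∧ p ∈ N ∧ N ⊆ cylinder U ∧ MapsTo Ψ N halfSpace ∧
      PullsBack Ψ (kkMetric s 0 gb φ A) (warpedAdS3 ℓ ν ε) N := by
    intro p hp
    obtain ⟨N, Ψ, hN, hpN, hNU, hΨ0, hΨ⟩ :=
      h.exists_pullsBack_of_kkModel (α := 0) hs hn (by fun_prop) hF hA hp
    obtain ⟨N', Θ, hN', hpN', hm, hΘ⟩ :=
      kkModel_profile2_pullsBack (y₀ := Ψ p) (δ := δ) hs hℓ hν hε hεs
        (by rw [hΨ0, ← hn _ hp]; exact h.nonnull _ hp)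
        (by rw [hΨ0, ← hn _ hp]; exact h.normSqDiff_pos hs hp)
    obtain ⟨ho, hc⟩ := hΨ.exists_comp hΘ hN hN'
    exact ⟨_, _, ho, ⟨hpN, hpN'⟩, fun y hy => hNU hy.1, fun y hy => hm hy.2, hc⟩
  refine ⟨locallyIsometric_of_pullsBack hd key, ?_, hasCanonicalForm_of_pullsBack hd ?_⟩
  · have : ν ^ 2 - 1 ≠ 0 := fun h0 => by simp [h0] at hεs
    positivity
  · intro p hp
    obtain ⟨N, Ψ, hN, hpN, hNU, hm, hΨ⟩ := key p hp
    obtain ⟨κ, hκ⟩ : ∃ κ, κ = ℓ ^ 2 / (ν ^ 2 + 3) := ⟨_, rfl⟩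
    obtain ⟨w, hw⟩ : ∃ w, w = 4 * ν ^ 2 / (ν ^ 2 + 3) := ⟨_, rfl⟩
    have hlog := blockMetric_log_pullsBack (d := κ) (g := warpedAdS3 ℓ ν ε)
      (a := fun t => κ * ε * (w - 1) * exp (2 * t)) (b := fun t => κ * ε * w * exp t)
      (c := fun _ => κ * ε * w) fun y hy => warpedAdS3_eq_log hκ hw hy
    -- the eigenvectors are `∂_t`, and `∂_τ` and `∂_u - y ∂_t`, which are orthogonal to it
    refine ⟨N, _, _, hN, hpN, hNU, hlog.comp hΨ hN isOpen_halfSpace hm,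
      !![0, 1, 0; 0, 0, 1; 1, 0, -Ψ p 0], ?_, ?_⟩
    · simp [Matrix.det_fin_three]
    · rw [tracelessRicci_block_warped hε hℓ.ne' hν hκ hw]
      have h1 : exp (log (Ψ p 0)) = Ψ p 0 := exp_log (hm hpN)
      simp only [Matrix.cons_val_zero, h1]
      ext i j
      fin_cases i <;> fin_cases j <;>
        simp [Matrix.mul_apply, Fin.sum_univ_three, Matrix.diagonal_apply] <;> ring

/-! ### Killing vector fields from ignorable coordinates -/

lemma HasPd.sum {n : ℕ} {ι : Type*} {i : Fin n} (u : Finset ι) {F : ι → (Fin n → ℝ) → ℝ}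
    {F' : ι → ℝ} {x : Fin n → ℝ} (hF : ∀ j ∈ u, HasPd i (F j) (F' j) x) :
    HasPd i (fun y => ∑ j ∈ u, F j y) (∑ j ∈ u, F' j) x :=
  ⟨DifferentiableAt.fun_sum fun j hj => (hF j hj).1, by
    rw [pd_sum u fun j hj => (hF j hj).1]
    exact Finset.sum_congr rfl fun j hj => (hF j hj).2⟩

section Ignorable

variable {n : ℕ} {Ψ : (Fin n → ℝ) → Fin n → ℝ} {N : Set (Fin n → ℝ)}

lemma hasPd_jac (hN : IsOpen N) (hΨ : ContDiffOn ℝ ∞ Ψ N) {x : Fin n → ℝ} (hx : x ∈ N)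
    (i a k : Fin n) :
    HasPd i (fun y => jac Ψ y a k) (pd i (fun y => jac Ψ y a k) x) x :=
  HasPd.of_diff (diffAt_of_smooth hN (contDiffOn_pd hN (contDiffOn_pi.1 hΨ a)) hx)

lemma pd_jac_comm (hN : IsOpen N) (hΨ : ContDiffOn ℝ ∞ Ψ N) {x : Fin n → ℝ} (hx : x ∈ N)
    (i a k : Fin n) : pd i (fun y => jac Ψ y a k) x = pd k (fun y => jac Ψ y a i) x :=
  pd_pd_comm hN (contDiffOn_pi.1 hΨ a) hx

/-- The derivative of the condition that a vector field `V` has constant components with respect to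
the coordinates `Ψ`. -/
lemma sum_jac_mul_pd (hN : IsOpen N) (hΨ : ContDiffOn ℝ ∞ Ψ N) {V : (Fin n → ℝ) → Fin n → ℝ}
    (hV : ContDiffOn ℝ ∞ V N) {e : Fin n → ℝ} (hJV : ∀ x ∈ N, jac Ψ x *ᵥ V x = e)
    {x : Fin n → ℝ} (hx : x ∈ N) (a i : Fin n) :
    ∑ k, V x k * pd k (fun y => jac Ψ y a i) x =
      -∑ k, jac Ψ x a k * pd i (fun y => V y k) x := by
  have dV : ∀ k, HasPd i (fun y => V y k) (pd i (fun y => V y k) x) x := fun k =>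
    HasPd.of_diff (diffAt_of_smooth hN (contDiffOn_pi.1 hV k) hx)
  have h1 := (HasPd.sum Finset.univ fun k _ => (hasPd_jac hN hΨ hx i a k).mul (dV k)).2
  have h2 : pd i (fun y => ∑ k, jac Ψ y a k * V y k) x = 0 := by
    exact (pd_congr_on (G := fun _ => e a) hN (fun y hy => congrFun (hJV y hy) a) hx).trans
      (pd_const _ _ _)
  rw [h2, Finset.sum_add_distrib] at h1
  have h3 : ∑ k, V x k * pd k (fun y => jac Ψ y a i) x =
      ∑ k, pd i (fun y => jac Ψ y a k) x * V x k :=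
    Finset.sum_congr rfl fun k _ => by rw [pd_jac_comm hN hΨ hx i a k, mul_comm]
  rw [h3]
  linear_combination -h1

/-- A coordinate vector field along which the components of the metric are constant is Killing. -/
lemma PullsBack.isKilling {g h : MetricField n} (hP : PullsBack Ψ g h N) (hN : IsOpen N)
    {V : (Fin n → ℝ) → Fin n → ℝ} (hV : ContDiffOn ℝ ∞ V N) {e : Fin n → ℝ}
    (hJV : ∀ x ∈ N, jac Ψ x *ᵥ V x = e)
    (hh : ∀ x ∈ N, ∀ a b, DifferentiableAt ℝ (fun y => h y a b) (Ψ x) ∧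
      ∑ d, pd d (fun y => h y a b) (Ψ x) * e d = 0) : IsKilling g V N := by
  intro x hx i j
  have hΨ := hP.smooth
  have dΨ := diffAt_of_smooth hN hΨ hx
  let P : Fin n → Matrix (Fin n) (Fin n) ℝ := fun k =>
    Matrix.of fun a i => pd k (fun y => jac Ψ y a i) x
  let D : Fin n → Matrix (Fin n) (Fin n) ℝ := fun k =>
    Matrix.of fun a b => pd k (fun y => h (Ψ y) a b) x
  let B : Matrix (Fin n) (Fin n) ℝ := Matrix.of fun k i => pd i (fun y => V y k) x
  have hpd : ∀ k i j, pd k (fun y => g y i j) x = ((P k)ᵀ * h (Ψ x) * jac Ψ x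
      + (jac Ψ x)ᵀ * D k * jac Ψ x + (jac Ψ x)ᵀ * h (Ψ x) * P k) i j := by
    intro k i j
    have dh : ∀ a b, HasPd k (fun y => h (Ψ y) a b) (D k a b) x := fun a b =>
      HasPd.of_diff ((hh x hx a b).1.comp x dΨ)
    have dJ := hasPd_jac hN hΨ hx k
    have h1 := (HasPd.sum Finset.univ fun b _ => (HasPd.sum Finset.univ fun a _ =>
      (dJ a i).mul (dh a b)).mul (dJ b j)).2
    rw [pd_congr_on (G := fun y => ∑ b, (∑ a, jac Ψ y a i * h (Ψ y) a b) * jac Ψ y b j) hN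
      (fun y hy => by rw [hP.pullback y hy]; simp only [Matrix.mul_apply, Matrix.transpose_apply])
      hx, h1]
    simp only [Matrix.add_apply, Matrix.mul_apply, Matrix.transpose_apply,
      ← Finset.sum_add_distrib, ← add_mul]
    rfl
  have hQ : ∑ k, V x k • P k = -(jac Ψ x * B) := by
    ext a i
    rw [Matrix.sum_apply, Matrix.neg_apply, Matrix.mul_apply]
    exact sum_jac_mul_pd hN hΨ hV hJV hx a i
  have hD : ∑ k, V x k • D k = 0 := by
    ext a b
    rw [Matrix.sum_apply]
    have h1 : ∀ k, D k a b = ∑ d, pd d (fun y => h y a b) (Ψ x) * jac Ψ x d k := fun k =>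
      pd_comp_map (hh x hx a b).1 dΨ
    simp only [Matrix.smul_apply, h1, smul_eq_mul, Finset.mul_sum, Matrix.zero_apply]
    rw [Finset.sum_comm, ← (hh x hx a b).2]
    refine Finset.sum_congr rfl fun d _ => ?_
    rw [← hJV x hx, Matrix.mulVec, dotProduct, Finset.mul_sum]
    exact Finset.sum_congr rfl fun k _ => by ring
  have hmat : ∑ k, V x k • ((P k)ᵀ * h (Ψ x) * jac Ψ x + (jac Ψ x)ᵀ * D k * jac Ψ x
      + (jac Ψ x)ᵀ * h (Ψ x) * P k) = -(Bᵀ * g x) - g x * B := by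
    have h1 : ∑ k, V x k • ((P k)ᵀ * h (Ψ x) * jac Ψ x + (jac Ψ x)ᵀ * D k * jac Ψ x
      + (jac Ψ x)ᵀ * h (Ψ x) * P k) = (∑ k, V x k • P k)ᵀ * h (Ψ x) * jac Ψ x
      + (jac Ψ x)ᵀ * (∑ k, V x k • D k) * jac Ψ x + (jac Ψ x)ᵀ * h (Ψ x) * ∑ k, V x k • P k := by
      simp only [smul_add, Finset.sum_add_distrib, Matrix.transpose_sum, Matrix.transpose_smul,
        Finset.sum_mul, Finset.mul_sum, Matrix.smul_mul, Matrix.mul_smul]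
    rw [h1, hQ, hD, hP.pullback x hx]
    simp only [Matrix.transpose_neg, Matrix.transpose_mul, Matrix.mul_zero, Matrix.zero_mul,
      add_zero, Matrix.neg_mul, Matrix.mul_neg, Matrix.mul_assoc, sub_eq_add_neg]
  have h2 := congrFun (congrFun hmat i) j
  rw [Matrix.sum_apply] at h2
  simp only [Finset.sum_add_distrib, hpd]
  simp only [Matrix.smul_apply, smul_eq_mul] at h2
  rw [h2, Matrix.sub_apply, Matrix.neg_apply, Matrix.mul_apply, Matrix.mul_apply]
  have h3 : ∑ k, g x k j * pd i (fun y => V y k) x = ∑ k, Bᵀ i k * g x k j :=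
    Finset.sum_congr rfl fun k _ => mul_comm _ _
  rw [h3]
  change -_ - ∑ k, g x i k * pd j (fun y => V y k) x + _ + _ = 0
  ring

/-- Vector fields with constant components with respect to the same coordinates commute. -/
lemma lieBracket_eq_zero_of_jac_mulVec (hN : IsOpen N) (hΨ : ContDiffOn ℝ ∞ Ψ N)
    {V W : (Fin n → ℝ) → Fin n → ℝ} (hV : ContDiffOn ℝ ∞ V N) (hW : ContDiffOn ℝ ∞ W N)
    {e e' : Fin n → ℝ} (hJV : ∀ x ∈ N, jac Ψ x *ᵥ V x = e) (hJW : ∀ x ∈ N, jac Ψ x *ᵥ W x = e')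
    {x : Fin n → ℝ} (hx : x ∈ N) (hdet : (jac Ψ x).det ≠ 0) :
    VectorField.lieBracket ℝ V W x = 0 := by
  have dV := diffAt_of_smooth hN hV hx
  have dW := diffAt_of_smooth hN hW hx
  refine Matrix.eq_zero_of_mulVec_eq_zero hdet ?_
  rw [VectorField.lieBracket, fderiv_eq_jac_mulVec dW, fderiv_eq_jac_mulVec dV]
  ext a
  simp only [Matrix.mulVec, dotProduct, Pi.sub_apply, Pi.zero_apply, mul_sub,
    Finset.sum_sub_distrib, Finset.mul_sum]
  have h1 := fun i => sum_jac_mul_pd hN hΨ hV hJV hx a i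
  have h2 := fun i => sum_jac_mul_pd hN hΨ hW hJW hx a i
  have h3 : ∑ k, ∑ i, jac Ψ x a k * (jac W x k i * V x i) =
      -∑ i, V x i * ∑ k, W x k * pd k (fun y => jac Ψ y a i) x := by
    simp only [h2, mul_neg, Finset.sum_neg_distrib, neg_neg, Finset.mul_sum]
    rw [Finset.sum_comm]
    refine Finset.sum_congr rfl fun i _ => Finset.sum_congr rfl fun k _ => ?_
    simp only [jac, Matrix.of_apply]
    ring
  have h4 : ∑ k, ∑ i, jac Ψ x a k * (jac V x k i * W x i) =
      -∑ i, W x i * ∑ k, V x k * pd k (fun y => jac Ψ y a i) x := by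
    simp only [h1, mul_neg, Finset.sum_neg_distrib, neg_neg, Finset.mul_sum]
    rw [Finset.sum_comm]
    refine Finset.sum_congr rfl fun i _ => Finset.sum_congr rfl fun k _ => ?_
    simp only [jac, Matrix.of_apply]
    ring
  rw [h3, h4, sub_eq_zero, neg_inj]
  simp only [Finset.mul_sum]
  rw [Finset.sum_comm]
  refine Finset.sum_congr rfl fun i _ => Finset.sum_congr rfl fun k _ => ?_
  rw [pd_jac_comm hN hΨ hx i a k]
  ring

/-- The vector fields with constant components with respect to the coordinates of a local
isometry. -/
lemma IsLocalIsometry.exists_coordinate_field {Φ : OpenPartialHomeomorph (Fin n → ℝ) (Fin n → ℝ)}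
    {g h : MetricField n} (hΦ : IsLocalIsometry Φ g h) (e : Fin n → ℝ) :
    ∃ V : (Fin n → ℝ) → Fin n → ℝ, ContDiffOn ℝ ∞ V Φ.source ∧
      ∀ x ∈ Φ.source, jac Φ x *ᵥ V x = e := by
  refine ⟨fun x => jac Φ.symm (Φ x) *ᵥ e, contDiffOn_pi.2 fun k => ?_, fun x hx => ?_⟩
  · have h1 : ∀ i, ContDiffOn ℝ ∞ (fun x => jac Φ.symm (Φ x) k i) Φ.source := fun i =>
      (contDiffOn_pd (i := i) Φ.open_target (contDiffOn_pi.1 hΦ.smooth_symm k)).comp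
        hΦ.smooth fun x hx => Φ.map_source hx
    change ContDiffOn ℝ ∞ (fun x => ∑ i, jac Φ.symm (Φ x) k i * e i) Φ.source
    exact ContDiffOn.sum fun i _ => (h1 i).mul contDiffOn_const
  · have hy := Φ.map_source hx
    have h1 : jac (fun y => Φ (Φ.symm y)) (Φ x) = jac Φ (Φ.symm (Φ x)) * jac Φ.symm (Φ x) :=
      jac_comp (diffAt_of_smooth Φ.open_source hΦ.smooth (Φ.map_target hy))
        (diffAt_of_smooth Φ.open_target hΦ.smooth_symm hy)
    have h2 : jac (fun y => Φ (Φ.symm y)) (Φ x) = 1 := by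
      ext a i
      rw [jac, Matrix.of_apply, pd_congr_on (G := fun y => y a) Φ.open_target
        (fun y hy => by rw [Φ.right_inv hy]) hy, pd_coord, Matrix.one_apply]
      simp only [eq_comm]
    have h3 := h1.symm.trans h2
    rw [Φ.left_inv hx] at h3
    rw [Matrix.mulVec_mulVec, h3, Matrix.one_mulVec]

end Ignorable

/-! ### The third case: the AdS pp-wave -/

/-- The metrics that are pulled back from `blockMetric` have two commuting Killing vector fields. -/
lemma hasTwoCommutingIsometries_of_blockMetric {g : MetricField 3} {W : Set (Fin 3 → ℝ)} {d : ℝ}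
    {a b c : ℝ → ℝ} (ha : Differentiable ℝ a) (hb : Differentiable ℝ b) (hc : Differentiable ℝ c)
    (hd : ∀ x ∈ W, (g x).det ≠ 0)
    (H : ∀ p ∈ W, ∃ (N : Set (Fin 3 → ℝ)) (Ψ : (Fin 3 → ℝ) → Fin 3 → ℝ), IsOpen N ∧ p ∈ N ∧
      N ⊆ W ∧ PullsBack Ψ g (blockMetric d a b c) N) : HasTwoCommutingIsometries g W := by
  intro p hp
  obtain ⟨N, Ψ, hN, hpN, hNW, hΨ⟩ := H p hp
  obtain ⟨Φ, hpΦ, hΦN, -, hΦ⟩ := hΨ.exists_isLocalIsometry hN (fun x hx => hd x (hNW hx)) hpN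
  have hP : PullsBack Φ g (blockMetric d a b c) Φ.source := ⟨hΦ.smooth, hΦ.pullback⟩
  have hdet : ∀ x ∈ Φ.source, (jac Φ x).det ≠ 0 := fun x hx =>
    hP.det_jac_ne_zero hx (hd x (hNW (hΦN hx)))
  obtain ⟨K, hK, hJK⟩ := hΦ.exists_coordinate_field ![0, 1, 0]
  obtain ⟨L, hL, hJL⟩ := hΦ.exists_coordinate_field ![0, 0, 1]
  have hpd : ∀ (i j k : Fin 3) (y : Fin 3 → ℝ),
      HasPd k (fun y => blockMetric d a b c y i j) (if k = 0 then
        !![0, 0, 0; 0, deriv a (y 0), deriv b (y 0); 0, deriv b (y 0), deriv c (y 0)] i j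
          else 0) y := by
    intro i j k y
    refine ⟨?_, pd_blockMetric (fun t => (ha t).hasDerivAt) (fun t => (hb t).hasDerivAt)
      (fun t => (hc t).hasDerivAt) k i j y⟩
    fin_cases i <;> fin_cases j <;> simp [blockMetric] <;> fun_prop
  have hh : ∀ e : Fin 3 → ℝ, e 0 = 0 → ∀ x ∈ Φ.source, ∀ i j,
      DifferentiableAt ℝ (fun y => blockMetric d a b c y i j) (Φ x) ∧
        ∑ k, pd k (fun y => blockMetric d a b c y i j) (Φ x) * e k = 0 := fun e he x _ i j => by
    refine ⟨(hpd i j 0 _).1, ?_⟩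
    simp [(hpd i j _ _).2, he]
  refine ⟨Φ.source, Φ.open_source, hpΦ, hΦN.trans hNW, K, L, hK, hL,
    hP.isKilling Φ.open_source hK hJK (hh _ rfl), hP.isKilling Φ.open_source hL hJL (hh _ rfl),
    fun x hx => lieBracket_eq_zero_of_jac_mulVec Φ.open_source hΦ.smooth hK hL hJK hJL hx
      (hdet x hx), fun x hx => ?_⟩
  rw [LinearIndependent.pair_iff]
  intro k l hkl
  have h1 : jac Φ x *ᵥ (k • K x + l • L x) = 0 := by rw [hkl, Matrix.mulVec_zero]
  rw [Matrix.mulVec_add, Matrix.mulVec_smul, Matrix.mulVec_smul, hJK x hx, hJL x hx] at h1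
  have h2 := congrFun h1 1
  have h3 := congrFun h1 2
  simp at h2 h3
  exact ⟨h2, h3⟩

/-- The AdS pp-wave in the coordinate `τ = log ρ`. -/
lemma blockMetric_pullsBack_ppWave {ℓ ν s s₂ : ℝ} :
    PullsBack (fun y => ![exp (y 0), y 1, y 2]) (blockMetric (ℓ ^ 2 / 4)
      (fun t => s * exp ((1 - 3 * ν * s₂) / 2 * t)) (fun t => 1 / 2 * exp t) fun _ => 0)
      (ppWave ℓ ν s s₂) univ := by
  refine ⟨contDiffOn_univ.2 (contDiff_pi.2 fun i => ?_), fun y _ => ?_⟩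
  · match i with
    | 0 => exact (contDiff_apply ℝ ℝ (0 : Fin 3)).exp
    | 1 => exact contDiff_apply ℝ ℝ (1 : Fin 3)
    | 2 => exact contDiff_apply ℝ ℝ (2 : Fin 3)
  · have hj : jac (fun y : Fin 3 → ℝ => ![exp (y 0), y 1, y 2]) y =
        !![exp (y 0), 0, 0; 0, 1, 0; 0, 0, 1] := by
      have h0 := fun i => pd_comp_coord (x := y) i 0 (Real.hasDerivAt_exp _)
      ext i j
      fin_cases i <;> fin_cases j <;> simp [jac, h0, pd_coord]
    have h1 : exp ((1 - 3 * ν * s₂) / 2 * y 0) = exp (y 0) ^ ((1 - 3 * ν * s₂) / 2) := by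
      rw [← Real.exp_mul, mul_comm]
    have h2 := exp_pos (y 0)
    rw [hj]
    ext i j
    fin_cases i <;> fin_cases j <;>
      simp [blockMetric, ppWave, Matrix.mul_apply, Fin.sum_univ_three, h1] <;> field_simp

/-- In the third case the field strength is a single exponential, whether or not `α = 1`. -/
lemma ansatzF_zero_zero {s μ α t : ℝ} :
    ansatzF s μ α 0 0 t = 2 * s * μ * ((1 - 2 * α) / (2 * α - 3)) * exp ((2 * α - 1) * t) := by
  rw [ansatzF]
  split_ifs with h
  · subst h
    rw [show ((1 : ℝ) - 2 * 1) / (2 * 1 - 3) = 1 by norm_num, show (2 * 1 - 1) * t = t by ring]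
    ring
  · ring

/-- In the third case the normal form of the metric is the AdS pp-wave in the coordinate
`log ρ = (2 α + 1) φ`; it does not depend on `z` and `t`, and its traceless Ricci tensor is
nilpotent and vanishes only for `ν = ±1/3`. -/
theorem IsAnsatz.case3_geometry {s ℓ ν α s₂ : ℝ} {U : Set (Fin 2 → ℝ)} {gb : MetricField 2}
    {φ : (Fin 2 → ℝ) → ℝ} {A : OneForm 2} (h : IsAnsatz s U gb φ) (hs : s = 1 ∨ s = -1)
    (hℓ : 0 < ℓ) (hν : ν ≠ 0) (hα : 2 * α - 3 ≠ 0) (hs₂ : s₂ = 1 ∨ s₂ = -1)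
    (hνα : 3 * ν * s₂ * (2 * α + 1) = 2 * α - 3)
    (hn : ∀ x ∈ U, normSqDiff gb φ x = profile3 (3 * ν / ℓ) α (φ x))
    (hA : IsPotential U gb (fun x => ansatzF s (3 * ν / ℓ) α 0 0 (φ x)) A) :
    LocallyIsometric (kkMetric s α gb φ A) (cylinder U) (ppWave ℓ ν s s₂) halfSpace ∧
      HasTwoCommutingIsometries (kkMetric s α gb φ A) (cylinder U) ∧
      (ν ≠ 1 / 3 ∧ ν ≠ -1 / 3 → PetrovN (kkMetric s α gb φ A) (cylinder U)) := by
  have hs2 : s ^ 2 = 1 := by rcases hs with rfl | rfl <;> norm_num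
  have hs22 : s₂ ^ 2 = 1 := by rcases hs₂ with rfl | rfl <;> norm_num
  have hs0 : s ≠ 0 := by rcases hs with rfl | rfl <;> norm_num
  have hα1 : 2 * α + 1 ≠ 0 := by
    intro h0
    rw [h0, mul_zero] at hνα
    exact hα hνα.symm
  have hF : ∀ t, HasDerivAt (fun t => -(6 * s * ν) / (ℓ * (2 * α - 3)) * exp ((2 * α - 1) * t))
      (ansatzF s (3 * ν / ℓ) α 0 0 t) t := fun t => by
    rw [ansatzF_zero_zero]
    refine ((hasDerivAt_exp_mul (2 * α - 1) t).const_mul _).congr_deriv ?_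
    field_simp
    ring
  have hd := kkMetric_det_ne_zero (α := α) (φ := φ) (A := A) hs0 h.metric
  have hr : (1 - 3 * ν * s₂) / 2 * (2 * α + 1) = 2 := by linear_combination (-1 / 2) * hνα
  have hΘ : PullsBack (fun y => ![(2 * α + 1) * y 0, 0 * y 1 + 1 * y 2 + 0,
      -(12 * ν / (ℓ * (2 * α - 3))) * y 1 + 0 * y 2 + 0])
      (kkModel s α (profile3 (3 * ν / ℓ) α)
        fun t => -(6 * s * ν) / (ℓ * (2 * α - 3)) * exp ((2 * α - 1) * t))
      (blockMetric (ℓ ^ 2 / 4) (fun t => s * exp ((1 - 3 * ν * s₂) / 2 * t))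
        (fun t => 1 / 2 * exp t) fun _ => 0) {y | y 0 ∈ univ} := by
    refine kkModel_pullsBack_blockMetric (θ := fun t => (2 * α + 1) * t) (by fun_prop)
      (fun t _ => ((hasDerivAt_id t).const_mul _).congr_deriv (mul_one _)) ?_ ?_ ?_ ?_
    · intro t _
      rw [profile3]
      have := exp_pos (2 * α * t)
      field_simp
      rw [← hνα]
      linear_combination (9 * ν ^ 2 * (2 * α + 1) ^ 2) * hs22
    · intro t _
      have e1 : exp (2 * α * t) * exp (2 * α * t) =
          exp (2 * t) * exp (t * (2 * α - 1)) ^ 2 := by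
        rw [← exp_add, ← exp_nat_mul, ← exp_add]
        ring_nf
      rw [profile3]
      field_simp
      linear_combination (-36 * ν ^ 2 * s) * e1 +
        (36 * ν ^ 2 * s * exp (2 * t) * exp (t * (2 * α - 1)) ^ 2) * hs2
    · intro t _
      have e1 : exp (2 * t) * exp (t * (2 * α - 1)) = exp ((2 * α + 1) * t) := by
        rw [← exp_add]
        ring_nf
      rw [← e1]
      field_simp
      linear_combination (-12 * ν * exp (2 * t) * exp (t * (2 * α - 1))) * hs2
    · intro t _
      have e1 : (1 - 3 * ν * s₂) / 2 * ((2 * α + 1) * t) = 2 * t := by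
        rw [← mul_assoc, hr]
      simp only [e1]
      ring
  have key : ∀ p ∈ cylinder U, ∃ (N : Set (Fin 3 → ℝ)) (Ψ : (Fin 3 → ℝ) → Fin 3 → ℝ),
      IsOpen N ∧ p ∈ N ∧ N ⊆ cylinder U ∧ PullsBack Ψ (kkMetric s α gb φ A)
        (blockMetric (ℓ ^ 2 / 4) (fun t => s * exp ((1 - 3 * ν * s₂) / 2 * t))
          (fun t => 1 / 2 * exp t) fun _ => 0) N := by
    intro p hp
    obtain ⟨N, Ψ, hN, hpN, hNU, -, hΨ⟩ :=
      h.exists_pullsBack_of_kkModel (α := α) hs hn (by fun_prop) hF hA hp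
    exact ⟨N, _, hN, hpN, hNU, hΘ.comp hΨ hN (by simp) fun _ _ => mem_univ _⟩
  refine ⟨locallyIsometric_of_pullsBack hd fun p hp => ?_,
    hasTwoCommutingIsometries_of_blockMetric (by fun_prop) (by fun_prop) (by fun_prop) hd key,
    fun hν3 => hasCanonicalForm_of_pullsBack hd fun p hp => ?_⟩
  · obtain ⟨N, Ψ, hN, hpN, hNU, hΨ⟩ := key p hp
    exact ⟨N, _, hN, hpN, hNU, fun y _ => exp_pos (Ψ y 0),
      blockMetric_pullsBack_ppWave.comp hΨ hN isOpen_univ (mapsTo_univ _ _)⟩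
  · obtain ⟨N, Ψ, hN, hpN, hNU, hΨ⟩ := key p hp
    obtain ⟨r, hr'⟩ : ∃ r, r = (1 - 3 * ν * s₂) / 2 := ⟨_, rfl⟩
    obtain ⟨σ, hσ⟩ : ∃ σ, σ = -(4 * s * r * (r - 1) / ℓ ^ 2) * exp (r * Ψ p 0) * exp (-Ψ p 0) :=
      ⟨_, rfl⟩
    have hσ0 : σ ≠ 0 := by
      have h1 : r * (r - 1) = 9 / 4 * ((ν - 1 / 3) * (ν - -1 / 3)) := by
        rw [hr']
        linear_combination (9 / 4 * ν ^ 2) * hs22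
      have h2 : r * (r - 1) ≠ 0 := by
        rw [h1]
        exact mul_ne_zero (by norm_num) (mul_ne_zero (sub_ne_zero.2 hν3.1) (sub_ne_zero.2 hν3.2))
      rw [hσ, show 4 * s * r * (r - 1) = 4 * s * (r * (r - 1)) by ring]
      have := exp_pos (r * Ψ p 0)
      have := exp_pos (-Ψ p 0)
      exact mul_ne_zero (mul_ne_zero (neg_ne_zero.2 (by positivity)) (by positivity))
        (by positivity)
    -- the tensor maps `∂_u` to `σ ∂_v`, and `∂_v` and `∂_τ` to zero
    refine ⟨N, Ψ, _, hN, hpN, hNU, hΨ, !![0, 0, 1; 0, 1, 0; σ, 0, 0], ?_, ?_⟩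
    · simp [Matrix.det_fin_three, hσ0]
    · rw [← hr', tracelessRicci_block_ppWave hℓ.ne', ← hσ]
      ext i j
      fin_cases i <;> fin_cases j <;> simp [Matrix.mul_apply, Fin.sum_univ_three]

end TMG

theorem mainTheorem1 (s ℓ μ ν α c kt δ : ℝ) (hs : s = 1 ∨ s = -1) (hℓ : 0 < ℓ) (hμ : μ ≠ 0)
    (hν : μ = 3 * ν / ℓ) (hα : α ≠ 3 / 2) :
    -- the equations are consistent exactly in the three cases
    ((∃ (U : Set (Fin 2 → ℝ)) (gb : TMG.MetricField 2) (φ : (Fin 2 → ℝ) → ℝ),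
        U.Nonempty ∧ TMG.IsAnsatz s U gb φ ∧
          TMG.ReducedTMG s ℓ μ α c U gb φ (fun x => TMG.ansatzF s μ α kt δ (φ x))) ↔
      TMG.Case1 α δ ∨ TMG.Case2 α c kt δ ∨ TMG.Case3 ℓ μ α c kt δ) ∧
    -- in each case they amount to the respective expression for the norm of the gradient
    (∀ (U : Set (Fin 2 → ℝ)) (gb : TMG.MetricField 2) (φ : (Fin 2 → ℝ) → ℝ),
      TMG.IsAnsatz s U gb φ →
        (TMG.Case1 α δ →
          (TMG.ReducedTMG s ℓ μ α c U gb φ (fun x => TMG.ansatzF s μ α kt δ (φ x)) ↔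
            ∀ x ∈ U, TMG.normSqDiff gb φ x = TMG.profile1 s ℓ μ c kt (φ x))) ∧
        (TMG.Case2 α c kt δ →
          (TMG.ReducedTMG s ℓ μ α c U gb φ (fun x => TMG.ansatzF s μ α kt δ (φ x)) ↔
            ∀ x ∈ U, TMG.normSqDiff gb φ x = TMG.profile2 s ℓ μ δ (φ x))) ∧
        (TMG.Case3 ℓ μ α c kt δ →
          (TMG.ReducedTMG s ℓ μ α c U gb φ (fun x => TMG.ansatzF s μ α kt δ (φ x)) ↔
            ∀ x ∈ U, TMG.normSqDiff gb φ x = TMG.profile3 μ α (φ x)))) ∧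
    -- the local geometry of the three-dimensional metric in each case
    (∀ (U : Set (Fin 2 → ℝ)) (gb : TMG.MetricField 2) (φ : (Fin 2 → ℝ) → ℝ) (A : TMG.OneForm 2),
      TMG.IsAnsatz s U gb φ →
      TMG.ReducedTMG s ℓ μ α c U gb φ (fun x => TMG.ansatzF s μ α kt δ (φ x)) →
      TMG.IsPotential U gb (fun x => TMG.ansatzF s μ α kt δ (φ x)) A →
        (TMG.Case1 α δ →
          TMG.LocallyAdS3 ℓ (TMG.kkMetric s α gb φ A) (TMG.cylinder U) ∧
          TMG.PetrovO (TMG.kkMetric s α gb φ A) (TMG.cylinder U)) ∧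
        (TMG.Case2 α c kt δ → ν ^ 2 ≠ 1 →
          (∃ ε : ℝ, (ε = 1 ∨ ε = -1) ∧ 0 < ε * (s * (ν ^ 2 - 1)) ∧
            TMG.LocallyIsometric (TMG.kkMetric s α gb φ A) (TMG.cylinder U)
              (TMG.warpedAdS3 ℓ ν ε) TMG.halfSpace) ∧
          TMG.PetrovD ((ν ^ 2 - 1) / ℓ ^ 2) (TMG.kkMetric s α gb φ A) (TMG.cylinder U)) ∧
        (TMG.Case3 ℓ μ α c kt δ →
          (∃ s₂ : ℝ, (s₂ = 1 ∨ s₂ = -1) ∧ 3 * ν * s₂ * (2 * α + 1) = 2 * α - 3 ∧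
            TMG.LocallyIsometric (TMG.kkMetric s α gb φ A) (TMG.cylinder U)
              (TMG.ppWave ℓ ν s s₂) TMG.halfSpace) ∧
          TMG.HasTwoCommutingIsometries (TMG.kkMetric s α gb φ A) (TMG.cylinder U) ∧
          (ν ≠ 1 / 3 ∧ ν ≠ -1 / 3 →
            TMG.PetrovN (TMG.kkMetric s α gb φ A) (TMG.cylinder U)) ∧
          (ν = 1 / 3 ∨ ν = -1 / 3 →
            TMG.LocallyAdS3 ℓ (TMG.kkMetric s α gb φ A) (TMG.cylinder U)))) := by
  have hs2 : s ^ 2 = 1 := by rcases hs with rfl | rfl <;> norm_num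
  have hν0 : ν ≠ 0 := fun h0 => hμ (by rw [hν, h0]; simp)
  have hα3 : 2 * α - 3 ≠ 0 := fun h0 => hα (by linarith)
  refine ⟨⟨?_, TMG.exists_solution hs hμ hℓ.ne' hα⟩, fun U gb φ h =>
    ⟨h.reducedTMG_iff_case1 hs2 hμ, h.reducedTMG_iff_case2 hs2 hμ,
      h.reducedTMG_iff_case3 hs2 hμ hℓ.ne' hα⟩, fun U gb φ A h H hA => ?_⟩
  · rintro ⟨U, gb, φ, hne, h, H⟩
    exact h.consistency hne hs2 hμ hℓ.ne' hα H
  have hcase1 : TMG.Case1 α δ → TMG.LocallyAdS3 ℓ (TMG.kkMetric s α gb φ A) (TMG.cylinder U) ∧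
      TMG.PetrovO (TMG.kkMetric s α gb φ A) (TMG.cylinder U) := fun hc => by
    have hn := (h.reducedTMG_iff_case1 hs2 hμ hc).1 H
    obtain ⟨rfl, rfl⟩ := hc
    exact h.case1_geometry hs hℓ hn hA
  refine ⟨hcase1, fun hc hν1 => ?_, fun hc => ?_⟩
  · have hn := (h.reducedTMG_iff_case2 hs2 hμ hc).1 H
    obtain ⟨-, rfl, rfl⟩ := hc
    subst hν
    have hs0 : s ≠ 0 := by rcases hs with rfl | rfl <;> norm_num
    obtain ⟨ε, hε, hεs⟩ : ∃ ε : ℝ, (ε = 1 ∨ ε = -1) ∧ 0 < ε * (s * (ν ^ 2 - 1)) := by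
      rcases (mul_ne_zero hs0 (sub_ne_zero.2 hν1)).lt_or_gt with h0 | h0
      · exact ⟨-1, Or.inr rfl, by linarith⟩
      · exact ⟨1, Or.inl rfl, by linarith⟩
    obtain ⟨h1, h2⟩ := h.case2_geometry hs hℓ hν0 hε hεs hn hA
    exact ⟨⟨ε, hε, hεs, h1⟩, h2⟩
  · have hn := (h.reducedTMG_iff_case3 hs2 hμ hℓ.ne' hα hc).1 H
    have hsq : (3 * ν * (2 * α + 1)) ^ 2 = (2 * α - 3) ^ 2 := by
      rw [← hc.2.2.2, hν]
      field_simp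
    -- for `ν = ±1/3` the relation between the parameters forces `α = 1/2`, the first case
    have hflat : ν = 1 / 3 ∨ ν = -1 / 3 →
        TMG.LocallyAdS3 ℓ (TMG.kkMetric s α gb φ A) (TMG.cylinder U) := fun hν3 => by
      refine (hcase1 ⟨hc.1, ?_⟩).1
      rcases hν3 with h0 | h0 <;> rw [h0] at hsq <;> linarith
    obtain ⟨rfl, rfl, rfl, -⟩ := hc
    subst hν
    obtain ⟨s₂, hs₂, hνα⟩ : ∃ s₂ : ℝ, (s₂ = 1 ∨ s₂ = -1) ∧
        3 * ν * s₂ * (2 * α + 1) = 2 * α - 3 := by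
      rcases sq_eq_sq_iff_eq_or_eq_neg.1 hsq with h0 | h0
      · exact ⟨1, Or.inl rfl, by linarith⟩
      · exact ⟨-1, Or.inr rfl, by linarith⟩
    obtain ⟨h1, h2, h3⟩ := h.case3_geometry hs hℓ hν0 hα3 hs₂ hνα hn hA
    exact ⟨⟨s₂, hs₂, hνα, h1⟩, h2, h3, hflat⟩
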